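/- \textbf{Conventions.} Surfaces are topological and Hausdorff; $S$ is a compact connected oriented surface with non-empty boundary and $P\subseteq S$. A $0$-handle is a closed disc; a $1$-handle is an oriented square $[-1,1]\times[-1,1]$ with attaching intervals $[-1,1]\times\{\pm1\}$ and co-core $[-1,1]\times\{0\}$. \textbf{Handle structures.} A handle structure compatible with $(S,P)$ consists of disjoint $0$-handles $D_1,\dots,D_d$ and $1$-handles $R_1,\dots,R_r,P_1,\dots,P_p$ embedded in $S$, compatibly with the orientation of $S$, such that $S$ is obtained from $D_1\cup\dots\cup D_d$ by successively attaching $R_1,\dots,R_r$ (the result being $R=\overline{S\setminus P}$) and then $P_1,\dots,P_p$, where $P=P_1\cup\dots\cup P_p$. Each $1$-handle meets the union of the earlier handles exactly in its two attaching intervals. These lie in the boundary of a $0$-handle or in a side $\{\pm1\}\times(-1,1)$ of an earlier $1$-handle. They avoid the attaching intervals of the other handles, the corners where handles meet, and the end points of the co-cores. ($d\ge 1$; $r$ and $p$ may be $0$.) \textbf{Slices.} A slice is a finite collection of oriented circles decorated at $2(r+p)+q$ distinct points, namely with $r$ unordered pairs called antecedent pairs, $p$ unordered pairs called primary pairs,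 and $q$ further points called markers. A slice of a handle structure as above consists of the circles of $\partial S$ with the boundary orientation, the antecedent pairs given by the end points of the co-cores of the $R_i$, the primary pairs given by the end points of the co-cores of the $P_j$, and one marker in each arc of $\partial S\setminus\partial P$ (that is, in each component of $\partial S\setminus\partial P$ that is not an entire circle of $\partial S$). An isomorphism of slices is an orientation-preserving homeomorphism between the collections of circles that carries the antecedent pairs, the primary pairs and the markers of one bijectively to those of the other. \textbf{Lemma (slices determine pairs).} Let $(S,P)$ and $(S',P')$ be pairs as above with compatible handle structures. If these handle structures have isomorphic slices, then there is a homeomorphism $f:S\to S'$ with $f(P)=P'$. -/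

import Mathlib

open Set Filter Topology
open scoped Manifold

noncomputable section

namespace SurfaceSlices

/-! ### Oriented surfaces

A topological surface with boundary is a space charted on `EuclideanHalfSpace 2`, the half-plane
`{x : 0 ≤ x 0}` with its standard orientation; `(𝓡∂ 2).boundary S` is its boundary. -/

/-- `g` is defined near `x` and has local degree `+1` there: it carries small circles
around `x`, run through once anticlockwise, to loops of winding number `+1` around `g x`. -/
def HasLocalDegreeOneAt (g : EuclideanSpace ℝ (Fin 2) → EuclideanSpace ℝ (Fin 2))
    (x : EuclideanSpace ℝ (Fin 2)) : Prop :=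
  ∃ ε > 0, ∀ ρ : ℝ, 0 < ρ → ρ < ε → ∃ θ : ℝ → ℝ,
    ContinuousOn θ (Icc 0 (2 * Real.pi)) ∧
    (∀ t ∈ Icc 0 (2 * Real.pi),
      let v := g (x + ρ • !₂[Real.cos t, Real.sin t]) - g x
      v ≠ 0 ∧ v = ‖v‖ • !₂[Real.cos (θ t), Real.sin (θ t)]) ∧
    θ (2 * Real.pi) = θ 0 + 2 * Real.pi

/-- An oriented surface: all coordinate changes of the given atlas preserve orientation,
that is, they have local degree `+1` at the points of the open half-plane. -/
class OrientedSurface (S : Type*) [TopologicalSpace S]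
    [ChartedSpace (EuclideanHalfSpace 2) S] : Prop where
  oriented : ∀ e ∈ atlas (EuclideanHalfSpace 2) S, ∀ e' ∈ atlas (EuclideanHalfSpace 2) S,
    ∀ x ∈ e.source ∩ e'.source, 0 < (e x).1 0 →
      HasLocalDegreeOneAt ((e'.extend (𝓡∂ 2)) ∘ (e.extend (𝓡∂ 2)).symm) (e.extend (𝓡∂ 2) x)

section

variable {S : Type*} [TopologicalSpace S] [ChartedSpace (EuclideanHalfSpace 2) S]

/-- The curve `c` follows, near the parameter `t`, the boundary of the oriented surface `S` in the
direction of the boundary orientation. (Outward normal first: the boundary of `{x : 0 ≤ x 0}` is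
run through in the direction of decreasing `x 1`, so that the surface lies on the left.) -/
def IsPositiveBoundaryCurveAt (c : ℝ → S) (t : ℝ) : Prop :=
  (∀ᶠ s in 𝓝 t, c s ∈ (𝓡∂ 2).boundary S) ∧
  ∀ e ∈ atlas (EuclideanHalfSpace 2) S, c t ∈ e.source →
    ∃ δ > 0, StrictAntiOn (fun s => (e (c s)).1 1) (Ioo (t - δ) (t + δ))

/-- The boundary, as a surface, of a subsurface `P` of `S`. -/
def subsurfaceBoundary (P : Set S) : Set S :=
  frontier P ∪ (P ∩ (𝓡∂ 2).boundary S)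

/-- The arcs of `∂S \ ∂P`: its connected components, other than entire circles of `∂S`. -/
def complementaryArcs (P : Set S) : Set (Set S) :=
  {C | ∃ x ∈ (𝓡∂ 2).boundary S \ subsurfaceBoundary P,
    C = connectedComponentIn ((𝓡∂ 2).boundary S \ subsurfaceBoundary P) x ∧
    C ≠ connectedComponentIn ((𝓡∂ 2).boundary S) x}

end

/-! ### Handles -/

/-- The model `1`-handle `[-1,1] × [-1,1]`. Its core is `{0} × [-1,1]`
and its co-core is `[-1,1] × {0}`. -/
def square : Set (ℝ × ℝ) := Icc (-1) 1 ×ˢ Icc (-1) 1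

/-- The attaching intervals `[-1,1] × {-1,1}` of the model `1`-handle are the
sets `foot (-1)` and `foot 1`. -/
def foot (η : ℝ) : Set (ℝ × ℝ) := Icc (-1) 1 ×ˢ {η}

/-- Both attaching intervals of the model `1`-handle. -/
def feet : Set (ℝ × ℝ) := foot (-1) ∪ foot 1

/-- The side `{σ} × (-1,1)` of the model `1`-handle without the end point of the co-core. -/
def side (σ : ℝ) : Set (ℝ × ℝ) := {σ} ×ˢ (Ioo (-1) 0 ∪ Ioo 0 1)

/-- A handle structure compatible with the pair `(S, P)`, together with a handle decomposition of
`R`, the closure of `S \ P`: the surface `S` is obtained from `d` disjoint `0`-handles by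
successively attaching `1`-handles `R_1, …, R_r`, which gives `R`, and then `1`-handles
`P_1, …, P_p`, whose union is `P`. The handles are given by their parametrizations, of which only
the values on the closed unit disc and on `square` matter. -/
structure HandleStructure {S : Type*} [TopologicalSpace S]
    [ChartedSpace (EuclideanHalfSpace 2) S] (P : Set S) where
  /-- number of `0`-handles -/
  d : ℕ
  /-- number of `1`-handles of `R` -/
  r : ℕ
  /-- number of `1`-handles of `P` -/
  p : ℕ
  /-- the `0`-handles -/
  zero : Fin d → ℂ → S
  /-- the `1`-handles, in the order `R_1, …, R_r, P_1, …, P_p` of attachment -/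
  one : Fin (r + p) → ℝ × ℝ → S
  zero_continuousOn : ∀ k, ContinuousOn (zero k) (Metric.closedBall 0 1)
  zero_injOn : ∀ k, InjOn (zero k) (Metric.closedBall 0 1)
  zero_disjoint : ∀ k l, k ≠ l →
    Disjoint (zero k '' Metric.closedBall 0 1) (zero l '' Metric.closedBall 0 1)
  one_continuousOn : ∀ i, ContinuousOn (one i) square
  one_injOn : ∀ i, InjOn (one i) square
  /-- Each `1`-handle meets the union of the earlier handles exactly in its attaching intervals. -/
  attach : ∀ i, one i '' square ∩
      ((⋃ k, zero k '' Metric.closedBall 0 1) ∪ ⋃ j, ⋃ (_ : j < i), one j '' square) =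
    one i '' feet
  /-- Each attaching interval lies in the boundary circle of a `0`-handle or in a side of an
  earlier `1`-handle, away from the corners and from the end points of co-cores. -/
  foot_mem : ∀ i, ∀ η ∈ ({-1, 1} : Set ℝ),
    (∃ k, one i '' foot η ⊆ zero k '' Metric.sphere 0 1) ∨
    (∃ j, j < i ∧ ∃ σ ∈ ({-1, 1} : Set ℝ), one i '' foot η ⊆ one j '' side σ)
  /-- Attaching intervals of different handles are disjoint. -/
  feet_disjoint : ∀ i j, i ≠ j → Disjoint (one i '' feet) (one j '' feet)
  /-- The handles make up `S`. -/
  cover : (⋃ k, zero k '' Metric.closedBall 0 1) ∪ (⋃ i, one i '' square) = univ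
  /-- The last `p` of the `1`-handles make up `P`. -/
  eq_P : P = ⋃ j : Fin p, one (Fin.natAdd r j) '' square
  /-- The `0`-handles carry the orientation of `S`: their boundary circles, run through
  anticlockwise, agree with the boundary orientation of `S` where they run in `∂S`. -/
  zero_oriented : ∀ k t, (∀ᶠ s in 𝓝 t, zero k (Circle.exp s) ∈ (𝓡∂ 2).boundary S) →
    IsPositiveBoundaryCurveAt (fun s => zero k (Circle.exp s)) t
  /-- The `1`-handles carry the orientation of `S`: right side. -/
  right_oriented : ∀ i, ∀ t ∈ Ioo (-1 : ℝ) 1,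
    (∀ᶠ s in 𝓝 t, one i (1, s) ∈ (𝓡∂ 2).boundary S) →
    IsPositiveBoundaryCurveAt (fun s => one i (1, s)) t
  /-- The `1`-handles carry the orientation of `S`: left side. -/
  left_oriented : ∀ i, ∀ t ∈ Ioo (-1 : ℝ) 1,
    (∀ᶠ s in 𝓝 t, one i (-1, -s) ∈ (𝓡∂ 2).boundary S) →
    IsPositiveBoundaryCurveAt (fun s => one i (-1, -s)) t

/-- The pair of end points of the co-core of the `i`-th `1`-handle. -/
def HandleStructure.cocoreEnds {S : Type*} [TopologicalSpace S]
    [ChartedSpace (EuclideanHalfSpace 2) S] {P : Set S} (H : HandleStructure P)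
    (i : Fin (H.r + H.p)) : Set S :=
  {H.one i (-1, 0), H.one i (1, 0)}

/-! ### Slices -/

/-- A slice: `n` circles, oriented anticlockwise, decorated at `2(r+p)+q` distinct points with
`r` antecedent pairs, `p` primary pairs and `q` markers. -/
structure Slice where
  /-- number of circles -/
  n : ℕ
  /-- number of antecedent pairs -/
  r : ℕ
  /-- number of primary pairs -/
  p : ℕ
  /-- number of markers -/
  q : ℕ
  antecedent : Fin r → Fin 2 → Fin n × Circle
  primary : Fin p → Fin 2 → Fin n × Circle
  marker : Fin q → Fin n × Circle
  distinct : Function.Injective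
    (Sum.elim (Function.uncurry antecedent) (Sum.elim (Function.uncurry primary) marker))

namespace Slice

/-- The (unordered) antecedent pairs. -/
def antecedentPairs (A : Slice) : Set (Set (Fin A.n × Circle)) :=
  range fun i => range (A.antecedent i)

/-- The (unordered) primary pairs. -/
def primaryPairs (A : Slice) : Set (Set (Fin A.n × Circle)) :=
  range fun i => range (A.primary i)

/-- Two slices are isomorphic if there is an orientation-preserving homeomorphism between their
collections of circles that carries antecedent pairs to antecedent pairs, primary pairs to primary
pairs and markers to markers, bijectively. -/
def Isomorphic (A B : Slice) : Prop :=
  ∃ f : (Fin A.n × Circle) ≃ₜ (Fin B.n × Circle),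
    (∀ i, ∃ j, ∃ g : ℝ → ℝ, Continuous g ∧ StrictMono g ∧
      ∀ t, f (i, Circle.exp t) = (j, Circle.exp (g t))) ∧
    image f '' A.antecedentPairs = B.antecedentPairs ∧
    image f '' A.primaryPairs = B.primaryPairs ∧
    f '' range A.marker = range B.marker

end Slice

/-- `A` is a slice of the handle structure `H` on `(S, P)`: its oriented circles are those
of `∂S`, the antecedent pairs are the end points of the co-cores of the `R_i`, the primary pairs
are the end points of the co-cores of the `P_j`, and there is one marker in each arc
of `∂S \ ∂P`. -/
def HandleStructure.IsSlice {S : Type*} [TopologicalSpace S]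
    [ChartedSpace (EuclideanHalfSpace 2) S] {P : Set S} (H : HandleStructure P)
    (A : Slice) : Prop :=
  ∃ φ : (Fin A.n × Circle) ≃ₜ (𝓡∂ 2).boundary S,
    (∀ i t, IsPositiveBoundaryCurveAt (fun s => (φ (i, Circle.exp s) : S)) t) ∧
    image (fun z => (φ z : S)) '' A.antecedentPairs =
      range (fun i : Fin H.r => H.cocoreEnds (Fin.castAdd H.p i)) ∧
    image (fun z => (φ z : S)) '' A.primaryPairs =
      range (fun j : Fin H.p => H.cocoreEnds (Fin.natAdd H.r j)) ∧
    (∀ m, ∃ C ∈ complementaryArcs P, (φ (A.marker m) : S) ∈ C) ∧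
    (∀ C ∈ complementaryArcs P, ∃! m, (φ (A.marker m) : S) ∈ C)

end SurfaceSlices

end

/-! A handle structure turns `S` into a ribbon surface: disjoint closed discs joined by bands. Such
a surface is determined by the order in which the sides of the bands follow one another along the
boundary. Let `flip` pass to the other side of the same band and `nx` to the next side on the same
boundary circle. Around the rim of a disc, feet of bands alternate with free boundary edges, and the
step from one foot to the next is `flip ∘ nx`. Hence the discs are the orbits of `flip ∘ nx`, and a
bijection of sides that commutes with `flip` and `nx` induces a homeomorphism
(`Ribbon.Frame.exists_homeo`): rims are matched piece by piece, discs by coning, bands up to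
rotation by π.

A slice shows only the end points of co-cores and the markers. Each `1`-handle is therefore cut into
five strips (`HandleStructure.exists_ribbon`): a core band around the co-core, a rectangle on each
side of it, and a collar at each foot. Later handles are attached to the rectangles only, so
`0`-handles and rectangles serve as discs, cores and collars as bands. A collar joins two different
discs and can be contracted. Contracting those whose feet lie on the same side of the division
between `P` and the rest (`MarkedRibbon.exists_reduced`) leaves only collars that separate `P` from
its complement, and every disc contains the inner foot of at most one of them.

The remaining collars are invisible in the slice but can be recovered
(`Diagram.CoreIso.exists_extension`). Between consecutive core points of different kinds, primary
and antecedent, there is exactly one collar side; between two antecedent points there is none;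
between two primary points there is either none or one where the boundary leaves `P` and one where
it reenters, and a marker tells these two cases apart. This gives the collar sides and `nx`. A
leaving and an entering side belong to the same collar when they meet the same disc of `P`, and this
is traced by `flip ∘ nx` through primary sides alone.

The link with the manifold boundary is a local criterion: a point with a disc neighbourhood does not
look like an edge point of a convex set (`IsDiscPt.not_isHalfPt`). It is proved by lifting loops
through the exponential and decides which points of discs and bands lie on the boundary. The
orientation clauses make all sides run in the positive direction. Without any bands `S` is a disc
and `P` is empty. -/

namespace SurfaceSlices

/-! ### Gluing maps along finite closed covers -/

/-- Two spaces covered by finitely many compact pieces with the same identifications. -/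
theorem exists_glue {ι T X Y : Type*} [Finite ι] [TopologicalSpace T] [T2Space T]
    [TopologicalSpace X] [T2Space X] [TopologicalSpace Y] [Nonempty Y]
    {K : ι → Set T} (hK : ∀ a, IsCompact (K a)) {p : ι → T → X} {q : ι → T → Y}
    (hp : ∀ a, ContinuousOn (p a) (K a)) (hq : ∀ a, ContinuousOn (q a) (K a))
    (h : ∀ a b, ∀ s ∈ K a, ∀ t ∈ K b, p a s = p b t ↔ q a s = q b t) :
    ∃ F : X → Y, ContinuousOn F (⋃ a, p a '' K a) ∧ InjOn F (⋃ a, p a '' K a) ∧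
      ∀ a, ∀ s ∈ K a, F (p a s) = q a s := by
  classical
  -- Any preimage may be chosen, since `h` makes the value independent of it. The value off the
  -- union plays no role.
  let F : X → Y := fun x =>
    if hx : ∃ as : ι × T, as.2 ∈ K as.1 ∧ p as.1 as.2 = x then
      q hx.choose.1 hx.choose.2 else Classical.arbitrary Y
  have hF : ∀ a, ∀ s ∈ K a, F (p a s) = q a s := by
    intro a s hs
    have hx : ∃ as : ι × T, as.2 ∈ K as.1 ∧ p as.1 as.2 = p a s := ⟨(a, s), hs, rfl⟩
    simp only [F, dif_pos hx]
    exact (h _ _ _ hx.choose_spec.1 _ hs).1 hx.choose_spec.2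
  refine ⟨F, ?_, ?_, hF⟩
  · rw [continuousOn_iff_isClosed]
    intro Z hZ
    -- On the union the preimage of `Z` is a finite union of images of compact sets, which is closed
    -- because `X` is Hausdorff.
    refine ⟨⋃ a, p a '' (K a ∩ q a ⁻¹' Z), ?_, ?_⟩
    · refine isClosed_iUnion_of_finite fun a => ?_
      have h1 : IsClosed (K a ∩ q a ⁻¹' Z) := (hq a).preimage_isClosed_of_isClosed (hK a).isClosed hZ
      have h2 : IsCompact (K a ∩ q a ⁻¹' Z) := (hK a).of_isClosed_subset h1 inter_subset_left
      exact (h2.image_of_continuousOn ((hp a).mono inter_subset_left)).isClosed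
    · ext x
      simp only [mem_inter_iff, mem_preimage, mem_iUnion, mem_image]
      constructor
      · rintro ⟨hx, a, s, hs, rfl⟩
        refine ⟨⟨a, s, ⟨hs, ?_⟩, rfl⟩, a, s, hs, rfl⟩
        rwa [hF a s hs] at hx
      · rintro ⟨⟨a, s, ⟨hs, hsZ⟩, rfl⟩, hx⟩
        refine ⟨?_, hx⟩
        rwa [hF a s hs]
  · intro x hx y hy hxy
    simp only [mem_iUnion, mem_image] at hx hy
    obtain ⟨a, s, hs, rfl⟩ := hx
    obtain ⟨b, t, ht, rfl⟩ := hy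
    rw [hF a s hs, hF b t ht] at hxy
    exact (h a b s hs t ht).2 hxy

/-- An injective continuous map on a compact set has a continuous left inverse. -/
theorem exists_leftInv {T X : Type*} [TopologicalSpace T] [T2Space T] [Nonempty T]
    [TopologicalSpace X] [T2Space X]
    {K : Set T} (hK : IsCompact K) {p : T → X} (hp : ContinuousOn p K) (hi : InjOn p K) :
    ∃ g : X → T, ContinuousOn g (p '' K) ∧ ∀ s ∈ K, g (p s) = s := by
  obtain ⟨F, h1, -, h3⟩ := exists_glue (ι := Unit) (K := fun _ => K) (fun _ => hK)
    (p := fun _ => p) (q := fun _ => id) (fun _ => hp) (fun _ => continuousOn_id)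
    (fun _ _ s hs t ht => hi.eq_iff hs ht)
  exact ⟨F, by rwa [iUnion_const] at h1, h3 ()⟩

/-! ### The square and its boundary -/

/-- The boundary of the square. -/
abbrev rim : Set (ℝ × ℝ) := Metric.sphere 0 1

theorem square_eq_closedBall : square = Metric.closedBall (0 : ℝ × ℝ) 1 := by
  ext ⟨x, y⟩
  simp only [square, mem_prod, mem_Icc, Metric.mem_closedBall, dist_zero_right, Prod.norm_def,
    Real.norm_eq_abs, max_le_iff, abs_le]

theorem isCompact_square : IsCompact square := isCompact_Icc.prod isCompact_Icc

theorem isCompact_rim : IsCompact rim := isCompact_sphere _ _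

theorem mem_square {z : ℝ × ℝ} : z ∈ square ↔ |z.1| ≤ 1 ∧ |z.2| ≤ 1 := by
  simp only [square, mem_prod, mem_Icc, abs_le]

theorem mem_rim {z : ℝ × ℝ} : z ∈ rim ↔ max |z.1| |z.2| = 1 := by
  simp [rim, Prod.norm_def]

theorem rim_subset_square : rim ⊆ square := by
  rw [square_eq_closedBall]; exact Metric.sphere_subset_closedBall

theorem mem_rim_of_fst {x y : ℝ} (hx : |x| = 1) (hy : |y| ≤ 1) : (x, y) ∈ rim := by
  simp [hx, hy]

theorem mem_rim_of_snd {x y : ℝ} (hx : |x| ≤ 1) (hy : |y| = 1) : (x, y) ∈ rim := by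
  simp [hx, hy]

theorem mem_rim_iff {z : ℝ × ℝ} : z ∈ rim ↔ z ∈ square ∧ (|z.1| = 1 ∨ |z.2| = 1) := by
  rw [mem_rim, mem_square]
  constructor
  · intro h
    have h1 := le_max_left |z.1| |z.2|
    have h2 := le_max_right |z.1| |z.2|
    refine ⟨⟨by linarith, by linarith⟩, ?_⟩
    rcases max_choice |z.1| |z.2| with h3 | h3
    · left; linarith
    · right; linarith
  · rintro ⟨⟨h1, h2⟩, h | h⟩
    · rw [h]; exact max_eq_left h2
    · rw [h]; exact max_eq_right h1

/-- A homeomorphism of the boundary of the square extends to the square. -/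
theorem exists_cone {f : ℝ × ℝ → ℝ × ℝ} (hf : ContinuousOn f rim) (hi : InjOn f rim)
    (him : f '' rim = rim) :
    ∃ g : ℝ × ℝ → ℝ × ℝ, ContinuousOn g square ∧ InjOn g square ∧ g '' square = square ∧
      EqOn g f rim := by
  have hmaps : MapsTo f rim rim := fun z hz => him ▸ mem_image_of_mem f hz
  have hN : ∀ z : ℝ × ℝ, z ≠ 0 → ‖z‖⁻¹ • z ∈ rim := by
    intro z hz
    have : ‖z‖ ≠ 0 := norm_ne_zero_iff.2 hz
    simp [rim, norm_smul, this]
  -- Radial extension. In the sup norm the spheres are concentric squares, and `g` preserves the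
  -- norm, which gives continuity at `0`.
  let g : ℝ × ℝ → ℝ × ℝ := fun z => ‖z‖ • f (‖z‖⁻¹ • z)
  have hnorm : ∀ z, ‖g z‖ = ‖z‖ := by
    intro z
    by_cases hz : z = 0
    · simp [g, hz]
    · have : ‖f (‖z‖⁻¹ • z)‖ = 1 := by simpa [rim] using hmaps (hN z hz)
      simp [g, norm_smul, this]
  have hg0 : g 0 = 0 := by simp [g]
  refine ⟨g, ?_, ?_, ?_, ?_⟩
  · intro z _
    by_cases hz : z = 0
    · subst hz
      apply ContinuousAt.continuousWithinAt
      unfold ContinuousAt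
      rw [hg0, tendsto_zero_iff_norm_tendsto_zero]
      simp only [hnorm]
      simpa using (continuous_norm (E := ℝ × ℝ)).tendsto 0
    · apply ContinuousAt.continuousWithinAt
      have h1 : ContinuousOn (fun z : ℝ × ℝ => ‖z‖⁻¹ • z) {0}ᶜ := by
        refine ContinuousOn.smul (f := fun z : ℝ × ℝ => ‖z‖⁻¹) (g := fun z => z) ?_ continuousOn_id
        exact continuous_norm.continuousOn.inv₀ fun z hz => norm_ne_zero_iff.2 hz
      have h2 : ContinuousOn g {0}ᶜ :=
        continuous_norm.continuousOn.smul (hf.comp h1 fun z hz => hN z hz)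
      exact h2.continuousAt (isOpen_compl_singleton.mem_nhds hz)
  · intro z _ w _ hzw
    have hn : ‖z‖ = ‖w‖ := by rw [← hnorm z, ← hnorm w, hzw]
    by_cases hz : z = 0
    · subst hz
      simpa [eq_comm] using hn
    · have hw : w ≠ 0 := by
        rintro rfl
        apply hz
        simpa using hn
      have hz' : ‖w‖ ≠ 0 := norm_ne_zero_iff.2 hw
      simp only [g] at hzw
      rw [hn] at hzw
      have h1 := smul_right_injective _ hz' hzw
      have h2 := hi (hn ▸ hN z hz) (hN w hw) h1
      exact smul_right_injective _ (inv_ne_zero hz') h2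
  · rw [square_eq_closedBall]
    apply Subset.antisymm
    · rintro _ ⟨z, hz, rfl⟩
      simpa [hnorm] using hz
    · intro w hw
      by_cases hw0 : w = 0
      · exact ⟨0, by simp, by rw [hg0, hw0]⟩
      · have hw' : ‖w‖ ≠ 0 := norm_ne_zero_iff.2 hw0
        obtain ⟨u, hu, huw⟩ : ‖w‖⁻¹ • w ∈ f '' rim := by rw [him]; exact hN w hw0
        have hu1 : ‖u‖ = 1 := by simpa [rim] using hu
        have hn : ‖(‖w‖ • u)‖ = ‖w‖ := by simp [norm_smul, hu1]
        refine ⟨‖w‖ • u, by simpa [hn] using hw, ?_⟩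
        simp only [g, hn]
        rw [smul_smul, inv_mul_cancel₀ hw', one_smul, huw, smul_smul, mul_inv_cancel₀ hw',
          one_smul]
  · intro z hz
    have : ‖z‖ = 1 := by simpa [rim] using hz
    simp [g, this]

/-! ### Arcs in circles -/

/-- The path is extended to the whole line by its end values and then lifted through the covering
`Circle.exp`. -/
theorem exists_circle_lift {z : ℝ → Circle} {a b : ℝ} (hab : a ≤ b)
    (hz : ContinuousOn z (Icc a b)) :
    ∃ θ : ℝ → ℝ, ContinuousOn θ (Icc a b) ∧ ∀ t ∈ Icc a b, Circle.exp (θ t) = z t := by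
  let f : C(ℝ, Circle) := ⟨IccExtend hab ((Icc a b).domRestrict z), hz.domRestrict.Icc_extend'⟩
  obtain ⟨e, he⟩ : ∃ e, Circle.exp e = f a := ⟨_, Circle.exp_arg (f a)⟩
  obtain ⟨F, ⟨-, hF⟩, -⟩ := Circle.isCoveringMap_exp.existsUnique_continuousMap_lifts (f := f)
    (a₀ := a) (e₀ := e) he
  refine ⟨F, F.continuous.continuousOn, fun t ht => ?_⟩
  have h := congrFun hF t
  simp only [Function.comp_apply] at h
  rw [h]
  simp [f, IccExtend_of_mem hab _ ht]

/-- The point of the boundary of the square in the direction of angle `t`. -/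
noncomputable def rimPt (t : ℝ) : ℝ × ℝ := (max |Real.cos t| |Real.sin t|)⁻¹ • (Real.cos t, Real.sin t)

theorem max_cos_sin_pos (t : ℝ) : 0 < max |Real.cos t| |Real.sin t| := by
  by_contra h
  push Not at h
  have h1 := (le_max_left _ _).trans h
  have h2 := (le_max_right _ _).trans h
  have h3 := abs_nonpos_iff.1 h1
  have h4 := abs_nonpos_iff.1 h2
  have := Real.cos_sq_add_sin_sq t
  rw [h3, h4] at this
  norm_num at this

theorem continuous_rimPt : Continuous rimPt := by
  unfold rimPt
  have : ∀ t, max |Real.cos t| |Real.sin t| ≠ 0 := fun t => (max_cos_sin_pos t).ne'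
  fun_prop (disch := assumption)

theorem rimPt_mem (t : ℝ) : rimPt t ∈ rim := by
  have h := max_cos_sin_pos t
  have : ‖((Real.cos t, Real.sin t) : ℝ × ℝ)‖ = max |Real.cos t| |Real.sin t| := by
    simp [Prod.norm_def]
  simp only [rim, rimPt, mem_sphere_zero_iff_norm, norm_smul, this, norm_inv, Real.norm_eq_abs,
    abs_of_pos h]
  exact inv_mul_cancel₀ h.ne'

/-- The direction of a non-zero vector. -/
noncomputable def direction (z : ℝ × ℝ) (hz : z ≠ 0) : Circle :=
  ⟨(⟨z.1, z.2⟩ : ℂ) / (‖(⟨z.1, z.2⟩ : ℂ)‖ : ℂ), by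
    have : (⟨z.1, z.2⟩ : ℂ) ≠ 0 := by
      intro h
      apply hz
      have h1 := congrArg Complex.re h
      have h2 := congrArg Complex.im h
      exact Prod.ext h1 h2
    simp [Submonoid.unitSphere, this]⟩

theorem rim_ne_zero {z : ℝ × ℝ} (hz : z ∈ rim) : z ≠ 0 := by
  rintro rfl
  simp [rim] at hz

theorem rimPt_eq_of_exp {z : ℝ × ℝ} (hz : z ∈ rim) {t : ℝ}
    (h : Circle.exp t = direction z (rim_ne_zero hz)) : rimPt t = z := by
  have h0 : (⟨z.1, z.2⟩ : ℂ) ≠ 0 := by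
    intro h
    apply rim_ne_zero hz
    exact Prod.ext (congrArg Complex.re h) (congrArg Complex.im h)
  set r : ℝ := ‖(⟨z.1, z.2⟩ : ℂ)‖ with hr
  have hr0 : 0 < r := norm_pos_iff.2 h0
  have h1 : (Circle.exp t : ℂ) = (⟨z.1, z.2⟩ : ℂ) / (r : ℂ) := congrArg Subtype.val h
  rw [Circle.coe_exp, Complex.exp_mul_I] at h1
  have h2 := congrArg Complex.re h1
  have h3 := congrArg Complex.im h1
  rw [Complex.div_ofReal_re] at h2
  rw [Complex.div_ofReal_im] at h3
  simp [Complex.cos_ofReal_re, Complex.sin_ofReal_re] at h2 h3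
  have hz1 := mem_rim.1 hz
  have : max |Real.cos t| |Real.sin t| = r⁻¹ := by
    rw [h2, h3, abs_div, abs_div, abs_of_pos hr0, max_div_div_right hr0.le, hz1, one_div]
  simp only [rimPt, this, inv_inv]
  rw [h2, h3]
  ext
  · simp only [Prod.smul_mk, smul_eq_mul]; field_simp
  · simp only [Prod.smul_mk, smul_eq_mul]; field_simp

theorem rimPt_eq_iff {s t : ℝ} : rimPt s = rimPt t ↔ Circle.exp s = Circle.exp t := by
  constructor
  · intro h
    have hs := max_cos_sin_pos s
    have ht := max_cos_sin_pos t
    set a := max |Real.cos s| |Real.sin s| with ha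
    set b := max |Real.cos t| |Real.sin t| with hb
    have h1 : a⁻¹ * Real.cos s = b⁻¹ * Real.cos t := congrArg Prod.fst h
    have h2 : a⁻¹ * Real.sin s = b⁻¹ * Real.sin t := congrArg Prod.snd h
    have h3 : (a⁻¹)^2 = (b⁻¹)^2 := by
      have e1 := Real.cos_sq_add_sin_sq s
      have e2 := Real.cos_sq_add_sin_sq t
      calc (a⁻¹)^2 = (a⁻¹ * Real.cos s)^2 + (a⁻¹ * Real.sin s)^2 := by
            rw [mul_pow, mul_pow, ← mul_add, e1, mul_one]
        _ = (b⁻¹)^2 := by rw [h1, h2, mul_pow, mul_pow, ← mul_add, e2, mul_one]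
    have h4 : a⁻¹ = b⁻¹ := by
      rwa [sq_eq_sq₀ (by positivity) (by positivity)] at h3
    have hb0 : b⁻¹ ≠ 0 := by positivity
    rw [h4] at h1 h2
    have h5 := mul_left_cancel₀ hb0 h1
    have h6 := mul_left_cancel₀ hb0 h2
    apply Circle.ext
    rw [Circle.coe_exp, Circle.coe_exp, Complex.exp_mul_I, Complex.exp_mul_I,
      ← Complex.ofReal_cos, ← Complex.ofReal_cos, ← Complex.ofReal_sin, ← Complex.ofReal_sin, h5, h6]
  · intro h
    have h1 : (Circle.exp s : ℂ) = Circle.exp t := congrArg Subtype.val h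
    rw [Circle.coe_exp, Circle.coe_exp, Complex.exp_mul_I, Complex.exp_mul_I] at h1
    have h2 := congrArg Complex.re h1
    have h3 := congrArg Complex.im h1
    simp [Complex.cos_ofReal_re, Complex.sin_ofReal_re] at h2 h3
    simp only [rimPt, h2, h3]

/-- Radial projection identifies the rim with the unit circle, where paths have continuous angles.
-/
theorem exists_rim_lift {γ : ℝ → ℝ × ℝ} {a b : ℝ} (hab : a ≤ b) (hγ : ContinuousOn γ (Icc a b))
    (hm : ∀ t ∈ Icc a b, γ t ∈ rim) :
    ∃ θ : ℝ → ℝ, ContinuousOn θ (Icc a b) ∧ ∀ t ∈ Icc a b, rimPt (θ t) = γ t := by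
  classical
  let z : ℝ → Circle := fun t => if h : t ∈ Icc a b then direction (γ t) (rim_ne_zero (hm t h)) else 1
  have hz : ContinuousOn z (Icc a b) := by
    have hind : Topology.IsInducing (fun u : Circle => (u : ℂ)) := ⟨rfl⟩
    rw [hind.continuousOn_iff]
    have h1 : ContinuousOn (fun t => (⟨(γ t).1, (γ t).2⟩ : ℂ)) (Icc a b) :=
      Complex.equivRealProdCLM.symm.continuous.comp_continuousOn hγ
    have h2 : ContinuousOn (fun t => (⟨(γ t).1, (γ t).2⟩ : ℂ) / (‖(⟨(γ t).1, (γ t).2⟩ : ℂ)‖ : ℂ))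
        (Icc a b) := by
      refine h1.div (Complex.continuous_ofReal.comp_continuousOn h1.norm) fun t ht => ?_
      simp only [ne_eq, Complex.ofReal_eq_zero, norm_eq_zero]
      intro h
      exact rim_ne_zero (hm t ht) (Prod.ext (congrArg Complex.re h) (congrArg Complex.im h))
    refine h2.congr fun t ht => ?_
    have : z t = direction (γ t) (rim_ne_zero (hm t ht)) := dif_pos ht
    simp only [Function.comp_apply, this]
    rfl
  obtain ⟨θ, h1, h2⟩ := exists_circle_lift hab hz
  refine ⟨θ, h1, fun t ht => rimPt_eq_of_exp (hm t ht) ?_⟩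
  rw [h2 t ht]
  simp only [z, dif_pos ht]

theorem exists_angle {z : ℝ × ℝ} (hz : z ∈ rim) : ∃ t, rimPt t = z := by
  obtain ⟨θ, -, h⟩ := exists_rim_lift (γ := fun _ => z) (le_refl (0:ℝ)) continuousOn_const
    (fun _ _ => hz)
  exact ⟨θ 0, h 0 (by simp)⟩

theorem rimPt_eq_iff' {s t : ℝ} : rimPt s = rimPt t ↔ ∃ k : ℤ, s = t + k * (2 * Real.pi) := by
  rw [rimPt_eq_iff, Circle.exp_eq_exp]

theorem int_eq_zero_of_abs_lt {k : ℤ} {c : ℝ} (hc : 0 < c) (h : |k * c| < c) : k = 0 := by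
  rw [abs_mul, abs_of_pos hc] at h
  have h1 : |(k : ℝ)| < 1 := by
    by_contra h2
    push Not at h2
    nlinarith
  have h3 : |k| < 1 := by exact_mod_cast h1
  exact Int.abs_lt_one_iff.1 h3

/-- In terms of angles the given arc rises from `θ (-1)` to `θ 1` by less than a full turn. The rest
of the rim is run through downwards, from `θ (-1)` to `θ 1 - 2π`, so that both arcs have the same
end point at `-1` and at `1`. -/
theorem exists_complementary_arc_of_mono {γ : ℝ → ℝ × ℝ} {θ : ℝ → ℝ}
    (hθ : ContinuousOn θ (Icc (-1) 1)) (hmono : StrictMonoOn θ (Icc (-1) 1))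
    (hγ : ∀ t ∈ Icc (-1 : ℝ) 1, rimPt (θ t) = γ t) (hi : InjOn γ (Icc (-1) 1)) :
    ∃ δ : ℝ → ℝ × ℝ, ContinuousOn δ (Icc (-1) 1) ∧ InjOn δ (Icc (-1) 1) ∧
      (∀ t ∈ Icc (-1 : ℝ) 1, δ t ∈ rim) ∧
      (∀ s ∈ Icc (-1 : ℝ) 1, ∀ t ∈ Icc (-1 : ℝ) 1, γ s = δ t ↔ s = t ∧ (s = -1 ∨ s = 1)) ∧
      rim ⊆ γ '' Icc (-1) 1 ∪ δ '' Icc (-1) 1 := by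
  have hπ := Real.two_pi_pos
  have m1 : (-1 : ℝ) ∈ Icc (-1 : ℝ) 1 := by constructor <;> norm_num
  have p1 : (1 : ℝ) ∈ Icc (-1 : ℝ) 1 := by constructor <;> norm_num
  have hab : θ (-1) < θ 1 := hmono m1 p1 (by norm_num)
  have hivt : Icc (θ (-1)) (θ 1) ⊆ θ '' Icc (-1) 1 := intermediate_value_Icc (by norm_num) hθ
  -- After a full turn `γ` would come back to its starting point, against injectivity.
  have hlt : θ 1 < θ (-1) + 2 * Real.pi := by
    by_contra h
    push Not at h
    obtain ⟨t, ht, he⟩ := hivt (show θ (-1) + 2 * Real.pi ∈ _ from ⟨by linarith, h⟩)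
    have h2 : γ t = γ (-1) := by
      rw [← hγ t ht, ← hγ _ m1, rimPt_eq_iff']
      exact ⟨1, by rw [he]; push_cast; ring⟩
    have h3 := hi ht m1 h2
    rw [h3] at he
    linarith
  have hbd : ∀ t ∈ Icc (-1 : ℝ) 1, θ (-1) ≤ θ t ∧ θ t ≤ θ 1 := fun t ht =>
    ⟨hmono.monotoneOn m1 ht ht.1, hmono.monotoneOn ht p1 ht.2⟩
  generalize ha : θ (-1) = a at *
  generalize hb : θ 1 = b at *
  -- The affine angle function with value `a` at `-1` and `b - 2π` at `1`.
  set m : ℝ → ℝ := fun x => (1 - x) / 2 * a + (1 + x) / 2 * (b - 2 * Real.pi) with hm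
  have hm1 : ∀ t ∈ Icc (-1 : ℝ) 1, b - 2 * Real.pi ≤ m t ∧ m t ≤ a := by
    intro t ht
    constructor
    · simp only [hm]; nlinarith [ht.1, ht.2]
    · simp only [hm]; nlinarith [ht.1, ht.2]
  have hminj : ∀ s t, m s = m t → s = t := by
    intro s t h
    have : (s - t) * (a - (b - 2 * Real.pi)) = 0 := by simp only [hm] at h; linarith
    rcases mul_eq_zero.1 this with h1 | h1 <;> linarith
  have hma : m (-1) = a := by simp [hm]
  have hmb : m 1 = b - 2 * Real.pi := by simp [hm]
  refine ⟨fun x => rimPt (m x), ?_, ?_, fun t _ => rimPt_mem _, ?_, ?_⟩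
  · refine (continuous_rimPt.comp ?_).continuousOn
    simp only [hm]
    fun_prop
  · intro s hs t ht h
    obtain ⟨k, hk⟩ := rimPt_eq_iff'.1 h
    have h1 := hm1 s hs
    have h2 := hm1 t ht
    have hk0 : k = 0 := int_eq_zero_of_abs_lt hπ (by rw [abs_lt]; constructor <;> linarith)
    apply hminj
    simpa [hk0] using hk
  · intro s hs t ht
    constructor
    · intro h
      rw [← hγ s hs, rimPt_eq_iff'] at h
      obtain ⟨k, hk⟩ := h
      have h1 := hm1 t ht
      have h2 := hbd s hs
      have hk1 : (0 : ℝ) ≤ k * (2 * Real.pi) := by linarith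
      have hk2 : (k : ℝ) * (2 * Real.pi) ≤ 2 * Real.pi := by linarith
      have hk3 : (0 : ℝ) ≤ k := by
        by_contra h; push Not at h; nlinarith
      have hk4 : (k : ℝ) ≤ 1 := by
        by_contra h; push Not at h; nlinarith
      have hk3' : 0 ≤ k := by exact_mod_cast hk3
      have hk4' : k ≤ 1 := by exact_mod_cast hk4
      -- Angles in `[a, b]` and in `[b - 2π, a]` agree modulo `2π` only at the common end `a`, where
      -- `k = 0`, or as `b` and `b - 2π`, where `k = 1`.
      obtain rfl | rfl : k = 0 ∨ k = 1 := by omega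
      · simp only [Int.cast_zero, zero_mul, add_zero] at hk
        have h3 : θ s = θ (-1) := by linarith
        have h4 : m t = m (-1) := by linarith
        have h5 := hmono.injOn hs m1 h3
        have h6 := hminj _ _ h4
        exact ⟨by rw [h5, h6], Or.inl h5⟩
      · simp only [Int.cast_one, one_mul] at hk
        have h3 : θ s = θ 1 := by linarith
        have h4 : m t = m 1 := by linarith
        have h5 := hmono.injOn hs p1 h3
        have h6 := hminj _ _ h4
        exact ⟨by rw [h5, h6], Or.inr h5⟩
    · rintro ⟨rfl, rfl | rfl⟩
      · rw [← hγ _ m1, ha]; exact congrArg rimPt hma.symm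
      · rw [← hγ _ p1]
        refine rimPt_eq_iff'.2 ⟨1, ?_⟩
        rw [hmb, hb]; push_cast; ring
  · intro z hz
    obtain ⟨u, rfl⟩ := exists_angle hz
    obtain ⟨v, hv, hvu⟩ : ∃ v ∈ Ico (b - 2 * Real.pi) (b - 2 * Real.pi + 2 * Real.pi),
        rimPt v = rimPt u := by
      refine ⟨toIcoMod hπ (b - 2 * Real.pi) u, toIcoMod_mem_Ico hπ _ _, ?_⟩
      rw [rimPt_eq_iff']
      exact ⟨-toIcoDiv hπ (b - 2 * Real.pi) u, by simp [toIcoMod]; ring⟩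
    rw [← hvu]
    rcases le_total a v with h | h
    · left
      obtain ⟨t, ht, he⟩ := hivt (show v ∈ Icc a b from ⟨h, by linarith [hv.2]⟩)
      exact ⟨t, ht, by rw [← hγ t ht, he]⟩
    · right
      have hd : 0 < a - (b - 2 * Real.pi) := by linarith
      refine ⟨(2 * (a - v) - (a - (b - 2 * Real.pi))) / (a - (b - 2 * Real.pi)), ⟨?_, ?_⟩, ?_⟩
      · rw [le_div_iff₀ hd]; linarith
      · rw [div_le_iff₀ hd]; linarith [hv.1]
      · refine congrArg rimPt ?_
        simp only [hm]
        generalize hD : b - 2 * Real.pi = D at hd ⊢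
        have : a - D ≠ 0 := hd.ne'
        field_simp
        ring

/-- A lifted angle is injective, hence strictly monotone; the decreasing case becomes the increasing
one after reversal of the parameter. -/
theorem exists_complementary_arc {γ : ℝ → ℝ × ℝ} (hc : ContinuousOn γ (Icc (-1) 1))
    (hi : InjOn γ (Icc (-1) 1)) (hγ : ∀ t ∈ Icc (-1 : ℝ) 1, γ t ∈ rim) :
    ∃ δ : ℝ → ℝ × ℝ, ContinuousOn δ (Icc (-1) 1) ∧ InjOn δ (Icc (-1) 1) ∧
      (∀ t ∈ Icc (-1 : ℝ) 1, δ t ∈ rim) ∧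
      (∀ s ∈ Icc (-1 : ℝ) 1, ∀ t ∈ Icc (-1 : ℝ) 1, γ s = δ t ↔ s = t ∧ (s = -1 ∨ s = 1)) ∧
      rim ⊆ γ '' Icc (-1) 1 ∪ δ '' Icc (-1) 1 := by
  obtain ⟨θ, h1, h2⟩ := exists_rim_lift (by norm_num) hc hγ
  have hθi : InjOn θ (Icc (-1) 1) := by
    intro s hs t ht h
    apply hi hs ht
    rw [← h2 s hs, ← h2 t ht, h]
  rcases h1.strictMonoOn_of_injOn_Icc' (by norm_num) hθi with hm | hm
  · exact exists_complementary_arc_of_mono h1 hm h2 hi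
  · have hneg : MapsTo (fun x : ℝ => -x) (Icc (-1) 1) (Icc (-1) 1) := by
      intro x hx
      exact ⟨by linarith [hx.2], by linarith [hx.1]⟩
    have hneg2 : (fun x : ℝ => -x) '' Icc (-1) 1 = Icc (-1) 1 := by simp
    obtain ⟨δ, a1, a2, a3, a4, a5⟩ := exists_complementary_arc_of_mono
      (γ := fun x => γ (-x)) (θ := fun x => θ (-x)) (h1.comp continuousOn_neg hneg)
      (fun s hs t ht hst => hm (hneg ht) (hneg hs) (by simpa using hst))
      (fun t ht => h2 _ (hneg ht)) (fun s hs t ht h => neg_injective (hi (hneg hs) (hneg ht) h))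
    refine ⟨fun x => δ (-x), a1.comp continuousOn_neg hneg,
      fun s hs t ht h => neg_injective (a2 (hneg hs) (hneg ht) h), fun t ht => a3 _ (hneg ht), ?_, ?_⟩
    · intro s hs t ht
      have := a4 _ (hneg hs) _ (hneg ht)
      simp only [neg_neg, neg_inj] at this
      rw [this, neg_eq_iff_eq_neg, or_comm]
    · have e1 : (fun x => γ (-x)) '' Icc (-1) 1 = γ '' Icc (-1) 1 := by
        rw [← hneg2, image_image]; simp
      have e2 : (fun x => δ (-x)) '' Icc (-1) 1 = δ '' Icc (-1) 1 := by
        conv_rhs => rw [← hneg2, image_image]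
      rw [e2]
      rwa [e1] at a5

/-- A homeomorphism of the boundary of the square with prescribed values on the top edge. -/
theorem exists_rim_map {γ : ℝ → ℝ × ℝ} (hc : ContinuousOn γ (Icc (-1) 1))
    (hi : InjOn γ (Icc (-1) 1)) (hγ : ∀ t ∈ Icc (-1 : ℝ) 1, γ t ∈ rim) :
    ∃ f : ℝ × ℝ → ℝ × ℝ, ContinuousOn f rim ∧ InjOn f rim ∧ f '' rim = rim ∧
      ∀ x ∈ Icc (-1 : ℝ) 1, f (x, 1) = γ x := by
  obtain ⟨δ, a1, a2, a3, a4, a5⟩ := exists_complementary_arc hc hi hγ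
  have hγ0 : ∀ t ∈ Icc (-1 : ℝ) 1, (t, (1 : ℝ)) ∈ rim := fun t ht =>
    mem_rim_of_snd (abs_le.2 ht) (by simp)
  obtain ⟨δ₀, b1, b2, b3, b4, b5⟩ := exists_complementary_arc (γ := fun x => (x, (1 : ℝ)))
    (by fun_prop) (fun s _ t _ h => congrArg Prod.fst h) hγ0
  -- The rim is the union of two arcs in two ways: top edge and complement, `γ` and complement. The
  -- incidences are the same, so the arcs can be matched.
  obtain ⟨F, f1, f2, f3⟩ := exists_glue (ι := Bool) (K := fun _ => Icc (-1 : ℝ) 1)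
    (p := fun b => if b then fun x => (x, (1 : ℝ)) else δ₀) (q := fun b => if b then γ else δ)
    (fun _ => isCompact_Icc)
    (by rintro (_ | _) <;> simp only [Bool.false_eq_true, if_true, if_false]; exacts [b1, by fun_prop])
    (by rintro (_ | _) <;> simp only [Bool.false_eq_true, if_true, if_false]; exacts [a1, hc])
    (by
      rintro (_ | _) (_ | _) s hs t ht <;> simp only [Bool.false_eq_true, if_true, if_false]
      · rw [a2.eq_iff hs ht, b2.eq_iff hs ht]
      · rw [eq_comm, b4 t ht s hs, eq_comm (a := δ s), a4 t ht s hs]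
      · rw [b4 s hs t ht, a4 s hs t ht]
      · rw [hi.eq_iff hs ht]; simp)
  have hU : (⋃ b : Bool, (fun b => if b then fun x => (x, (1 : ℝ)) else δ₀ : Bool → ℝ → ℝ × ℝ) b ''
      Icc (-1) 1) = rim := by
    apply Subset.antisymm
    · refine iUnion_subset ?_
      rintro (_ | _)
      · rintro _ ⟨t, ht, rfl⟩; exact b3 t ht
      · rintro _ ⟨t, ht, rfl⟩; exact hγ0 t ht
    · intro z hz
      rcases b5 hz with h | h
      · exact mem_iUnion.2 ⟨true, h⟩
      · exact mem_iUnion.2 ⟨false, h⟩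
  rw [hU] at f1 f2
  refine ⟨F, f1, f2, ?_, fun x hx => f3 true x hx⟩
  rw [← hU, image_iUnion]
  apply Subset.antisymm
  · refine iUnion_subset ?_
    rw [hU]
    rintro (_ | _)
    · rintro _ ⟨_, ⟨t, ht, rfl⟩, rfl⟩
      rw [f3 false t ht]; exact a3 t ht
    · rintro _ ⟨_, ⟨t, ht, rfl⟩, rfl⟩
      rw [f3 true t ht]; exact hγ t ht
  · rw [hU]
    intro z hz
    rcases a5 hz with ⟨t, ht, rfl⟩ | ⟨t, ht, rfl⟩
    · exact mem_iUnion.2 ⟨true, _, ⟨t, ht, rfl⟩, f3 true t ht⟩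
    · exact mem_iUnion.2 ⟨false, _, ⟨t, ht, rfl⟩, f3 false t ht⟩

/-! ### Reparametrizing and stacking discs -/

section

variable {S : Type*} [TopologicalSpace S]

/-- A disc can be reparametrized so that its top edge is a given arc in its boundary. -/
theorem exists_reparam [T2Space S] {ψ : ℝ × ℝ → S} (hψ : ContinuousOn ψ square) (hψi : InjOn ψ square)
    {γ : ℝ → S} (hγ : ContinuousOn γ (Icc (-1) 1)) (hγi : InjOn γ (Icc (-1) 1))
    (hm : ∀ x ∈ Icc (-1 : ℝ) 1, γ x ∈ ψ '' rim) :
    ∃ h : ℝ × ℝ → S, ContinuousOn h square ∧ InjOn h square ∧ h '' square = ψ '' square ∧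
      h '' rim = ψ '' rim ∧ ∀ x ∈ Icc (-1 : ℝ) 1, h (x, 1) = γ x := by
  obtain ⟨g, g1, g2⟩ := exists_leftInv isCompact_square hψ hψi
  have hg : ∀ x ∈ Icc (-1 : ℝ) 1, g (γ x) ∈ rim ∧ ψ (g (γ x)) = γ x := by
    intro x hx
    obtain ⟨z, hz, he⟩ := hm x hx
    rw [← he, g2 z (rim_subset_square hz)]
    exact ⟨hz, rfl⟩
  -- `γ` is pulled back to the rim of the parameter square; a rim homeomorphism taking the top edge
  -- to it is then coned off.
  obtain ⟨f, f1, f2, f3, f4⟩ := exists_rim_map (γ := g ∘ γ)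
    (g1.comp hγ fun x hx => image_mono rim_subset_square (hm x hx))
    (fun x hx y hy h => hγi hx hy (by
      have h' : g (γ x) = g (γ y) := h
      rw [← (hg x hx).2, ← (hg y hy).2, h'])) (fun x hx => (hg x hx).1)
  obtain ⟨k, k1, k2, k3, k4⟩ := exists_cone f1 f2 f3
  have kmaps : MapsTo k square square := fun z hz => k3 ▸ mem_image_of_mem k hz
  refine ⟨ψ ∘ k, hψ.comp k1 kmaps, hψi.comp k2 kmaps, by rw [image_comp, k3], ?_, ?_⟩
  · rw [image_comp, k4.image_eq, f3]
  · intro x hx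
    have : (x, (1 : ℝ)) ∈ rim := mem_rim_of_snd (abs_le.2 hx) (by simp)
    simp only [Function.comp_apply]
    rw [k4 this, f4 x hx]
    exact (hg x hx).2

/-- Stacking one disc on another along a common edge. -/
theorem exists_stack {h₁ h₂ : ℝ × ℝ → S} (c₁ : ContinuousOn h₁ square) (i₁ : InjOn h₁ square)
    (c₂ : ContinuousOn h₂ square) (i₂ : InjOn h₂ square)
    (he : ∀ x ∈ Icc (-1 : ℝ) 1, h₁ (x, 1) = h₂ (x, -1))
    (hs : ∀ s ∈ square, ∀ t ∈ square, h₁ s = h₂ t → s.2 = 1) :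
    ∃ g : ℝ × ℝ → S, ContinuousOn g square ∧ InjOn g square ∧
      g '' square = h₁ '' square ∪ h₂ '' square ∧
      (∀ s ∈ square, g (s.1, (s.2 - 1) / 2) = h₁ s) ∧
      (∀ s ∈ square, g (s.1, (s.2 + 1) / 2) = h₂ s) := by
  have key : ∀ s ∈ square, ∀ t ∈ square,
      ((s.1, (s.2 - 1) / 2) = ((t.1, (t.2 + 1) / 2) : ℝ × ℝ) ↔ h₁ s = h₂ t) := by
    rintro ⟨x, s⟩ hs' ⟨y, t⟩ ht'
    have hs1 := mem_square.1 hs'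
    have ht1 := mem_square.1 ht'
    simp only [abs_le] at hs1 ht1
    simp only [Prod.mk.injEq]
    constructor
    · rintro ⟨rfl, h⟩
      have h1 : s = 1 := by linarith
      have h2 : t = -1 := by linarith
      rw [h1, h2]
      exact he x hs1.1
    · intro h
      have h1 : s = 1 := hs _ hs' _ ht' h
      subst h1
      rw [he x hs1.1] at h
      have h2 := i₂ (mem_square.2 ⟨by simpa [abs_le] using hs1.1, by simp⟩) ht' h
      simp only [Prod.mk.injEq] at h2
      exact ⟨h2.1, by rw [← h2.2]; norm_num⟩
  have : Nonempty S := ⟨h₁ 0⟩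
  -- The two squares are compressed to the lower and upper half of a single square; they meet there
  -- in the same way as the two discs do in `S`.
  obtain ⟨F, f1, f2, f3⟩ := exists_glue (ι := Bool) (K := fun _ => square)
    (p := fun b => if b then fun z : ℝ × ℝ => (z.1, (z.2 - 1) / 2)
      else fun z : ℝ × ℝ => (z.1, (z.2 + 1) / 2)) (q := fun b => if b then h₁ else h₂)
    (fun _ => isCompact_square)
    (by rintro (_ | _) <;> simp only [Bool.false_eq_true, if_true, if_false] <;> fun_prop)
    (by rintro (_ | _) <;> simp only [Bool.false_eq_true, if_true, if_false] <;> assumption)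
    (by
      rintro (_ | _) (_ | _) s hs t ht <;> simp only [Bool.false_eq_true, if_true, if_false]
      · rw [i₂.eq_iff hs ht, Prod.ext_iff, Prod.ext_iff]
        simp
      · rw [eq_comm, key t ht s hs, eq_comm]
      · exact key s hs t ht
      · rw [i₁.eq_iff hs ht, Prod.ext_iff, Prod.ext_iff]
        simp)
  have hU : (⋃ b : Bool, (fun b => if b then fun z : ℝ × ℝ => (z.1, (z.2 - 1) / 2)
      else fun z : ℝ × ℝ => (z.1, (z.2 + 1) / 2) : Bool → ℝ × ℝ → ℝ × ℝ) b '' square) = square := by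
    apply Subset.antisymm
    · refine iUnion_subset ?_
      rintro (_ | _) <;> rintro _ ⟨t, ht, rfl⟩ <;>
        simp only [Bool.false_eq_true, if_true, if_false] <;>
        simp only [mem_square, abs_le] at ht ⊢ <;> refine ⟨ht.1, ?_, ?_⟩ <;> linarith [ht.2.1, ht.2.2]
    · rintro ⟨x, s⟩ hz
      simp only [mem_square, abs_le] at hz
      rcases le_total s 0 with h | h
      · refine mem_iUnion.2 ⟨true, (x, 2 * s + 1), ?_, ?_⟩
        · simp only [mem_square, abs_le]
          refine ⟨hz.1, ?_, ?_⟩ <;> linarith [hz.2.1, hz.2.2]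
        · simp
      · refine mem_iUnion.2 ⟨false, (x, 2 * s - 1), ?_, ?_⟩
        · simp only [mem_square, abs_le]
          refine ⟨hz.1, ?_, ?_⟩ <;> linarith [hz.2.1, hz.2.2]
        · simp
  rw [hU] at f1 f2
  have e1 : ∀ s ∈ square, F (s.1, (s.2 - 1) / 2) = h₁ s := f3 true
  have e2 : ∀ s ∈ square, F (s.1, (s.2 + 1) / 2) = h₂ s := f3 false
  refine ⟨F, f1, f2, ?_, e1, e2⟩
  have h5 := congrArg (image F) hU
  rw [image_iUnion] at h5
  rw [← h5]
  apply Subset.antisymm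
  · refine iUnion_subset ?_
    rintro (_ | _)
    · rintro _ ⟨_, ⟨t, ht, rfl⟩, rfl⟩
      exact Or.inr ⟨t, ht, (e2 t ht).symm⟩
    · rintro _ ⟨_, ⟨t, ht, rfl⟩, rfl⟩
      exact Or.inl ⟨t, ht, (e1 t ht).symm⟩
  · rintro _ (⟨t, ht, rfl⟩ | ⟨t, ht, rfl⟩)
    · exact mem_iUnion.2 ⟨true, _, ⟨t, ht, rfl⟩, e1 t ht⟩
    · exact mem_iUnion.2 ⟨false, _, ⟨t, ht, rfl⟩, e2 t ht⟩

end

/-! ### Interior points and boundary points of a surface -/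

/-- A loop of winding number one is not contractible in the punctured plane. -/
theorem false_of_loop {Y : Set (ℝ × ℝ)} {z : ℝ × ℝ} (hz : z ∈ Y) (hY : StarConvex ℝ z Y)
    {G : ℝ × ℝ → ℂ} (hG : ContinuousOn G Y) (hG0 : ∀ y ∈ Y, G y ≠ 0) {Q : ℝ → ℝ × ℝ}
    (hQ : Continuous Q) (hQY : ∀ t, Q t ∈ Y) (hper : Q (2 * Real.pi) = Q 0) {r : ℝ}
    (hGQ : ∀ t, G (Q t) = r * Complex.exp (t * Complex.I)) : False := by
  have hmem : ∀ st : unitInterval × ℝ, z + (st.1 : ℝ) • (Q st.2 - z) ∈ Y := by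
    intro st
    have := hY (hQY st.2) (a := 1 - (st.1 : ℝ)) (b := st.1) (by linarith [st.1.2.2]) st.1.2.1 (by ring)
    convert this using 1
    rw [smul_sub, sub_smul, one_smul]
    abel
  -- The straight contraction of the loop towards the star centre `z`, followed by `G`.
  let H : C(unitInterval × ℝ, {z : ℂ // z ≠ 0}) :=
    ⟨fun st => ⟨G (z + (st.1 : ℝ) • (Q st.2 - z)), hG0 _ (hmem st)⟩, by
      refine Continuous.subtype_mk ?_ _
      exact hG.comp_continuous (by fun_prop) hmem⟩
  let cov := Complex.isCoveringMap_exp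
  let f : C(ℝ, ℂ) := ContinuousMap.const ℝ (Complex.log (G z))
  have H0 : ∀ a, H (0, a) = ⟨_, (f a).exp_ne_zero⟩ := by
    intro a
    apply Subtype.ext
    simp only [H, f, ContinuousMap.coe_mk, ContinuousMap.const_apply]
    rw [Complex.exp_log (hG0 z hz)]
    simp
  let L := cov.liftHomotopy H f H0
  have hL : ∀ st, Complex.exp (L st) = G (z + (st.1 : ℝ) • (Q st.2 - z)) := by
    intro st
    have := congrFun (cov.liftHomotopy_lifts H f H0) st
    exact congrArg Subtype.val this
  have hL0 : ∀ a, L (0, a) = Complex.log (G z) := fun a => cov.liftHomotopy_zero H f H0 a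
  -- Both are lifts of the same path, because `Q` is closed, and both start at `log (G z)`.
  have h1 : (fun s : unitInterval => L (s, 0)) = fun s : unitInterval => L (s, 2 * Real.pi) := by
    refine cov.eq_of_comp_eq (by fun_prop) (by fun_prop) ?_ 0 (by rw [hL0, hL0])
    funext s
    apply Subtype.ext
    simp only [Function.comp_apply]
    rw [hL, hL, hper]
  -- At stage `1` the lifted loop is known explicitly; it gains `2πi` over one period, which
  -- contradicts `h1`.
  have h2 : (fun t : ℝ => L (1, t)) = fun t : ℝ => L (1, 0) + t * Complex.I := by
    refine cov.eq_of_comp_eq (by fun_prop) (by fun_prop) ?_ 0 (by simp)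
    funext t
    apply Subtype.ext
    simp only [Function.comp_apply]
    rw [Complex.exp_add, hL, hL]
    simp only [Set.Icc.coe_one, one_smul, add_sub_cancel]
    rw [hGQ, hGQ]
    simp
  have h3 := congrFun h1 1
  have h4 := congrFun h2 (2 * Real.pi)
  rw [← h3] at h4
  have h5 : ((2 * Real.pi : ℝ) : ℂ) * Complex.I = 0 := by
    exact left_eq_add.1 h4
  simp [Real.pi_ne_zero] at h5

section

variable {S : Type*} [TopologicalSpace S]

/-- `x` has a neighbourhood in `S` that is an open disc around `x`. -/
def IsDiscPt (x : S) : Prop :=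
  ∃ (r : ℝ) (q : ℂ → S) (g : S → ℂ) (U : Set S), 0 < r ∧ U ∈ 𝓝 x ∧
    ContinuousOn q (Metric.ball 0 r) ∧ q 0 = x ∧ ContinuousOn g U ∧ (∀ y ∈ U, g y = 0 → y = x) ∧
    ∀ w ∈ Metric.ball 0 r, g (q w) = w

/-- `x` has a neighbourhood in `S` that looks like a convex set near one of its edge points. -/
def IsHalfPt (x : S) : Prop :=
  ∃ (K : Set (ℝ × ℝ)) (p z : ℝ × ℝ) (l : ℝ × ℝ →ₗ[ℝ] ℝ) (k : ℝ × ℝ → S) (j : S → ℝ × ℝ)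
    (N : Set S), Convex ℝ K ∧ p ∈ K ∧ z ∈ K ∧ (∀ y ∈ K, l y ≤ l p) ∧ l z < l p ∧
    ContinuousOn k K ∧ InjOn k K ∧ k p = x ∧ N ∈ 𝓝 x ∧ ContinuousOn j N ∧
    ∀ y ∈ N, j y ∈ K ∧ k (j y) = y

/-- A small circle around `x` in the disc chart has winding number one. Seen in the convex model it
is a loop near `p` that misses `p`, and near an edge point a convex set remains star-shaped after
removal of that point, so the loop would be contractible. -/
theorem IsDiscPt.not_isHalfPt {x : S} (hd : IsDiscPt x) : ¬ IsHalfPt x := by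
  rintro ⟨K, p, z, l, k, j, N, hK, hp, hz, hl, hlz, hk, hki, hkp, hN, hj, hjk⟩
  obtain ⟨r, q, g, U, hr, hU, hq, hq0, hg, hg0, hgq⟩ := hd
  obtain ⟨δ, hδ, hδU⟩ : ∃ δ > 0, ∀ y ∈ K, dist y p < δ → k y ∈ U := by
    have h1 : k ⁻¹' U ∈ 𝓝[K] p := hk p hp (by rwa [hkp])
    obtain ⟨δ, hδ, h⟩ := Metric.mem_nhdsWithin_iff.1 h1
    exact ⟨δ, hδ, fun y hy hd => h ⟨hd, hy⟩⟩
  obtain ⟨τ, hτ, hτ1, hτ2⟩ : ∃ τ : ℝ, 0 < τ ∧ τ ≤ 1 ∧ ‖τ • (z - p)‖ < δ := by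
    have hc : Tendsto (fun τ : ℝ => ‖τ • (z - p)‖) (𝓝[>] 0) (𝓝 0) := by
      have : Continuous fun τ : ℝ => ‖τ • (z - p)‖ := by fun_prop
      simpa using (this.tendsto 0).mono_left nhdsWithin_le_nhds
    have h1 := hc.eventually (gt_mem_nhds hδ)
    have h2 : ∀ᶠ τ : ℝ in 𝓝[>] 0, τ ∈ Ioc (0 : ℝ) 1 := Ioc_mem_nhdsGT one_pos
    obtain ⟨τ, h3, h4⟩ := (h1.and h2).exists
    exact ⟨τ, h4.1, h4.2, h3⟩
  -- `z` is moved towards `p` into the ball on which `g ∘ k` is defined; `z'` still satisfies `l z'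
  -- < l p` and serves as star centre.
  set z' := p + τ • (z - p) with hz'
  have hz'K : z' ∈ K := by
    have := hK hp hz (a := 1 - τ) (b := τ) (by linarith) hτ.le (by ring)
    convert this using 1
    rw [hz', smul_sub, sub_smul, one_smul]
    abel
  have hlz' : l z' < l p := by
    rw [hz', map_add, map_smul, map_sub, smul_eq_mul]
    nlinarith
  have hz'b : z' ∈ Metric.ball p δ := by
    rw [mem_ball_iff_norm, hz', add_sub_cancel_left]
    exact hτ2
  have hKb : Convex ℝ (K ∩ Metric.ball p δ) := hK.inter (convex_ball p δ)
  have hjx : j x = p := by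
    have h1 := hjk x (mem_of_mem_nhds hN)
    exact hki h1.1 hp (h1.2.trans hkp.symm)
  have hball : Metric.ball (0 : ℂ) r ∈ 𝓝 (0 : ℂ) := Metric.ball_mem_nhds _ hr
  have hqc : ContinuousAt q 0 := hq.continuousAt hball
  have hqN : ∀ᶠ w in 𝓝 (0 : ℂ), q w ∈ N := hqc (by rwa [hq0])
  have hjc : ContinuousAt j (q 0) := by rw [hq0]; exact hj.continuousAt hN
  have hjq : ∀ᶠ w in 𝓝 (0 : ℂ), j (q w) ∈ Metric.ball p δ := by
    have h1 : Tendsto (fun w => j (q w)) (𝓝 0) (𝓝 (j (q 0))) := (hjc.comp (f := q) hqc)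
    rw [hq0, hjx] at h1
    exact h1 (Metric.ball_mem_nhds _ hδ)
  obtain ⟨ρ, hρ, hρ'⟩ := Metric.eventually_nhds_iff_ball.1 (hqN.and (hjq.and hball))
  have hw : ∀ t : ℝ, ((ρ / 2 : ℝ) : ℂ) * Complex.exp (t * Complex.I) ∈ Metric.ball (0 : ℂ) ρ := by
    intro t
    rw [mem_ball_zero_iff, norm_mul, Complex.norm_exp_ofReal_mul_I, mul_one, Complex.norm_real,
      Real.norm_eq_abs, abs_of_pos (by linarith)]
    linarith
  set W : ℝ → ℂ := fun t => ((ρ / 2 : ℝ) : ℂ) * Complex.exp (t * Complex.I) with hW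
  have hWc : Continuous W := by simp only [hW]; fun_prop
  have hqW : Continuous fun t => q (W t) :=
    hq.comp_continuous hWc fun t => (hρ' _ (hw t)).2.2
  have hqx : ∀ t, j (q (W t)) ≠ p := by
    intro t h
    have h1 := (hjk _ (hρ' _ (hw t)).1).2
    rw [h, hkp] at h1
    have h2 := hgq _ (hρ' _ (hw t)).2.2
    have h3 : g (q 0) = 0 := hgq 0 (by simpa using hr)
    rw [hq0, h1] at h3
    rw [h3] at h2
    have : W t ≠ 0 := by
      simp only [hW]
      refine mul_ne_zero ?_ (Complex.exp_ne_zero _)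
      exact_mod_cast (by linarith : (ρ / 2 : ℝ) ≠ 0 )
    exact this h2.symm
  refine false_of_loop (Y := (K ∩ Metric.ball p δ) \ {p}) (z := z') (G := fun y => g (k y))
    (Q := fun t => j (q (W t))) (r := ρ / 2) ⟨⟨hz'K, hz'b⟩, ?_⟩ ?_ ?_ ?_ ?_ ?_ ?_ ?_
  · intro h
    rw [mem_singleton_iff] at h
    rw [h] at hlz'
    exact lt_irrefl _ hlz'
  · intro y hy a b ha hb hab
    refine ⟨hKb ⟨hz'K, hz'b⟩ hy.1 ha hb hab, ?_⟩
    intro h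
    rw [mem_singleton_iff] at h
    rcases ha.eq_or_lt with h0 | h0
    · rw [← h0, zero_add] at hab
      rw [← h0, hab, zero_smul, zero_add, one_smul] at h
      exact hy.2 h
    -- A segment from `z'` can reach `p` only at its far end: any positive weight on `z'` brings `l`
    -- strictly below `l p`.
    · have h1 := congrArg l h
      rw [map_add, map_smul, map_smul, smul_eq_mul, smul_eq_mul] at h1
      have h2 := hl y hy.1.1
      have h3 : a * l z' + b * l y < a * l p + b * l p := by nlinarith
      rw [h1, ← add_mul, hab, one_mul] at h3
      exact lt_irrefl _ h3
  · refine hg.comp (hk.mono ?_) ?_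
    · exact fun y hy => hy.1.1
    · exact fun y hy => hδU y hy.1.1 hy.1.2
  · intro y hy h
    have h1 := hg0 _ (hδU y hy.1.1 hy.1.2) h
    exact hy.2 (hki hy.1.1 hp (h1.trans hkp.symm))
  · exact hj.comp_continuous hqW fun t => (hρ' _ (hw t)).1
  · intro t
    exact ⟨⟨(hjk _ (hρ' _ (hw t)).1).1, (hρ' _ (hw t)).2.1⟩, hqx t⟩
  · have : W (2 * Real.pi) = W 0 := by
      simp [hW, Complex.exp_two_pi_mul_I]
    simp only [this]
  · intro t
    rw [(hjk _ (hρ' _ (hw t)).1).2, hgq _ (hρ' _ (hw t)).2.2]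

/-- The coordinates of a point of the half-plane. -/
def halfCoords (h : EuclideanHalfSpace 2) : ℝ × ℝ := (h.1 0, h.1 1)

/-- The point of the half-plane with given coordinates. -/
noncomputable def halfPoint (y : ℝ × ℝ) : EuclideanHalfSpace 2 := ⟨!₂[max 0 y.1, y.2], by simp⟩

theorem continuous_halfCoords : Continuous halfCoords := by
  unfold halfCoords
  have h : Continuous fun h : EuclideanHalfSpace 2 => h.1 := continuous_subtype_val
  fun_prop

theorem continuous_halfPoint : Continuous halfPoint := by
  unfold halfPoint
  refine Continuous.subtype_mk ?_ _
  refine (PiLp.continuous_toLp 2 _).comp ?_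
  refine continuous_pi fun i => ?_
  fin_cases i
  · simp; fun_prop
  · simp; fun_prop

theorem halfPoint_halfCoords (h : EuclideanHalfSpace 2) : halfPoint (halfCoords h) = h := by
  apply EuclideanHalfSpace.ext
  ext i
  have := h.2
  fin_cases i
  · simpa [halfPoint, halfCoords] using this
  · simp [halfPoint, halfCoords]

theorem halfCoords_halfPoint {y : ℝ × ℝ} (hy : 0 ≤ y.1) : halfCoords (halfPoint y) = y := by
  simp [halfPoint, halfCoords, hy]

/-- Together with `isHalfPt_of_chart` this places every point of the surface in one of two local
classes, which exclude each other. Membership in the boundary can then be tested on discs and bands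
instead of charts. -/
theorem isDiscPt_of_chart (e : OpenPartialHomeomorph S (EuclideanHalfSpace 2)) {x : S}
    (hx : x ∈ e.source) (h : 0 < (e x).1 0) : IsDiscPt x := by
  set p := halfCoords (e x) with hp
  have hp0 : 0 < p.1 := h
  let c : ℂ → ℝ × ℝ := fun w => (p.1 + w.re, p.2 + w.im)
  have hc : Continuous c := by simp only [c]; fun_prop
  have hc0 : c 0 = p := by simp [c]
  have h1 : ∀ᶠ w in 𝓝 (0 : ℂ), halfPoint (c w) ∈ e.target ∧ 0 < (c w).1 := by
    refine Filter.Eventually.and ?_ ?_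
    · refine (continuous_halfPoint.comp hc).continuousAt (e.open_target.mem_nhds ?_)
      rw [Function.comp_apply, hc0, hp, halfPoint_halfCoords]
      exact e.map_source hx
    · exact (continuous_fst.comp hc).continuousAt (lt_mem_nhds (by simpa [c] using hp0))
  obtain ⟨r, hr, hr'⟩ := Metric.eventually_nhds_iff_ball.1 h1
  refine ⟨r, fun w => e.symm (halfPoint (c w)),
    fun y => ⟨(halfCoords (e y)).1 - p.1, (halfCoords (e y)).2 - p.2⟩, e.source, hr,
    e.open_source.mem_nhds hx, ?_, ?_, ?_, ?_, ?_⟩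
  · exact e.continuousOn_symm.comp (continuous_halfPoint.comp hc).continuousOn
      fun w hw => (hr' w hw).1
  · simp only [hc0, hp, halfPoint_halfCoords]
    exact e.left_inv hx
  · have h2 : ContinuousOn (fun y => halfCoords (e y)) e.source :=
      continuous_halfCoords.comp_continuousOn e.continuousOn
    have h3 : ContinuousOn (fun y => ((halfCoords (e y)).1 - p.1, (halfCoords (e y)).2 - p.2))
      e.source := by fun_prop
    exact Complex.equivRealProdCLM.symm.continuous.comp_continuousOn h3
  · intro y hy h0
    have h2 := congrArg Complex.re h0
    have h3 := congrArg Complex.im h0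
    simp only [Complex.zero_re, Complex.zero_im, sub_eq_zero] at h2 h3
    have h4 : halfCoords (e y) = halfCoords (e x) := Prod.ext h2 h3
    have h5 := congrArg halfPoint h4
    rw [halfPoint_halfCoords, halfPoint_halfCoords] at h5
    exact e.injOn hy hx h5
  · intro w hw
    dsimp only
    rw [e.right_inv (hr' w hw).1, halfCoords_halfPoint (hr' w hw).2.le]
    apply Complex.ext <;> simp [c]

theorem isHalfPt_of_chart (e : OpenPartialHomeomorph S (EuclideanHalfSpace 2)) {x : S}
    (hx : x ∈ e.source) (h : (e x).1 0 = 0) : IsHalfPt x := by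
  set p := halfCoords (e x) with hp
  have hp0 : p.1 = 0 := h
  have h1 : ∀ᶠ y in 𝓝 p, halfPoint y ∈ e.target := by
    refine continuous_halfPoint.continuousAt (e.open_target.mem_nhds ?_)
    rw [hp, halfPoint_halfCoords]
    exact e.map_source hx
  obtain ⟨r, hr, hr'⟩ := Metric.eventually_nhds_iff_ball.1 h1
  have hj : ContinuousOn (fun y => halfCoords (e y)) e.source :=
    continuous_halfCoords.comp_continuousOn e.continuousOn
  refine ⟨{y | 0 ≤ y.1} ∩ Metric.ball p r, p, (p.1 + r / 2, p.2), -LinearMap.fst ℝ ℝ ℝ,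
    fun y => e.symm (halfPoint y), fun y => halfCoords (e y),
    e.source ∩ (fun y => halfCoords (e y)) ⁻¹' Metric.ball p r, ?_, ?_, ?_, ?_, ?_, ?_, ?_, ?_, ?_, ?_, ?_⟩
  · refine Convex.inter ?_ (convex_ball _ _)
    exact convex_halfSpace_ge (LinearMap.fst ℝ ℝ ℝ).isLinear 0
  · exact ⟨hp0.ge, Metric.mem_ball_self hr⟩
  · refine ⟨by simp only [mem_ofPred_eq]; linarith, ?_⟩
    rw [mem_ball_iff_norm]
    simp only [Prod.norm_def, Prod.fst_sub, Prod.snd_sub, add_sub_cancel_left, sub_self, norm_zero,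
      Real.norm_eq_abs, abs_of_pos (half_pos hr)]
    rw [max_eq_left (half_pos hr).le]
    linarith
  · rintro y ⟨hy, -⟩
    simp only [mem_ofPred_eq] at hy
    simp [hp0, hy]
  · simp [hr]
  · exact e.continuousOn_symm.comp continuous_halfPoint.continuousOn fun y hy => hr' y hy.2
  · intro y hy w hw hyw
    have h2 := e.symm.injOn (hr' y hy.2) (hr' w hw.2) hyw
    have h3 := congrArg halfCoords h2
    rwa [halfCoords_halfPoint hy.1, halfCoords_halfPoint hw.1] at h3
  · simp only [hp, halfPoint_halfCoords]
    exact e.left_inv hx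
  · refine Filter.inter_mem (e.open_source.mem_nhds hx) ?_
    exact (hj.continuousAt (e.open_source.mem_nhds hx)) (Metric.ball_mem_nhds _ hr)
  · exact hj.mono inter_subset_left
  · rintro y ⟨hy, hyb⟩
    refine ⟨⟨(e y).2, hyb⟩, ?_⟩
    simp only [halfPoint_halfCoords]
    exact e.left_inv hy

section
variable [ChartedSpace (EuclideanHalfSpace 2) S]

theorem mem_boundary_iff {x : S} :
    x ∈ (𝓡∂ 2).boundary S ↔ (chartAt (EuclideanHalfSpace 2) x x).1 0 = 0 := by
  change (𝓡∂ 2).IsBoundaryPoint x ↔ _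
  rw [ModelWithCorners.isBoundaryPoint_iff, frontier_range_modelWithCornersEuclideanHalfSpace]
  simp [extChartAt, modelWithCornersEuclideanHalfSpace, eq_comm]

theorem mem_boundary_of_isHalfPt {x : S} (h : IsHalfPt x) : x ∈ (𝓡∂ 2).boundary S := by
  rw [mem_boundary_iff]
  by_contra h0
  have h1 : 0 < (chartAt (EuclideanHalfSpace 2) x x).1 0 :=
    lt_of_le_of_ne (chartAt (EuclideanHalfSpace 2) x x).2 (Ne.symm h0)
  exact (isDiscPt_of_chart _ (mem_chart_source _ x) h1).not_isHalfPt h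

theorem notMem_boundary_of_isDiscPt {x : S} (h : IsDiscPt x) : x ∉ (𝓡∂ 2).boundary S := by
  intro h0
  rw [mem_boundary_iff] at h0
  exact h.not_isHalfPt (isHalfPt_of_chart _ (mem_chart_source _ x) h0)

end

variable [T2Space S]

theorem isDiscPt_of_square {ψ : ℝ × ℝ → S} (hψ : ContinuousOn ψ square) (hi : InjOn ψ square)
    {p : ℝ × ℝ} (h1 : |p.1| < 1) (h2 : |p.2| < 1) (hn : ψ '' square ∈ 𝓝 (ψ p)) :
    IsDiscPt (ψ p) := by
  obtain ⟨g, g1, g2⟩ := exists_leftInv isCompact_square hψ hi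
  have hp : p ∈ square := mem_square.2 ⟨h1.le, h2.le⟩
  let c : ℂ → ℝ × ℝ := fun w => (p.1 + w.re, p.2 + w.im)
  have hc : Continuous c := by simp only [c]; fun_prop
  have hc0 : c 0 = p := by simp [c]
  have h3 : ∀ᶠ w in 𝓝 (0 : ℂ), c w ∈ square := by
    refine hc.continuousAt ?_
    rw [hc0, square_eq_closedBall]
    refine Filter.mem_of_superset (Metric.isOpen_ball.mem_nhds ?_) Metric.ball_subset_closedBall
    rw [mem_ball_zero_iff, Prod.norm_def, max_lt_iff]
    exact ⟨h1, h2⟩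
  obtain ⟨r, hr, hr'⟩ := Metric.eventually_nhds_iff_ball.1 h3
  refine ⟨r, fun w => ψ (c w), fun y => ⟨(g y).1 - p.1, (g y).2 - p.2⟩, ψ '' square, hr, hn,
    hψ.comp hc.continuousOn hr', by simp only [hc0], ?_, ?_, ?_⟩
  · have h4 : ContinuousOn (fun y => ((g y).1 - p.1, (g y).2 - p.2)) (ψ '' square) := by fun_prop
    exact Complex.equivRealProdCLM.symm.continuous.comp_continuousOn h4
  · rintro _ ⟨y, hy, rfl⟩ h0
    dsimp only at h0
    rw [g2 y hy] at h0
    have h2 := congrArg Complex.re h0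
    have h3 := congrArg Complex.im h0
    simp only [Complex.zero_re, Complex.zero_im, sub_eq_zero] at h2 h3
    rw [Prod.ext h2 h3]
  · intro w hw
    dsimp only
    rw [g2 _ (hr' w hw)]
    apply Complex.ext <;> simp [c]

/-- The square itself is the convex model, with its centre as `z`. At `p` the functional is the
coordinate of absolute value one, multiplied by its sign; corners need no separate treatment. -/
theorem isHalfPt_of_square {ψ : ℝ × ℝ → S} (hψ : ContinuousOn ψ square) (hi : InjOn ψ square)
    {p : ℝ × ℝ} (hp : p ∈ rim) (hn : ψ '' square ∈ 𝓝 (ψ p)) : IsHalfPt (ψ p) := by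
  obtain ⟨g, g1, g2⟩ := exists_leftInv isCompact_square hψ hi
  obtain ⟨hps, hp1⟩ := mem_rim_iff.1 hp
  obtain ⟨l, hl, hl0⟩ : ∃ l : ℝ × ℝ →ₗ[ℝ] ℝ, (∀ y ∈ square, l y ≤ l p) ∧ 0 < l p := by
    rcases hp1 with h | h
    · refine ⟨p.1 • LinearMap.fst ℝ ℝ ℝ, fun y hy => ?_, ?_⟩
      · have := (mem_square.1 hy).1
        simp only [LinearMap.smul_apply, LinearMap.fst_apply, smul_eq_mul]
        calc p.1 * y.1 ≤ |p.1 * y.1| := le_abs_self _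
          _ = |y.1| := by rw [abs_mul, h, one_mul]
          _ ≤ 1 := this
          _ = p.1 * p.1 := by rw [← abs_mul_abs_self, h, one_mul]
      · simp only [LinearMap.smul_apply, LinearMap.fst_apply, smul_eq_mul]
        rw [← abs_mul_abs_self, h]; norm_num
    · refine ⟨p.2 • LinearMap.snd ℝ ℝ ℝ, fun y hy => ?_, ?_⟩
      · have := (mem_square.1 hy).2
        simp only [LinearMap.smul_apply, LinearMap.snd_apply, smul_eq_mul]
        calc p.2 * y.2 ≤ |p.2 * y.2| := le_abs_self _
          _ = |y.2| := by rw [abs_mul, h, one_mul]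
          _ ≤ 1 := this
          _ = p.2 * p.2 := by rw [← abs_mul_abs_self, h, one_mul]
      · simp only [LinearMap.smul_apply, LinearMap.snd_apply, smul_eq_mul]
        rw [← abs_mul_abs_self, h]; norm_num
  refine ⟨square, p, 0, l, ψ, g, ψ '' square, ?_, hps, ?_, hl, by simpa using hl0, hψ, hi, rfl, hn,
    g1, ?_⟩
  · rw [square_eq_closedBall]; exact convex_closedBall _ _
  · simp [mem_square]
  · rintro _ ⟨y, hy, rfl⟩
    rw [g2 y hy]
    exact ⟨hy, rfl⟩

end

/-! ### Signs -/

/-- A sign as a real number. -/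
def sg (η : ℤˣ) : ℝ := ((η : ℤ) : ℝ)

@[simp] theorem sg_one : sg 1 = 1 := by simp [sg]

@[simp] theorem sg_neg (η : ℤˣ) : sg (-η) = -sg η := by simp [sg]

theorem sg_mul (η ζ : ℤˣ) : sg (η * ζ) = sg η * sg ζ := by simp [sg]

theorem sg_eq (η : ℤˣ) : sg η = 1 ∨ sg η = -1 := by
  rcases Int.units_eq_one_or η with rfl | rfl <;> simp

@[simp] theorem abs_sg (η : ℤˣ) : |sg η| = 1 := by
  rcases sg_eq η with h | h <;> simp [h]

@[simp] theorem sg_mul_self (η : ℤˣ) : sg η * sg η = 1 := by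
  rcases sg_eq η with h | h <;> simp [h]

theorem sg_mul_sg_mul (η : ℤˣ) (x : ℝ) : sg η * (sg η * x) = x := by
  rw [← mul_assoc, sg_mul_self, one_mul]

theorem sg_injective : Function.Injective sg := by
  intro a b h
  simpa [sg, Units.ext_iff] using h

theorem sg_ne_zero (η : ℤˣ) : sg η ≠ 0 := by
  rcases sg_eq η with h | h <;> simp [h]

theorem exists_sg_of_abs {x : ℝ} (h : |x| = 1) : ∃ η, x = sg η := by
  rcases (abs_eq zero_le_one).1 h with h | h
  · exact ⟨1, by simp [h]⟩
  · exact ⟨-1, by simp [h]⟩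

theorem units_int_ne_iff {η ζ : ℤˣ} : η ≠ ζ ↔ η = -ζ := by
  rcases Int.units_eq_one_or η with rfl | rfl <;> rcases Int.units_eq_one_or ζ with rfl | rfl <;>
    decide

theorem abs_sg_mul (η : ℤˣ) (x : ℝ) : |sg η * x| = |x| := by rw [abs_mul, abs_sg, one_mul]

theorem sg_mul_mem_Icc (η : ℤˣ) {x : ℝ} (hx : x ∈ Icc (-1 : ℝ) 1) : sg η * x ∈ Icc (-1 : ℝ) 1 := by
  rw [mem_Icc, ← abs_le, abs_sg_mul, abs_le]
  exact hx

/-- Rotation of the square by `0` or `π`. -/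
def rot (κ : ℤˣ) (z : ℝ × ℝ) : ℝ × ℝ := (sg κ * z.1, sg κ * z.2)

theorem rot_rot (κ : ℤˣ) (z : ℝ × ℝ) : rot κ (rot κ z) = z := by
  simp [rot, sg_mul_sg_mul]

theorem continuous_rot (κ : ℤˣ) : Continuous (rot κ) := by
  unfold rot
  fun_prop

theorem rot_mem_square {κ : ℤˣ} {z : ℝ × ℝ} : rot κ z ∈ square ↔ z ∈ square := by
  simp [mem_square, rot]

theorem rot_injective (κ : ℤˣ) : Function.Injective (rot κ) :=
  Function.LeftInverse.injective (g := rot κ) (rot_rot κ)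

theorem image_rot_square (κ : ℤˣ) : rot κ '' square = square := by
  ext z
  constructor
  · rintro ⟨w, hw, rfl⟩
    exact rot_mem_square.2 hw
  · intro hz
    exact ⟨rot κ z, rot_mem_square.2 hz, rot_rot κ z⟩

/-! ### Ribbon presentations -/

/-- A decomposition of a space into finitely many disjoint closed discs and finitely many disjoint
bands, which are squares meeting the discs exactly in their feet. -/
structure Ribbon (S : Type*) [TopologicalSpace S] where
  C : Type
  I : Type
  finC : Finite C
  finI : Finite I
  disc : C → ℝ × ℝ → S
  band : I → ℝ × ℝ → S
  /-- the disc to which a foot is attached -/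
  fd : I → ℤˣ → C
  disc_cont : ∀ c, ContinuousOn (disc c) square
  disc_inj : ∀ c, InjOn (disc c) square
  disc_disj : ∀ c c', ∀ s ∈ square, ∀ t ∈ square, disc c s = disc c' t → c = c'
  band_cont : ∀ i, ContinuousOn (band i) square
  band_inj : ∀ i, InjOn (band i) square
  band_disj : ∀ i j, ∀ s ∈ square, ∀ t ∈ square, band i s = band j t → i = j
  foot_mem : ∀ i η, ∀ x ∈ Icc (-1 : ℝ) 1, band i (x, sg η) ∈ disc (fd i η) '' rim
  band_notMem : ∀ i, ∀ z ∈ square, |z.2| < 1 → ∀ c, band i z ∉ disc c '' square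
  cover : ∀ x, (∃ c, x ∈ disc c '' square) ∨ ∃ i, x ∈ band i '' square

namespace Ribbon

section

variable {S : Type*} [TopologicalSpace S] (X : Ribbon S)

instance : Finite X.C := X.finC

instance : Finite X.I := X.finI

theorem disc_eq_iff {c c' : X.C} {s t : ℝ × ℝ} (hs : s ∈ square) (ht : t ∈ square) :
    X.disc c s = X.disc c' t ↔ c = c' ∧ s = t := by
  constructor
  · intro h
    obtain rfl := X.disc_disj _ _ s hs t ht h
    exact ⟨rfl, X.disc_inj _ hs ht h⟩
  · rintro ⟨rfl, rfl⟩; rfl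

theorem band_eq_iff {i j : X.I} {s t : ℝ × ℝ} (hs : s ∈ square) (ht : t ∈ square) :
    X.band i s = X.band j t ↔ i = j ∧ s = t := by
  constructor
  · intro h
    obtain rfl := X.band_disj _ _ s hs t ht h
    exact ⟨rfl, X.band_inj _ hs ht h⟩
  · rintro ⟨rfl, rfl⟩; rfl

/-- `band_notMem` confines the common point to a foot, and disjointness of the discs identifies the
disc as the one to which that foot is attached. -/
theorem disc_eq_band {c : X.C} {i : X.I} {s t : ℝ × ℝ} (hs : s ∈ square) (ht : t ∈ square)
    (h : X.disc c s = X.band i t) : ∃ η, t.2 = sg η ∧ c = X.fd i η ∧ s ∈ rim := by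
  have h1 := mem_square.1 ht
  have h2 : |t.2| = 1 := by
    by_contra h3
    exact X.band_notMem i t ht (lt_of_le_of_ne h1.2 h3) c (h ▸ mem_image_of_mem _ hs)
  obtain ⟨η, hη⟩ := exists_sg_of_abs h2
  obtain ⟨p, hp, hpe⟩ := X.foot_mem i η t.1 (abs_le.1 h1.1)
  rw [← hη, Prod.mk.eta, ← h, X.disc_eq_iff (rim_subset_square hp) hs] at hpe
  exact ⟨η, hη, hpe.1.symm, hpe.2 ▸ hp⟩

theorem sg_mem_square {σ : ℤˣ} {s : ℝ} (hs : s ∈ Icc (-1 : ℝ) 1) : (sg σ, s) ∈ square :=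
  mem_square.2 ⟨(abs_sg σ).le, abs_le.2 hs⟩

theorem mem_square_sg {η : ℤˣ} {x : ℝ} (hx : x ∈ Icc (-1 : ℝ) 1) : (x, sg η) ∈ square :=
  mem_square.2 ⟨abs_le.2 hx, (abs_sg η).le⟩

variable [T2Space S]

theorem isClosed_disc (c : X.C) : IsClosed (X.disc c '' square) :=
  (isCompact_square.image_of_continuousOn (X.disc_cont c)).isClosed

theorem isClosed_band (i : X.I) : IsClosed (X.band i '' square) :=
  (isCompact_square.image_of_continuousOn (X.band_cont i)).isClosed

/-- The remaining pieces form a finite union of closed sets that misses the point. -/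
theorem disc_mem_nhds {c : X.C} {p : ℝ × ℝ} (hp : p ∈ square)
    (hb : ∀ i, X.disc c p ∉ X.band i '' square) : X.disc c '' square ∈ 𝓝 (X.disc c p) := by
  classical
  have hcl : IsClosed ((⋃ c' : X.C, if c' = c then ∅ else X.disc c' '' square) ∪
      ⋃ i, X.band i '' square) := by
    refine IsClosed.union (isClosed_iUnion_of_finite fun c' => ?_)
      (isClosed_iUnion_of_finite X.isClosed_band)
    split_ifs
    · exact isClosed_empty
    · exact X.isClosed_disc c'
  refine Filter.mem_of_superset (hcl.isOpen_compl.mem_nhds ?_) ?_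
  · rintro (h | h)
    · obtain ⟨c', h⟩ := mem_iUnion.1 h
      split_ifs at h with hc
      · exact h
      · obtain ⟨t, ht, he⟩ := h
        exact hc ((X.disc_eq_iff ht hp).1 he).1
    · obtain ⟨i, h⟩ := mem_iUnion.1 h
      exact hb i h
  · intro x hx
    rcases X.cover x with ⟨c', h⟩ | ⟨i, h⟩
    · by_cases hc : c' = c
      · exact hc ▸ h
      · exact absurd (Or.inl (mem_iUnion.2 ⟨c', by rwa [if_neg hc]⟩)) hx
    · exact absurd (Or.inr (mem_iUnion.2 ⟨i, h⟩)) hx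

theorem band_mem_nhds {i : X.I} {z : ℝ × ℝ} (hz : z ∈ square) (hz2 : |z.2| < 1) :
    X.band i '' square ∈ 𝓝 (X.band i z) := by
  classical
  have hcl : IsClosed ((⋃ j : X.I, if j = i then ∅ else X.band j '' square) ∪
      ⋃ c, X.disc c '' square) := by
    refine IsClosed.union (isClosed_iUnion_of_finite fun c' => ?_)
      (isClosed_iUnion_of_finite X.isClosed_disc)
    split_ifs
    · exact isClosed_empty
    · exact X.isClosed_band c'
  refine Filter.mem_of_superset (hcl.isOpen_compl.mem_nhds ?_) ?_
  · rintro (h | h)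
    · obtain ⟨c', h⟩ := mem_iUnion.1 h
      split_ifs at h with hc
      · exact h
      · obtain ⟨t, ht, he⟩ := h
        exact hc ((X.band_eq_iff ht hz).1 he).1
    · obtain ⟨c, h⟩ := mem_iUnion.1 h
      exact X.band_notMem i z hz hz2 c h
  · intro x hx
    rcases X.cover x with ⟨c, h⟩ | ⟨j, h⟩
    · exact absurd (Or.inr (mem_iUnion.2 ⟨c, h⟩)) hx
    · by_cases hc : j = i
      · exact hc ▸ h
      · exact absurd (Or.inl (mem_iUnion.2 ⟨j, by rwa [if_neg hc]⟩)) hx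

/-- The points of an open foot are interior points. -/
theorem isDiscPt_foot {i : X.I} {η : ℤˣ} {x : ℝ} (hx : |x| < 1) :
    IsDiscPt (X.band i (x, sg η)) := by
  classical
  set c := X.fd i η with hc
  -- The band is turned so that the foot in question is its bottom edge.
  set b : ℝ × ℝ → S := fun z => X.band i (rot (-η) z) with hb
  have hbc : ContinuousOn b square := (X.band_cont i).comp (continuous_rot _).continuousOn
    fun z hz => rot_mem_square.2 hz
  have hbi : InjOn b square := fun z hz w hw h =>
    rot_injective (-η) (X.band_inj i (rot_mem_square.2 hz) (rot_mem_square.2 hw) h)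
  have hI : ∀ x ∈ Icc (-1 : ℝ) 1, (x, (-1 : ℝ)) ∈ square := fun x hx =>
    mem_square.2 ⟨abs_le.2 hx, by simp⟩
  have hbm : ∀ x ∈ Icc (-1 : ℝ) 1, b (x, -1) ∈ X.disc c '' rim := by
    intro x hx
    have := X.foot_mem i η (sg (-η) * x) (sg_mul_mem_Icc _ hx)
    simpa [hb, rot] using this
  obtain ⟨h, h1, h2, h3, -, h5⟩ := exists_reparam (X.disc_cont c) (X.disc_inj c)
    (γ := fun x => b (x, -1)) (hbc.comp (by fun_prop) hI)
    (fun x hx y hy hxy => congrArg Prod.fst (hbi (hI x hx) (hI y hy) hxy)) hbm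
  set q : ℝ × ℝ → ℝ × ℝ := fun z => (z.1, (z.2 - 1) / 2) with hq
  have hqs : MapsTo q square square := by
    intro z hz
    simp only [mem_square, abs_le, hq] at hz ⊢
    refine ⟨hz.1, ?_, ?_⟩ <;> linarith [hz.2.1, hz.2.2]
  have hqi : Function.Injective q := by
    rintro ⟨a, b⟩ ⟨a', b'⟩ h
    simp only [hq, Prod.mk.injEq] at h
    ext
    · exact h.1
    · simp only; linarith [h.2]
  -- Only the half of the band next to this foot is stacked on the disc. The whole band could meet
  -- the disc again in its other foot.
  obtain ⟨g, g1, g2, g3, g4, -⟩ := exists_stack h1 h2 (h₂ := b ∘ q)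
    (hbc.comp (by fun_prop) hqs) (fun z hz w hw hzw => hqi (hbi (hqs hz) (hqs hw) hzw))
    (by
      intro x hx
      rw [h5 x hx]
      simp only [Function.comp_apply, hq]
      norm_num)
    (by
      intro s hs t ht hst
      have hsm : h s ∈ X.disc c '' square := h3 ▸ mem_image_of_mem h hs
      obtain ⟨p, hp, hpe⟩ := hsm
      rw [hst] at hpe
      obtain ⟨ζ, e1, e2, e3⟩ := X.disc_eq_band hp (rot_mem_square.2 (hqs ht)) hpe
      have ht' := (mem_square.1 ht)
      simp only [abs_le] at ht'
      have e4 : (t.2 - 1) / 2 = sg (-η) * sg ζ := by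
        rw [← e1]; simp only [rot, sg_mul_sg_mul, hq]
      have e5 : (t.2 - 1) / 2 = -1 := by
        rw [← sg_mul] at e4
        rcases sg_eq (-η * ζ) with h | h <;> rw [h] at e4 <;> linarith [ht'.2.2]
      have e6 : b (q t) = b (t.1, -1) := by rw [← e5]
      have e7 : h s = h (t.1, 1) := by rw [h5 t.1 ht'.1, ← e6]; exact hst
      have e8 := h2 hs (x₂ := (t.1, 1)) (mem_square.2 ⟨abs_le.2 ht'.1, by norm_num⟩) e7
      rw [e8])
  have hx' : sg (-η) * x ∈ Icc (-1 : ℝ) 1 := sg_mul_mem_Icc _ (abs_le.1 hx.le)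
  have hpt : g (sg (-η) * x, 0) = X.band i (x, sg η) := by
    have e1 := g4 (sg (-η) * x, 1) (mem_square.2 ⟨abs_le.2 hx', by simp⟩)
    simp only [sub_self, zero_div] at e1
    rw [e1, h5 _ hx']
    simp only [hb, rot, sg_mul_sg_mul]
    simp
  rw [← hpt]
  refine isDiscPt_of_square g1 g2 (by simpa [abs_sg_mul] using hx) (by simp) ?_
  rw [hpt, g3, h3]
  set q' : ℝ × ℝ → ℝ × ℝ := fun z => (z.1, (z.2 + 1) / 2) with hq'
  have hqs' : MapsTo q' square square := by
    intro z hz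
    simp only [mem_square, abs_le, hq'] at hz ⊢
    refine ⟨hz.1, ?_, ?_⟩ <;> linarith [hz.2.1, hz.2.2]
  -- Everything except the disc and the near half of the band, that is, other bands, other discs and
  -- the far half.
  have hcl : IsClosed (((⋃ j : X.I, if j = i then ∅ else X.band j '' square) ∪
      ⋃ c' : X.C, if c' = c then ∅ else X.disc c' '' square) ∪ (b ∘ q') '' square) := by
    refine IsClosed.union (IsClosed.union (isClosed_iUnion_of_finite fun j => ?_)
      (isClosed_iUnion_of_finite fun c' => ?_)) ?_
    · split_ifs
      · exact isClosed_empty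
      · exact X.isClosed_band j
    · split_ifs
      · exact isClosed_empty
      · exact X.isClosed_disc c'
    · exact (isCompact_square.image_of_continuousOn (hbc.comp (by fun_prop) hqs')).isClosed
  have hxs : (x, sg η) ∈ square := mem_square_sg (abs_le.1 hx.le)
  refine Filter.mem_of_superset (hcl.isOpen_compl.mem_nhds ?_) ?_
  · rintro ((h | h) | h)
    · obtain ⟨j, h⟩ := mem_iUnion.1 h
      split_ifs at h with hj
      · exact h
      · obtain ⟨t, ht, he⟩ := h
        exact hj ((X.band_eq_iff ht hxs).1 he).1
    · obtain ⟨c', h⟩ := mem_iUnion.1 h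
      split_ifs at h with hj
      · exact h
      · obtain ⟨t, ht, he⟩ := h
        obtain ⟨ζ, f1, f2, -⟩ := X.disc_eq_band ht hxs he
        rw [← sg_injective f1] at f2
        exact hj f2
    · obtain ⟨t, ht, he⟩ := h
      have f1 := X.band_inj i (rot_mem_square.2 (hqs' ht)) hxs he
      have f2 := congrArg Prod.snd f1
      simp only [rot, hq'] at f2
      have ht' := (mem_square.1 ht)
      simp only [abs_le] at ht'
      rw [sg_neg] at f2
      rcases sg_eq η with h | h <;> rw [h] at f2 <;> linarith [ht'.2.1]
  · intro y hy
    rcases X.cover y with ⟨c', h⟩ | ⟨j, h⟩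
    · by_cases hcc : c' = c
      · exact Or.inl (hcc ▸ h)
      · exact absurd (Or.inl (Or.inr (mem_iUnion.2 ⟨c', by rwa [if_neg hcc]⟩))) hy
    · by_cases hj : j = i
      · subst hj
        obtain ⟨z, hz, rfl⟩ := h
        have hz' := rot_mem_square (κ := -η) |>.2 hz
        have hz'' := mem_square.1 hz'
        simp only [abs_le] at hz''
        rcases le_total (rot (-η) z).2 0 with h0 | h0
        · refine Or.inr ⟨((rot (-η) z).1, 2 * (rot (-η) z).2 + 1), ?_, ?_⟩
          · simp only [mem_square, abs_le]
            refine ⟨hz''.1, ?_, ?_⟩ <;> linarith [hz''.2.1, hz''.2.2]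
          · simp only [Function.comp_apply, hq, hb]
            congr 1
            conv_rhs => rw [← rot_rot (-η) z]
            congr 1
            ext
            · rfl
            · simp only; ring
        · refine absurd (Or.inr ⟨((rot (-η) z).1, 2 * (rot (-η) z).2 - 1), ?_, ?_⟩) hy
          · simp only [mem_square, abs_le]
            refine ⟨hz''.1, ?_, ?_⟩ <;> linarith [hz''.2.1, hz''.2.2]
          · simp only [Function.comp_apply, hq', hb]
            congr 1
            conv_rhs => rw [← rot_rot (-η) z]
            congr 1
            ext
            · rfl
            · simp only; ring
      · exact absurd (Or.inl (Or.inl (mem_iUnion.2 ⟨j, by rwa [if_neg hj]⟩))) hy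

variable [ChartedSpace (EuclideanHalfSpace 2) S]

theorem disc_mem_boundary {c : X.C} {p : ℝ × ℝ} (hp : p ∈ rim)
    (hb : ∀ i, X.disc c p ∉ X.band i '' square) : X.disc c p ∈ (𝓡∂ 2).boundary S :=
  mem_boundary_of_isHalfPt (isHalfPt_of_square (X.disc_cont c) (X.disc_inj c) hp
    (X.disc_mem_nhds (rim_subset_square hp) hb))

theorem openSide_mem_boundary (i : X.I) (σ : ℤˣ) {s : ℝ} (hs : |s| < 1) :
    X.band i (sg σ, s) ∈ (𝓡∂ 2).boundary S := by
  have h : (sg σ, s) ∈ rim := mem_rim_of_fst (abs_sg σ) hs.le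
  exact mem_boundary_of_isHalfPt (isHalfPt_of_square (X.band_cont i) (X.band_inj i) h
    (X.band_mem_nhds (rim_subset_square h) hs))

/-- At the corners the band need not be a neighbourhood of the point; they are reached as limits of
the open side. -/
theorem side_mem_boundary (hcl : IsClosed ((𝓡∂ 2).boundary S)) (i : X.I) (σ : ℤˣ) {s : ℝ}
    (hs : s ∈ Icc (-1 : ℝ) 1) : X.band i (sg σ, s) ∈ (𝓡∂ 2).boundary S := by
  have hc : ContinuousOn (fun s => X.band i (sg σ, s)) (Icc (-1) 1) :=
    (X.band_cont i).comp (by fun_prop) fun s hs => sg_mem_square hs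
  have h1 : Icc (-1 : ℝ) 1 = closure (Ioo (-1) 1) := (closure_Ioo (by norm_num)).symm
  rw [h1] at hc
  have h2 := hc.image_closure
  have h3 : (fun s => X.band i (sg σ, s)) '' Ioo (-1) 1 ⊆ (𝓡∂ 2).boundary S := by
    rintro _ ⟨t, ht, rfl⟩
    exact X.openSide_mem_boundary i σ (abs_lt.2 ht)
  exact hcl.closure_subset_iff.2 h3 (h2 (mem_image_of_mem _ (h1 ▸ hs)))

theorem disc_notMem_boundary {c : X.C} {p : ℝ × ℝ} (hp : p ∈ square) (hr : p ∉ rim) :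
    X.disc c p ∉ (𝓡∂ 2).boundary S := by
  have h1 := mem_square.1 hp
  have h2 : |p.1| < 1 := lt_of_le_of_ne h1.1 fun h => hr (mem_rim_iff.2 ⟨hp, Or.inl h⟩)
  have h3 : |p.2| < 1 := lt_of_le_of_ne h1.2 fun h => hr (mem_rim_iff.2 ⟨hp, Or.inr h⟩)
  refine notMem_boundary_of_isDiscPt (isDiscPt_of_square (X.disc_cont c) (X.disc_inj c) h2 h3
    (X.disc_mem_nhds hp ?_))
  rintro i ⟨t, ht, he⟩
  obtain ⟨-, -, -, h⟩ := X.disc_eq_band hp ht he.symm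
  exact hr h

theorem band_notMem_boundary {i : X.I} {z : ℝ × ℝ} (hz : z ∈ square) (h1 : |z.1| < 1) :
    X.band i z ∉ (𝓡∂ 2).boundary S := by
  have h2 := mem_square.1 hz
  rcases h2.2.lt_or_eq with h | h
  · exact notMem_boundary_of_isDiscPt (isDiscPt_of_square (X.band_cont i) (X.band_inj i) h1 h
      (X.band_mem_nhds hz h))
  · obtain ⟨η, hη⟩ := exists_sg_of_abs h
    have := notMem_boundary_of_isDiscPt (X.isDiscPt_foot (i := i) (η := η) h1)
    rwa [← hη] at this

end

end Ribbon

/-! ### Contraction of a band that joins two different discs -/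

namespace Ribbon

variable {S : Type*} [TopologicalSpace S] (X : Ribbon S)

theorem fd_eq_or (b : X.I) (ζ : ℤˣ) : X.fd b ζ = X.fd b 1 ∨ X.fd b ζ = X.fd b (-1) := by
  rcases Int.units_eq_one_or ζ with rfl | rfl
  · exact Or.inl rfl
  · exact Or.inr rfl

open scoped Classical in
/-- The index of the disc containing a given disc after contraction of the band `b`. -/
noncomputable def contractIdx {b : X.I} (hb : X.fd b 1 ≠ X.fd b (-1)) (c : X.C) :
    {c : X.C // c ≠ X.fd b (-1)} :=
  if h : c = X.fd b (-1) then ⟨X.fd b 1, hb⟩ else ⟨c, h⟩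

theorem contractIdx_of_ne {b : X.I} (hb : X.fd b 1 ≠ X.fd b (-1)) {c : X.C}
    (h : c ≠ X.fd b (-1)) : X.contractIdx hb c = ⟨c, h⟩ := dif_neg h

theorem contractIdx_neg_one {b : X.I} (hb : X.fd b 1 ≠ X.fd b (-1)) :
    X.contractIdx hb (X.fd b (-1)) = ⟨X.fd b 1, hb⟩ := dif_pos rfl

theorem contractIdx_fd {b : X.I} (hb : X.fd b 1 ≠ X.fd b (-1)) (η : ℤˣ) :
    X.contractIdx hb (X.fd b η) = ⟨X.fd b 1, hb⟩ := by
  rcases Int.units_eq_one_or η with rfl | rfl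
  · exact X.contractIdx_of_ne hb hb
  · exact X.contractIdx_neg_one hb

variable [T2Space S]

/-- Two different discs joined by a band form a disc. -/
theorem exists_merge {b : X.I} (hb : X.fd b 1 ≠ X.fd b (-1)) :
    ∃ G : ℝ × ℝ → S, ContinuousOn G square ∧ InjOn G square ∧
      G '' square = (X.disc (X.fd b (-1)) '' square ∪ X.band b '' square) ∪
        X.disc (X.fd b 1) '' square ∧
      ∀ η, ∀ p ∈ rim, X.disc (X.fd b η) p ∉ X.band b '' square →
        X.disc (X.fd b η) p ∈ G '' rim := by
  have hI : ∀ η, ∀ x ∈ Icc (-1 : ℝ) 1, (x, sg η) ∈ square := fun η x hx => mem_square_sg hx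
  have hneg : ∀ x ∈ Icc (-1 : ℝ) 1, -x ∈ Icc (-1 : ℝ) 1 := fun x hx =>
    ⟨by linarith [hx.2], by linarith [hx.1]⟩
  obtain ⟨h₁, a1, a2, a3, a4, a5⟩ := exists_reparam (X.disc_cont (X.fd b (-1)))
    (X.disc_inj (X.fd b (-1))) (γ := fun x => X.band b (x, sg (-1)))
    ((X.band_cont b).comp (by fun_prop) (hI (-1)))
    (fun x hx y hy h => congrArg Prod.fst (X.band_inj b (hI _ x hx) (hI _ y hy) h))
    (X.foot_mem b (-1))
  -- This disc will be placed upside down on the band, so its top edge runs through the foot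
  -- backwards, whence `-x`.
  obtain ⟨h₂, b1, b2, b3, b4, b5⟩ := exists_reparam (X.disc_cont (X.fd b 1))
    (X.disc_inj (X.fd b 1)) (γ := fun x => X.band b (-x, sg 1))
    ((X.band_cont b).comp (by fun_prop) fun x hx => hI 1 _ (hneg x hx))
    (fun x hx y hy h => neg_injective
      (congrArg Prod.fst (X.band_inj b (hI _ _ (hneg x hx)) (hI _ _ (hneg y hy)) h)))
    (fun x hx => X.foot_mem b 1 (-x) (hneg x hx))
  have htop : ∀ x ∈ Icc (-1 : ℝ) 1, (x, (1 : ℝ)) ∈ square := fun x hx =>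
    mem_square.2 ⟨abs_le.2 hx, by simp⟩
  obtain ⟨g, g1, g2, g3, g4, g5⟩ := exists_stack a1 a2 (X.band_cont b) (X.band_inj b)
    (fun x hx => by rw [a5 x hx]; simp) (by
      intro s hs t ht hst
      obtain ⟨p, hp, hpe⟩ := a3 ▸ mem_image_of_mem h₁ hs
      rw [hst] at hpe
      obtain ⟨ζ, e1, e2, -⟩ := X.disc_eq_band hp ht hpe
      obtain rfl : ζ = -1 := by
        rcases Int.units_eq_one_or ζ with rfl | rfl
        · exact absurd e2.symm hb
        · rfl
      have ht1 := abs_le.1 (mem_square.1 ht).1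
      have e3 : h₁ s = h₁ (t.1, 1) := by rw [a5 _ ht1, hst, ← e1]
      rw [a2 hs (htop _ ht1) e3])
  have c1 : ContinuousOn (h₂ ∘ rot (-1)) square :=
    b1.comp (continuous_rot _).continuousOn fun z hz => rot_mem_square.2 hz
  have c2 : InjOn (h₂ ∘ rot (-1)) square := fun z hz w hw h =>
    rot_injective _ (b2 (rot_mem_square.2 hz) (rot_mem_square.2 hw) h)
  have g6 : ∀ x ∈ Icc (-1 : ℝ) 1, g (x, 1) = X.band b (x, 1) := by
    intro x hx
    have := g5 (x, 1) (htop x hx)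
    simpa using this
  obtain ⟨G, G1, G2, G3, G4, G5⟩ := exists_stack g1 g2 c1 c2
    (fun x hx => by
      rw [g6 x hx]
      simp only [Function.comp_apply, rot, sg_neg, sg_one]
      rw [show ((-1 : ℝ) * x, (-1 : ℝ) * (-1)) = (-x, (1 : ℝ)) by simp, b5 _ (hneg x hx)]
      simp) (by
      intro s hs t ht hst
      have ht' := rot_mem_square (κ := -1) |>.2 ht
      obtain ⟨p, hp, hpe⟩ := b3 ▸ mem_image_of_mem h₂ ht'
      change g s = h₂ (rot (-1) t) at hst
      rcases g3 ▸ mem_image_of_mem g hs with h | ⟨u, hu, hue⟩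
      · rw [a3] at h
        obtain ⟨q, hq, hqe⟩ := h
        rw [hst, ← hpe] at hqe
        exact absurd ((X.disc_eq_iff hq hp).1 hqe).1.symm hb
      · rw [hst, ← hpe] at hue
        obtain ⟨ζ, e1, e2, -⟩ := X.disc_eq_band hp hu hue.symm
        obtain rfl : ζ = 1 := by
          rcases Int.units_eq_one_or ζ with rfl | rfl
          · rfl
          · exact absurd e2 hb
        have hu1 := abs_le.1 (mem_square.1 hu).1
        have e3 : g s = g (u.1, 1) := by
          rw [g6 _ hu1, hst, ← hpe, ← hue]
          rw [sg_one] at e1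
          rw [← e1]
        rw [g2 hs (htop _ hu1) e3])
  refine ⟨G, G1, G2, ?_, ?_⟩
  · rw [G3, g3, a3, image_comp, image_rot_square, b3]
  -- A rim point off the glued edge lies on one of the other three edges of the reparametrized disc
  -- and hence on the outer edge of the stack. This keeps the other bands attached to the rim.
  · intro η p hp hpb
    rcases Int.units_eq_one_or η with rfl | rfl
    · obtain ⟨s, hs, hse⟩ := b4 ▸ mem_image_of_mem (X.disc (X.fd b 1)) hp
      rw [← hse] at hpb ⊢
      obtain ⟨hss, hs1⟩ := mem_rim_iff.1 hs
      have hsb := mem_square.1 hss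
      have hne : s.2 ≠ 1 := by
        intro h
        apply hpb
        have hs1' := abs_le.1 hsb.1
        refine ⟨(-s.1, sg 1), hI 1 _ (hneg _ hs1'), ?_⟩
        rw [← b5 _ hs1', ← h]
      have e := G5 (rot (-1) s) (rot_mem_square.2 hss)
      rw [Function.comp_apply, rot_rot] at e
      rw [← e]
      refine mem_image_of_mem _ (mem_rim_iff.2 ⟨?_, ?_⟩)
      · simp only [mem_square, rot, sg_neg, sg_one, abs_le] at hsb ⊢
        refine ⟨⟨?_, ?_⟩, ?_, ?_⟩ <;> linarith [hsb.1.1, hsb.1.2, hsb.2.1, hsb.2.2]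
      · rcases hs1 with h | h
        · left; simpa [rot] using h
        · right
          rcases (abs_eq zero_le_one).1 h with h | h
          · exact absurd h hne
          · simp [rot, h]
    · obtain ⟨s, hs, hse⟩ := a4 ▸ mem_image_of_mem (X.disc (X.fd b (-1))) hp
      rw [← hse] at hpb ⊢
      obtain ⟨hss, hs1⟩ := mem_rim_iff.1 hs
      have hsb := mem_square.1 hss
      have hne : s.2 ≠ 1 := by
        intro h
        apply hpb
        have hs1' := abs_le.1 hsb.1
        refine ⟨(s.1, sg (-1)), hI (-1) _ hs1', ?_⟩
        rw [← a5 _ hs1', ← h]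
      have hs2 : (s.1, (s.2 - 1) / 2) ∈ square := by
        simp only [mem_square, abs_le] at hsb ⊢
        refine ⟨⟨?_, ?_⟩, ?_, ?_⟩ <;> linarith [hsb.1.1, hsb.1.2, hsb.2.1, hsb.2.2]
      have e := G4 _ hs2
      rw [g4 s hss] at e
      rw [← e]
      refine mem_image_of_mem _ (mem_rim_iff.2 ⟨?_, ?_⟩)
      · simp only [mem_square, abs_le] at hs2 ⊢
        refine ⟨⟨?_, ?_⟩, ?_, ?_⟩ <;> linarith [hs2.1.1, hs2.1.2, hs2.2.1, hs2.2.2]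
      · rcases hs1 with h | h
        · left; simpa using h
        · right
          rcases (abs_eq zero_le_one).1 h with h | h
          · exact absurd h hne
          · simp [h]; norm_num

open scoped Classical in
/-- The discs after contraction of the band `b`. -/
noncomputable def contractDisc {b : X.I} (hb : X.fd b 1 ≠ X.fd b (-1)) (c : X.C) : ℝ × ℝ → S :=
  if c = X.fd b 1 then (X.exists_merge hb).choose else X.disc c

/-- Traces points of the new discs back to old pieces, so that incidences after contraction follow
from those before. -/
theorem contractDisc_cases {b : X.I} (hb : X.fd b 1 ≠ X.fd b (-1)) {c : X.C} {s : ℝ × ℝ}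
    (hs : s ∈ square) :
    (∃ c' t, t ∈ square ∧ (c' = c ∨ c = X.fd b 1 ∧ c' = X.fd b (-1)) ∧
      X.contractDisc hb c s = X.disc c' t) ∨
    (∃ t ∈ square, c = X.fd b 1 ∧ X.contractDisc hb c s = X.band b t) := by
  obtain ⟨-, -, h3, -⟩ := (X.exists_merge hb).choose_spec
  by_cases h : c = X.fd b 1
  · simp only [contractDisc, if_pos h]
    rcases h3 ▸ mem_image_of_mem _ hs with (⟨t, ht, he⟩ | ⟨t, ht, he⟩) | ⟨t, ht, he⟩
    · exact Or.inl ⟨_, t, ht, Or.inr ⟨h, rfl⟩, he.symm⟩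
    · exact Or.inr ⟨t, ht, h, he.symm⟩
    · exact Or.inl ⟨_, t, ht, Or.inl h.symm, he.symm⟩
  · simp only [contractDisc, if_neg h]
    exact Or.inl ⟨c, s, hs, Or.inl rfl, rfl⟩

theorem disc_mem_contractDisc {b : X.I} (hb : X.fd b 1 ≠ X.fd b (-1)) (c : X.C) :
    X.disc c '' square ⊆ X.contractDisc hb (X.contractIdx hb c).1 '' square := by
  obtain ⟨-, -, h3, -⟩ := (X.exists_merge hb).choose_spec
  by_cases h : c = X.fd b (-1)
  · subst h
    rw [contractIdx_neg_one]
    simp only [contractDisc, if_true]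
    rw [h3]
    exact fun x hx => Or.inl (Or.inl hx)
  · rw [X.contractIdx_of_ne hb h]
    by_cases h' : c = X.fd b 1
    · subst h'
      simp only [contractDisc, if_true]
      rw [h3]
      exact fun x hx => Or.inr hx
    · simp only [contractDisc, if_neg h']
      exact subset_rfl

/-- Contraction of a band joining two different discs. -/
noncomputable def contract (b : X.I) (hb : X.fd b 1 ≠ X.fd b (-1)) : Ribbon S where
  C := {c : X.C // c ≠ X.fd b (-1)}
  I := {i : X.I // i ≠ b}
  finC := inferInstance
  finI := inferInstance
  disc c := X.contractDisc hb c.1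
  band i := X.band i.1
  fd i η := X.contractIdx hb (X.fd i.1 η)
  disc_cont c := by
    unfold contractDisc
    split_ifs
    · exact (X.exists_merge hb).choose_spec.1
    · exact X.disc_cont _
  disc_inj c := by
    unfold contractDisc
    split_ifs
    · exact (X.exists_merge hb).choose_spec.2.1
    · exact X.disc_inj _
  disc_disj := by
    rintro ⟨c, hc⟩ ⟨c', hc'⟩ s hs t ht h
    apply Subtype.ext
    simp only at h ⊢
    rcases X.contractDisc_cases hb hs (c := c) with ⟨d, u, hu, hd, e⟩ | ⟨u, hu, hd, e⟩ <;>
      rcases X.contractDisc_cases hb ht (c := c') with ⟨d', u', hu', hd', e'⟩ | ⟨u', hu', hd', e'⟩ <;>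
      rw [e, e'] at h
    · have h1 := ((X.disc_eq_iff hu hu').1 h).1
      rcases hd with rfl | ⟨h2, h3⟩ <;> rcases hd' with rfl | ⟨h2', h3'⟩
      · exact h1
      · exact absurd (h1.trans h3') hc
      · exact absurd (h1.symm.trans h3) hc'
      · exact h2.trans h2'.symm
    · obtain ⟨ζ, -, h1, -⟩ := X.disc_eq_band hu hu' h
      rw [hd']
      rcases hd with rfl | ⟨h2, h3⟩
      · rcases X.fd_eq_or b ζ with h4 | h4
        · exact h1.trans h4
        · exact absurd (h1.trans h4) hc
      · exact h2
    · obtain ⟨ζ, -, h1, -⟩ := X.disc_eq_band hu' hu h.symm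
      rw [hd]
      rcases hd' with rfl | ⟨h2, h3⟩
      · rcases X.fd_eq_or b ζ with h4 | h4
        · exact (h1.trans h4).symm
        · exact absurd (h1.trans h4) hc'
      · exact h2.symm
    · exact hd.trans hd'.symm
  band_cont i := X.band_cont _
  band_inj i := X.band_inj _
  band_disj i j s hs t ht h := Subtype.ext (X.band_disj _ _ s hs t ht h)
  foot_mem := by
    rintro ⟨i, hi⟩ η x hx
    simp only
    obtain ⟨p, hp, he⟩ := X.foot_mem i η x hx
    obtain ⟨-, -, -, h4⟩ := (X.exists_merge hb).choose_spec
    have hnb : X.band i (x, sg η) ∉ X.band b '' square := by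
      rintro ⟨t, ht, h⟩
      exact hi ((X.band_eq_iff (mem_square_sg hx) ht).1 h.symm).1
    by_cases h : ∃ ζ, X.fd i η = X.fd b ζ
    · obtain ⟨ζ, hζ⟩ := h
      rw [hζ, contractIdx_fd]
      simp only [contractDisc, if_true]
      rw [hζ] at he
      rw [← he] at hnb ⊢
      exact h4 ζ p hp hnb
    · rw [X.contractIdx_of_ne hb fun h' => h ⟨_, h'⟩]
      simp only [contractDisc]
      rw [if_neg fun h' => h ⟨_, h'⟩]
      exact ⟨p, hp, he⟩
  band_notMem := by
    rintro ⟨i, hi⟩ z hz hz2 ⟨c, hc⟩ ⟨s, hs, h⟩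
    simp only at h
    rcases X.contractDisc_cases hb hs (c := c) with ⟨d, u, hu, hd, e⟩ | ⟨u, hu, hd, e⟩
    · exact X.band_notMem i z hz hz2 d ⟨u, hu, e.symm.trans h⟩
    · exact hi ((X.band_eq_iff hz hu).1 (h.symm.trans e)).1
  cover x := by
    rcases X.cover x with ⟨c, h⟩ | ⟨i, h⟩
    · exact Or.inl ⟨_, X.disc_mem_contractDisc hb c h⟩
    · by_cases hi : i = b
      · subst hi
        refine Or.inl ⟨⟨X.fd i 1, hb⟩, ?_⟩
        obtain ⟨-, -, h3, -⟩ := (X.exists_merge hb).choose_spec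
        simp only [contractDisc, if_true]
        rw [h3]
        exact Or.inl (Or.inr h)
      · exact Or.inr ⟨⟨i, hi⟩, h⟩

end Ribbon

/-! ### Marked ribbon presentations and their reduction -/

/-- A ribbon presentation adapted to a handle structure on `(S, P)`: there is one core band around
the co-core of each handle; the other bands, the collars, carry an inner foot, the foot at `-1`.
The predicates `inPC` and `inPI` single out the discs and bands that make up `P`. -/
structure MarkedRibbon {S : Type*} [TopologicalSpace S] [ChartedSpace (EuclideanHalfSpace 2) S]
    {P : Set S} (H : HandleStructure P) extends Ribbon S where
  core : I → Prop
  inPC : C → Prop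
  inPI : I → Prop
  rank : C → ℕ
  mem_P : ∀ x, x ∈ P ↔ (∃ c, inPC c ∧ x ∈ disc c '' square) ∨ ∃ i, inPI i ∧ x ∈ band i '' square
  inP_core : ∀ i, core i → ∀ η, (inPC (fd i η) ↔ inPI i)
  inP_inner : ∀ i, ¬ core i → (inPC (fd i (-1)) ↔ inPI i)
  inP_outer : ∀ i, ¬ core i → inPC (fd i 1) → inPI i
  rank_lt : ∀ i, ¬ core i → rank (fd i 1) < rank (fd i (-1))
  inner_inj : ∀ i j, ¬ core i → ¬ core j → fd i (-1) = fd j (-1) → i = j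
  inner_core : ∀ i, ¬ core i → ∃ j η, core j ∧ fd j η = fd i (-1)
  antecedents : {s | ∃ i, core i ∧ ¬ inPI i ∧ s = {band i (-1, 0), band i (1, 0)}} =
    range fun i : Fin H.r => H.cocoreEnds (Fin.castAdd H.p i)
  primaries : {s | ∃ i, core i ∧ inPI i ∧ s = {band i (-1, 0), band i (1, 0)}} =
    range fun j : Fin H.p => H.cocoreEnds (Fin.natAdd H.r j)
  positive : ∀ i σ, IsPositiveBoundaryCurveAt (fun s => band i (sg σ, sg σ * s)) 0

namespace MarkedRibbon

variable {S : Type*} [TopologicalSpace S] [ChartedSpace (EuclideanHalfSpace 2) S]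
  {P : Set S} {H : HandleStructure P} (X : MarkedRibbon H)

/-- The rank falls from the inner to the outer foot, so a collar never closes up on one disc and can
always be contracted. -/
theorem fd_ne {b : X.I} (hb : ¬ X.core b) : X.fd b 1 ≠ X.fd b (-1) := fun h =>
  absurd (X.rank_lt b hb) (by rw [h]; exact lt_irrefl _)

theorem inPC_contractIdx {b : X.I} (hb : ¬ X.core b) (hP : X.inPC (X.fd b 1) ↔ X.inPI b) (c : X.C) :
    X.inPC (X.contractIdx (X.fd_ne hb) c).1 ↔ X.inPC c := by
  by_cases h : c = X.fd b (-1)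
  · subst h
    rw [X.contractIdx_neg_one, hP, X.inP_inner b hb]
  · rw [X.contractIdx_of_ne _ h]

theorem rank_contractIdx {b : X.I} (hb : ¬ X.core b) (c : X.C) :
    X.rank (X.contractIdx (X.fd_ne hb) c).1 ≤ X.rank c := by
  by_cases h : c = X.fd b (-1)
  · subst h
    rw [X.contractIdx_neg_one]
    exact (X.rank_lt b hb).le
  · rw [X.contractIdx_of_ne _ h]

variable [T2Space S]

/-- Contraction of a collar both of whose feet are attached to discs of the same kind. -/
noncomputable def contract (b : X.I) (hb : ¬ X.core b) (hP : X.inPC (X.fd b 1) ↔ X.inPI b) :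
    MarkedRibbon H where
  toRibbon := X.toRibbon.contract b (X.fd_ne hb)
  core i := X.core i.1
  inPC c := X.inPC c.1
  inPI i := X.inPI i.1
  rank c := X.rank c.1
  mem_P x := by
    rw [X.mem_P]
    constructor
    · rintro (⟨c, hc, hx⟩ | ⟨i, hi, hx⟩)
      · exact Or.inl ⟨X.contractIdx (X.fd_ne hb) c, (X.inPC_contractIdx hb hP c).2 hc,
          X.disc_mem_contractDisc _ c hx⟩
      · by_cases hib : i = b
        · subst hib
          refine Or.inl ⟨⟨X.fd i 1, X.fd_ne hb⟩, hP.2 hi, ?_⟩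
          obtain ⟨-, -, h3, -⟩ := (X.exists_merge (X.fd_ne hb)).choose_spec
          simp only [Ribbon.contract, Ribbon.contractDisc, if_true]
          rw [h3]
          exact Or.inl (Or.inr hx)
        · exact Or.inr ⟨⟨i, hib⟩, hi, hx⟩
    · rintro (⟨⟨c, hcb⟩, hc, s, hs, rfl⟩ | ⟨i, hi, hx⟩)
      · simp only [Ribbon.contract]
        rcases X.contractDisc_cases (X.fd_ne hb) hs (c := c) with ⟨d, u, hu, hd, e⟩ | ⟨u, hu, hd, e⟩
        · refine Or.inl ⟨d, ?_, u, hu, e.symm⟩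
          rcases hd with rfl | ⟨h1, h2⟩
          · exact hc
          · rw [h2, X.inP_inner b hb, ← hP, ← h1]
            exact hc
        · refine Or.inr ⟨b, ?_, u, hu, e.symm⟩
          rw [← hP, ← hd]
          exact hc
      · exact Or.inr ⟨i.1, hi, hx⟩
  inP_core i hi η := (X.inPC_contractIdx hb hP _).trans (X.inP_core i.1 hi η)
  inP_inner i hi := (X.inPC_contractIdx hb hP _).trans (X.inP_inner i.1 hi)
  inP_outer i hi h := X.inP_outer i.1 hi ((X.inPC_contractIdx hb hP _).1 h)
  rank_lt i hi := by
    -- The absorbed disc contains the inner foot of `b` and of no other collar. So inner feet keep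
    -- their discs, while the rank at an outer foot can only fall.
    have h1 : X.fd i.1 (-1) ≠ X.fd b (-1) := fun h => i.2 (X.inner_inj _ _ hi hb h)
    have h2 := X.contractIdx_of_ne (X.fd_ne hb) h1
    simp only [Ribbon.contract, h2]
    exact (X.rank_contractIdx hb _).trans_lt (X.rank_lt i.1 hi)
  inner_inj i j hi hj h := by
    have h1 : X.fd i.1 (-1) ≠ X.fd b (-1) := fun h => i.2 (X.inner_inj _ _ hi hb h)
    have h2 : X.fd j.1 (-1) ≠ X.fd b (-1) := fun h => j.2 (X.inner_inj _ _ hj hb h)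
    simp only [Ribbon.contract, X.contractIdx_of_ne (X.fd_ne hb) h1,
      X.contractIdx_of_ne (X.fd_ne hb) h2, Subtype.mk.injEq] at h
    exact Subtype.ext (X.inner_inj _ _ hi hj h)
  inner_core i hi := by
    obtain ⟨j, η, hj, h⟩ := X.inner_core i.1 hi
    have hjb : j ≠ b := by rintro rfl; exact hb hj
    refine ⟨⟨j, hjb⟩, η, hj, ?_⟩
    simp only [Ribbon.contract, h]
  antecedents := by
    rw [← X.antecedents]
    ext s
    constructor
    · rintro ⟨i, h1, h2, h3⟩
      exact ⟨i.1, h1, h2, h3⟩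
    · rintro ⟨i, h1, h2, h3⟩
      exact ⟨⟨i, by rintro rfl; exact hb h1⟩, h1, h2, h3⟩
  primaries := by
    rw [← X.primaries]
    ext s
    constructor
    · rintro ⟨i, h1, h2, h3⟩
      exact ⟨i.1, h1, h2, h3⟩
    · rintro ⟨i, h1, h2, h3⟩
      exact ⟨⟨i, by rintro rfl; exact hb h1⟩, h1, h2, h3⟩
  positive i σ := X.positive i.1 σ

/-- In a reduced ribbon presentation the collars are those that separate `P` from the rest. -/
def IsReduced : Prop := ∀ i, ¬ X.core i → X.inPI i ∧ ¬ X.inPC (X.fd i 1)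

/-- A collar that violates reducedness has both feet in `P` or both outside, by `inP_outer`, and so
can be contracted. The number of bands decreases. -/
theorem exists_reduced (X : MarkedRibbon H) : ∃ Y : MarkedRibbon H, Y.IsReduced := by
  induction hn : Nat.card X.I using Nat.strong_induction_on generalizing X with
  | _ n ih =>
    by_cases hX : X.IsReduced
    · exact ⟨X, hX⟩
    · unfold IsReduced at hX
      push Not at hX
      obtain ⟨b, hb, h⟩ := hX
      have hP : X.inPC (X.fd b 1) ↔ X.inPI b := ⟨X.inP_outer b hb, h⟩
      refine ih _ ?_ (X.contract b hb hP) rfl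
      rw [← hn]
      exact Finite.card_subtype_lt (p := fun i => i ≠ b) (x := b) (by simp)

end MarkedRibbon

/-! ### The ribbon presentation of a handle structure -/

/-- A parametrization of the closed unit disc by the square. -/
theorem exists_disc_param : ∃ ω : ℝ × ℝ → ℂ, Continuous ω ∧ Function.Injective ω ∧
    ω '' square = Metric.closedBall 0 1 ∧ ω '' rim = Metric.sphere 0 1 := by
  let e : (ℝ × ℝ) ≃L[ℝ] ℂ := Complex.equivRealProdCLM.symm
  have hcv : Convex ℝ (e '' square) := by
    rw [square_eq_closedBall]
    exact (convex_closedBall _ _).is_linear_image e.toLinearMap.isLinear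
  have hint : (interior (e '' square)) = e '' Metric.ball 0 1 := by
    rw [square_eq_closedBall]
    change interior (e.toHomeomorph '' _) = e.toHomeomorph '' _
    rw [← e.toHomeomorph.image_interior, interior_closedBall _ one_ne_zero]
  have hfr : frontier (e '' square) = e '' rim := by
    rw [square_eq_closedBall]
    change frontier (e.toHomeomorph '' _) = e.toHomeomorph '' _
    rw [← e.toHomeomorph.image_frontier, frontier_closedBall _ one_ne_zero]
  have hcomp : IsCompact (e '' square) := isCompact_square.image e.continuous
  -- Bounded convex sets with non-empty interior are carried to the unit ball by a homeomorphism of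
  -- the plane that respects closures and frontiers.
  obtain ⟨h, -, h2, h3⟩ := exists_homeomorph_image_interior_closure_frontier_eq_unitBall hcv
    (by rw [hint]; exact ⟨_, 0, by simp, rfl⟩) (hcomp.isBounded)
  rw [hcomp.isClosed.closure_eq] at h2
  rw [hfr] at h3
  refine ⟨h ∘ e, h.continuous.comp e.continuous, h.injective.comp e.injective, ?_, ?_⟩
  · rw [image_comp, h2]
  · rw [image_comp, h3]

/-- The affine map of the square to the strip `[-1,1] × [a,b]` or its image under rotation by `π`. -/
noncomputable def strip (a b : ℝ) (η : ℤˣ) (z : ℝ × ℝ) : ℝ × ℝ :=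
  (sg η * z.1, sg η * ((a + b) / 2 + (b - a) / 2 * z.2))

theorem continuous_strip (a b : ℝ) (η : ℤˣ) : Continuous (strip a b η) := by
  unfold strip
  fun_prop

theorem strip_injective {a b : ℝ} (hab : a < b) (η : ℤˣ) : Function.Injective (strip a b η) := by
  rintro ⟨x, s⟩ ⟨y, t⟩ h
  simp only [strip, Prod.mk.injEq] at h
  have h1 := mul_left_cancel₀ (sg_ne_zero η) h.1
  have h2 := mul_left_cancel₀ (sg_ne_zero η) h.2
  have h3 : (b - a) / 2 ≠ 0 := by linarith
  ext
  · exact h1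
  · exact mul_left_cancel₀ h3 (by linarith)

theorem strip_level {a b : ℝ} (hab : a < b) (η : ℤˣ) {z : ℝ × ℝ} (hz : z ∈ square) :
    sg η * (strip a b η z).2 ∈ Icc a b := by
  have := (mem_square.1 hz).2
  rw [abs_le] at this
  simp only [strip, sg_mul_sg_mul]
  constructor <;> nlinarith

theorem strip_level' {a b : ℝ} (hab : a < b) (η : ℤˣ) {z : ℝ × ℝ} (hz : |z.2| < 1) :
    sg η * (strip a b η z).2 ∈ Ioo a b := by
  rw [abs_lt] at hz
  simp only [strip, sg_mul_sg_mul]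
  constructor <;> nlinarith

theorem strip_mem_square {a b : ℝ} (hab : a < b) (ha : -1 ≤ a) (hb : b ≤ 1) (η : ℤˣ) {z : ℝ × ℝ}
    (hz : z ∈ square) : strip a b η z ∈ square := by
  have h1 := strip_level hab η hz
  refine mem_square.2 ⟨?_, ?_⟩
  · simpa [strip, abs_sg_mul] using (mem_square.1 hz).1
  · rw [← abs_sg_mul η, abs_le]
    exact ⟨ha.trans h1.1, h1.2.trans hb⟩

theorem exists_strip {a b : ℝ} (hab : a < b) (η : ℤˣ) {z : ℝ × ℝ} (hz : z ∈ square)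
    (h : sg η * z.2 ∈ Icc a b) : ∃ w ∈ square, strip a b η w = z := by
  have h3 : 0 < (b - a) / 2 := by linarith
  refine ⟨(sg η * z.1, (sg η * z.2 - (a + b) / 2) / ((b - a) / 2)), ?_, ?_⟩
  · rw [mem_square]
    refine ⟨by simpa [abs_sg_mul] using (mem_square.1 hz).1, ?_⟩
    simp only
    rw [abs_le, le_div_iff₀ h3, div_le_iff₀ h3]
    constructor <;> linarith [h.1, h.2]
  · simp only [strip, sg_mul_sg_mul]
    ext
    · rfl
    · simp only
      rw [mul_div_cancel₀ _ h3.ne', add_sub_cancel, sg_mul_sg_mul]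

namespace HandleStructure

section

variable {S : Type*} [TopologicalSpace S] [ChartedSpace (EuclideanHalfSpace 2) S]
  {P : Set S} (H : HandleStructure P)

theorem mem_feet {z : ℝ × ℝ} (hz : z ∈ feet) : |z.2| = 1 := by
  rcases hz with h | h
  · rw [h.2]; simp
  · rw [h.2]; simp

theorem feet_subset : feet ⊆ square := by
  rintro z (h | h)
  · exact mem_square.2 ⟨abs_le.2 h.1, by rw [h.2]; simp⟩
  · exact mem_square.2 ⟨abs_le.2 h.1, by rw [h.2]; simp⟩

theorem mem_feet_of {z : ℝ × ℝ} (hz : z ∈ square) (h : |z.2| = 1) : z ∈ feet := by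
  have h1 := abs_le.1 (mem_square.1 hz).1
  rcases (abs_eq zero_le_one).1 h with h | h
  · exact Or.inr ⟨h1, h⟩
  · exact Or.inl ⟨h1, h⟩

theorem one_eq_zero {i k} {z : ℝ × ℝ} {w : ℂ} (hz : z ∈ square) (hw : w ∈ Metric.closedBall 0 1)
    (h : H.one i z = H.zero k w) : |z.2| = 1 := by
  have h1 : H.one i z ∈ H.one i '' feet := by
    rw [← H.attach i]
    exact ⟨mem_image_of_mem _ hz, Or.inl (mem_iUnion.2 ⟨k, h ▸ mem_image_of_mem _ hw⟩)⟩
  obtain ⟨y, hy, he⟩ := h1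
  exact H.one_injOn i (feet_subset hy) hz he ▸ mem_feet hy

theorem one_eq_one_of_lt {i j} (hij : i < j) {z w : ℝ × ℝ} (hz : z ∈ square) (hw : w ∈ square)
    (h : H.one i z = H.one j w) : |w.2| = 1 := by
  have h1 : H.one j w ∈ H.one j '' feet := by
    rw [← H.attach j]
    exact ⟨mem_image_of_mem _ hw, Or.inr (mem_iUnion.2 ⟨i, mem_iUnion.2 ⟨hij,
      h ▸ mem_image_of_mem _ hz⟩⟩)⟩
  obtain ⟨y, hy, he⟩ := h1
  exact H.one_injOn j (feet_subset hy) hw he ▸ mem_feet hy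

/-- All feet attached to sides of handles lie in the part where `ε < |s| < 1 - ε`. -/
def IsMargin (ε : ℝ) : Prop :=
  ∀ (i : Fin (H.r + H.p)) (η : ℤˣ) (j : Fin (H.r + H.p)) (σ : ℤˣ),
    H.one i '' foot (sg η) ⊆ H.one j '' side (sg σ) →
    ∃ ζ : ℤˣ, ∀ x ∈ Icc (-1 : ℝ) 1, ∃ s ∈ Ioo ε (1 - ε),
      H.one i (x, sg η) = H.one j (sg σ, sg ζ * s)

theorem foot_mem_square {η : ℤˣ} {x : ℝ} (hx : x ∈ Icc (-1 : ℝ) 1) : (x, sg η) ∈ square :=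
  mem_square.2 ⟨abs_le.2 hx, (abs_sg η).le⟩

variable [T2Space S]

/-- There are finitely many feet, and each one attached to a side is compact and connected, hence
stays within one open half of the side and away from its ends. So every sufficiently small `ε`
works. -/
theorem exists_margin : ∃ ε, 0 < ε ∧ ε < 1 / 2 ∧ H.IsMargin ε := by
  have key : ∀ᶠ ε in 𝓝[>] (0 : ℝ), H.IsMargin ε := by
    unfold IsMargin
    simp only [eventually_all]
    intro i η j σ hsub
    obtain ⟨g, g1, g2⟩ := exists_leftInv isCompact_square (H.one_continuousOn j) (H.one_injOn j)
    have hside : side (sg σ) ⊆ square := by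
      rintro ⟨a, b⟩ ⟨h1, h2⟩
      obtain rfl : a = sg σ := h1
      refine mem_square.2 ⟨(abs_sg σ).le, abs_le.2 ?_⟩
      rcases h2 with h | h
      · exact ⟨h.1.le, by linarith [h.2]⟩
      · exact ⟨by linarith [h.1], h.2.le⟩
    have hval : ∀ x ∈ Icc (-1 : ℝ) 1, g (H.one i (x, sg η)) ∈ side (sg σ) ∧
        H.one i (x, sg η) = H.one j (g (H.one i (x, sg η))) := by
      intro x hx
      obtain ⟨y, hy, he⟩ := hsub (mem_image_of_mem _ (⟨hx, rfl⟩ : (x, sg η) ∈ foot (sg η)))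
      rw [← he, g2 y (hside hy)]
      exact ⟨hy, rfl⟩
    set s : ℝ → ℝ := fun x => (g (H.one i (x, sg η))).2 with hs
    have hsc : ContinuousOn s (Icc (-1) 1) := by
      refine continuous_snd.comp_continuousOn (g1.comp
        ((H.one_continuousOn i).comp (by fun_prop) fun x hx => foot_mem_square hx) ?_)
      intro x hx
      dsimp only
      rw [(hval x hx).2]
      exact mem_image_of_mem _ (hside (hval x hx).1)
    have hs0 : ∀ x ∈ Icc (-1 : ℝ) 1, s x ∈ Ioo (-1 : ℝ) 0 ∪ Ioo 0 1 := fun x hx => (hval x hx).1.2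
    have hs1 : ∀ x ∈ Icc (-1 : ℝ) 1, H.one i (x, sg η) = H.one j (sg σ, s x) := by
      intro x hx
      have h1 : (g (H.one i (x, sg η))).1 = sg σ := (hval x hx).1.1
      have h2 := (hval x hx).2
      rw [← Prod.mk.eta (p := g (H.one i (x, sg η))), h1] at h2
      exact h2
    -- The height `s` is continuous and never zero on the foot, so its sign is constant.
    obtain ⟨ζ, hζ⟩ : ∃ ζ : ℤˣ, ∀ x ∈ Icc (-1 : ℝ) 1, 0 < sg ζ * s x := by
      have hpre : IsPreconnected (s '' Icc (-1) 1) := isPreconnected_Icc.image _ hsc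
      by_cases hpos : ∃ x ∈ Icc (-1 : ℝ) 1, 0 < s x
      · refine ⟨1, fun x hx => ?_⟩
        rw [sg_one, one_mul]
        by_contra hneg
        push Not at hneg
        obtain ⟨y, hy, hy0⟩ := hpos
        obtain ⟨u, hu, hu0⟩ := hpre.Icc_subset (mem_image_of_mem s hx) (mem_image_of_mem s hy)
          (show (0 : ℝ) ∈ _ from ⟨hneg, hy0.le⟩)
        have := hs0 u hu
        rw [hu0] at this
        simp at this
      · push Not at hpos
        refine ⟨-1, fun x hx => ?_⟩
        have h1 := hpos x hx
        rcases hs0 x hx with h | h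
        · simp only [sg_neg, sg_one]; linarith [h.2]
        · linarith [h.1]
    obtain ⟨x₀, hx₀, hmin⟩ := isCompact_Icc.exists_isMinOn (nonempty_Icc.2 (by norm_num : (-1 : ℝ) ≤ 1))
      (f := fun x => min (sg ζ * s x) (1 - sg ζ * s x)) (by fun_prop)
    have hm : 0 < min (sg ζ * s x₀) (1 - sg ζ * s x₀) := by
      refine lt_min (hζ x₀ hx₀) ?_
      have : |sg ζ * s x₀| < 1 := by
        rw [abs_sg_mul, abs_lt]
        rcases hs0 x₀ hx₀ with h | h
        · exact ⟨h.1, by linarith [h.2]⟩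
        · exact ⟨by linarith [h.1], h.2⟩
      linarith [(abs_lt.1 this).2]
    filter_upwards [Ioo_mem_nhdsGT hm] with ε hε
    refine ⟨ζ, fun x hx => ⟨sg ζ * s x, ?_, ?_⟩⟩
    · have h1 : min (sg ζ * s x₀) (1 - sg ζ * s x₀) ≤ min (sg ζ * s x) (1 - sg ζ * s x) := hmin hx
      have h2 := hε.2.trans_le h1
      exact ⟨h2.trans_le (min_le_left _ _), by linarith [h2.trans_le (min_le_right _ _)]⟩
    · rw [sg_mul_sg_mul]
      exact hs1 x hx
  obtain ⟨ε, h1, h2⟩ := (key.and (Ioo_mem_nhdsGT (by norm_num : (0 : ℝ) < 1 / 2))).exists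
  exact ⟨ε, h2.1, h2.2, h1⟩

end

end HandleStructure

theorem IsPositiveBoundaryCurveAt.comp_affine {S : Type*} [TopologicalSpace S]
    [ChartedSpace (EuclideanHalfSpace 2) S] {c : ℝ → S} {a b : ℝ} (hb : 0 < b)
    (h : IsPositiveBoundaryCurveAt c a) :
    IsPositiveBoundaryCurveAt (fun s => c (a + b * s)) 0 := by
  have ht : Tendsto (fun s : ℝ => a + b * s) (𝓝 0) (𝓝 a) := by
    have : Continuous fun s : ℝ => a + b * s := by fun_prop
    simpa using this.tendsto 0
  refine ⟨ht.eventually h.1, fun e he hs => ?_⟩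
  obtain ⟨δ, hδ, hanti⟩ := h.2 e he (by simpa using hs)
  refine ⟨δ / b, by positivity, fun s hs t ht hst => ?_⟩
  have hmem : ∀ u ∈ Ioo (0 - δ / b) (0 + δ / b), a + b * u ∈ Ioo (a - δ) (a + δ) := by
    intro u hu
    have h1 : b * (δ / b) = δ := by field_simp
    constructor <;> nlinarith [hu.1, hu.2]
  exact hanti (hmem s hs) (hmem t ht) (by nlinarith)

namespace HandleStructure

variable {S : Type*} [TopologicalSpace S] [ChartedSpace (EuclideanHalfSpace 2) S]
  {P : Set S} (H : HandleStructure P)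

theorem isPositive_side (i : Fin (H.r + H.p)) (κ : ℤˣ) {t : ℝ} (ht : t ∈ Ioo (-1 : ℝ) 1)
    (h : ∀ᶠ s in 𝓝 t, H.one i (sg κ, sg κ * s) ∈ (𝓡∂ 2).boundary S) :
    IsPositiveBoundaryCurveAt (fun s => H.one i (sg κ, sg κ * s)) t := by
  rcases Int.units_eq_one_or κ with rfl | rfl
  · simp only [sg_one, one_mul] at h ⊢
    exact H.right_oriented i t ht h
  · simp only [sg_neg, sg_one, neg_mul, one_mul] at h ⊢
    exact H.left_oriented i t ht h

variable {H}

theorem foot_cases {ε : ℝ} (hm : H.IsMargin ε) (i : Fin (H.r + H.p)) (η : ℤˣ) :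
    (∃ k, H.one i '' foot (sg η) ⊆ H.zero k '' Metric.sphere 0 1) ∨
    ∃ j, j < i ∧ ∃ σ ζ : ℤˣ, ∀ x ∈ Icc (-1 : ℝ) 1, ∃ s ∈ Ioo ε (1 - ε),
      H.one i (x, sg η) = H.one j (sg σ, sg ζ * s) := by
  rcases H.foot_mem i (sg η) (by rcases sg_eq η with h | h <;> simp [h]) with h | ⟨j, hj, σ, hσ, h⟩
  · exact Or.inl h
  · obtain ⟨σ', rfl⟩ : ∃ σ', σ = sg σ' := exists_sg_of_abs (by
      rcases hσ with rfl | hσ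
      · simp
      · rw [mem_singleton_iff.1 hσ]; simp)
    obtain ⟨ζ, hζ⟩ := hm i η j σ' h
    exact Or.inr ⟨j, hj, σ', ζ, hζ⟩

/-- The common point lies on a foot of the later handle `j`. If that foot sits on handle `i`, the
margin applies. In every other case the point would also be on a foot of `i`, or at level one in the
handle that carries the foot, and both are excluded. -/
theorem level_of_lt {ε : ℝ} (hε : 0 < ε) (hm : H.IsMargin ε) {i j} (hij : i < j) {z w : ℝ × ℝ}
    (hz : z ∈ square) (hw : w ∈ square) (h : H.one i z = H.one j w) :
    ε < |z.2| ∧ |z.2| < 1 - ε := by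
  have hw1 := H.one_eq_one_of_lt hij hz hw h
  have hwf := mem_feet_of hw hw1
  have hx := abs_le.1 (mem_square.1 hw).1
  obtain ⟨η, hη⟩ := exists_sg_of_abs hw1
  have hzf : |z.2| ≠ 1 := fun h1 => (Set.disjoint_left.1 (H.feet_disjoint i j hij.ne)
    (mem_image_of_mem _ (mem_feet_of hz h1))) (h ▸ mem_image_of_mem _ hwf)
  have hw2 : w = (w.1, sg η) := by rw [← hη]
  rcases foot_cases hm j η with ⟨k, hk⟩ | ⟨l, -, σ, ζ, hl⟩
  · obtain ⟨u, hu, hue⟩ := hk (mem_image_of_mem _ (⟨hx, rfl⟩ : (w.1, sg η) ∈ foot (sg η)))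
    rw [← hw2, ← h] at hue
    exact absurd (H.one_eq_zero hz (Metric.sphere_subset_closedBall hu) hue.symm) hzf
  · obtain ⟨s, hs, he⟩ := hl w.1 hx
    rw [← hw2, ← h] at he
    have hs1 : |sg ζ * s| = s := by rw [abs_sg_mul, abs_of_pos (hε.trans hs.1)]
    have hsq : (sg σ, sg ζ * s) ∈ square :=
      mem_square.2 ⟨(abs_sg σ).le, by simp only; rw [hs1]; linarith [hs.2]⟩
    rcases lt_trichotomy i l with hil | rfl | hil
    · have h1 := H.one_eq_one_of_lt hil hz hsq he
      simp only at h1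
      rw [hs1] at h1
      linarith [hs.2]
    · have h1 := H.one_injOn i hz hsq he
      rw [h1]
      simp only
      rw [hs1]
      exact hs
    · exact absurd (H.one_eq_one_of_lt hil hsq hz he.symm) hzf

variable (H)

/-- The discs of the initial ribbon presentation: the `0`-handles and two rectangles in
each `1`-handle, on both sides of the co-core. -/
noncomputable def initDisc (ω : ℝ × ℝ → ℂ) (ε : ℝ) :
    Fin H.d ⊕ Fin (H.r + H.p) × ℤˣ → ℝ × ℝ → S :=
  Sum.elim (fun k => H.zero k ∘ ω) fun x => H.one x.1 ∘ strip ε (1 - ε) x.2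

/-- The bands of the initial ribbon presentation: neighbourhoods of the co-core and of both feet
of each `1`-handle. -/
noncomputable def initBand (ε : ℝ) : Fin (H.r + H.p) ⊕ Fin (H.r + H.p) × ℤˣ → ℝ × ℝ → S :=
  Sum.elim (fun i => H.one i ∘ strip (-ε) ε 1) fun x => H.one x.1 ∘ strip (1 - ε) 1 x.2

variable {H}

/-- By the margin a foot on a side of handle `j` lies in the rim of one of the two rectangles of
`j`. That `j` is earlier makes the rank of a parent smaller. -/
theorem exists_parent {ω : ℝ × ℝ → ℂ} (hω : ω '' rim = Metric.sphere 0 1) {ε : ℝ}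
    (hε2 : ε < 1 / 2) (hm : H.IsMargin ε) (i : Fin (H.r + H.p)) (η : ℤˣ) :
    ∃ c, (∀ x ∈ Icc (-1 : ℝ) 1, H.one i (x, sg η) ∈ H.initDisc ω ε c '' rim) ∧
      ∀ y, c = Sum.inr y → y.1 < i := by
  rcases foot_cases hm i η with ⟨k, hk⟩ | ⟨j, hj, σ, ζ, h⟩
  · refine ⟨Sum.inl k, fun x hx => ?_, fun y hy => by simp at hy⟩
    have := hk (mem_image_of_mem _ (⟨hx, rfl⟩ : (x, sg η) ∈ foot (sg η)))
    rw [← hω, ← image_comp] at this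
    exact this
  · refine ⟨Sum.inr (j, ζ), fun x hx => ?_, fun y hy => by rw [← Sum.inr_injective hy]; exact hj⟩
    obtain ⟨s, hs, he⟩ := h x hx
    have h2 : 0 < 1 - 2 * ε := by linarith
    -- The inverse of the affine parametrization of the strip between heights `ε` and `1 - ε`.
    refine ⟨(sg ζ * sg σ, (2 * s - 1) / (1 - 2 * ε)), mem_rim_of_fst (by rw [abs_mul]; simp) ?_, ?_⟩
    · rw [abs_le, le_div_iff₀ h2, div_le_iff₀ h2]
      constructor <;> linarith [hs.1, hs.2]
    · rw [he]
      simp only [initDisc, Sum.elim_inr, Function.comp_apply, strip, sg_mul_sg_mul]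
      congr 3
      rw [show 1 - ε - ε = 1 - 2 * ε by ring, div_mul_div_comm, mul_comm (1 - 2 * ε),
        mul_div_mul_right _ _ h2.ne']
      ring

/-- Which part of a handle a piece occupies, and that it is a part of this handle. -/
theorem initDisc_inr {ω : ℝ × ℝ → ℂ} {ε : ℝ} (hε : 0 < ε) (hε2 : ε < 1 / 2)
    (x : Fin (H.r + H.p) × ℤˣ) {z : ℝ × ℝ} (hz : z ∈ square) :
    ∃ w ∈ square, H.initDisc ω ε (Sum.inr x) z = H.one x.1 w ∧ ε ≤ |w.2| ∧ |w.2| ≤ 1 - ε ∧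
      0 < sg x.2 * w.2 := by
  have h := strip_level (a := ε) (b := 1 - ε) (by linarith) x.2 hz
  refine ⟨_, strip_mem_square (by linarith) (by linarith) (by linarith) x.2 hz, rfl, ?_⟩
  rw [← abs_sg_mul x.2, abs_of_pos (hε.trans_le h.1)]
  exact ⟨h.1, h.2, hε.trans_le h.1⟩

theorem initBand_inl {ε : ℝ} (hε : 0 < ε) (hε2 : ε < 1 / 2)
    (i : Fin (H.r + H.p)) {z : ℝ × ℝ} (hz : z ∈ square) :
    ∃ w ∈ square, H.initBand ε (Sum.inl i) z = H.one i w ∧ |w.2| ≤ ε ∧ (|z.2| < 1 → |w.2| < ε) := by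
  have h := strip_level (a := -ε) (b := ε) (by linarith) 1 hz
  refine ⟨_, strip_mem_square (by linarith) (by linarith) (by linarith) 1 hz, rfl, ?_, ?_⟩
  · rw [sg_one, one_mul] at h
    exact abs_le.2 h
  · intro h2
    have h3 := strip_level' (a := -ε) (b := ε) (by linarith) 1 h2
    rw [sg_one, one_mul] at h3
    exact abs_lt.2 h3

theorem initBand_inr {ε : ℝ} (hε : 0 < ε) (hε2 : ε < 1 / 2)
    (x : Fin (H.r + H.p) × ℤˣ) {z : ℝ × ℝ} (hz : z ∈ square) :
    ∃ w ∈ square, H.initBand ε (Sum.inr x) z = H.one x.1 w ∧ 1 - ε ≤ |w.2| ∧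
      0 < sg x.2 * w.2 ∧ (|z.2| < 1 → 1 - ε < |w.2| ∧ |w.2| < 1) := by
  have h := strip_level (a := 1 - ε) (b := 1) (by linarith) x.2 hz
  have h0 : 0 < sg x.2 * (strip (1 - ε) 1 x.2 z).2 := by linarith [h.1]
  refine ⟨_, strip_mem_square (by linarith) (by linarith) (by linarith) x.2 hz, rfl, ?_, h0, ?_⟩
  · rw [← abs_sg_mul x.2, abs_of_pos h0]
    exact h.1
  · intro h2
    have h3 := strip_level' (a := 1 - ε) (b := 1) (by linarith) x.2 h2
    rw [← abs_sg_mul x.2, abs_of_pos h0]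
    exact h3

theorem sign_eq_of_pos {η ζ : ℤˣ} {s : ℝ} (h1 : 0 < sg η * s) (h2 : 0 < sg ζ * s) : η = ζ := by
  by_contra h
  rw [← ne_eq, units_int_ne_iff] at h
  rw [h, sg_neg] at h1
  linarith

theorem initDisc_disj {ω : ℝ × ℝ → ℂ} (hω : ω '' square = Metric.closedBall 0 1) {ε : ℝ}
    (hε : 0 < ε) (hε2 : ε < 1 / 2) (c c' : Fin H.d ⊕ Fin (H.r + H.p) × ℤˣ) (s : ℝ × ℝ)
    (hs : s ∈ square) (t : ℝ × ℝ) (ht : t ∈ square)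
    (h : H.initDisc ω ε c s = H.initDisc ω ε c' t) : c = c' := by
  have hωm : ∀ z ∈ square, ω z ∈ Metric.closedBall (0 : ℂ) 1 := fun z hz =>
    hω ▸ mem_image_of_mem ω hz
  rcases c with k | x <;> rcases c' with l | y
  · by_contra hkl
    exact Set.disjoint_left.1 (H.zero_disjoint k l fun h => hkl (by rw [h]))
      (mem_image_of_mem _ (hωm s hs)) (show H.zero k (ω s) ∈ _ from
        (show H.zero k (ω s) = H.zero l (ω t) from h) ▸ mem_image_of_mem _ (hωm t ht))
  · obtain ⟨w, hw, e, h1, h2, h3⟩ := initDisc_inr (ω := ω) hε hε2 y ht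
    have := H.one_eq_zero hw (hωm s hs) (e.symm.trans h.symm)
    linarith
  · obtain ⟨w, hw, e, h1, h2, h3⟩ := initDisc_inr (ω := ω) hε hε2 x hs
    have := H.one_eq_zero hw (hωm t ht) (e.symm.trans h)
    linarith
  · obtain ⟨w, hw, e, h1, h2, h3⟩ := initDisc_inr (ω := ω) hε hε2 x hs
    obtain ⟨w', hw', e', h1', h2', h3'⟩ := initDisc_inr (ω := ω) hε hε2 y ht
    rw [e, e'] at h
    obtain ⟨i, η⟩ := x
    obtain ⟨j, ζ⟩ := y
    simp only at *
    rcases lt_trichotomy i j with hij | rfl | hij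
    · linarith [H.one_eq_one_of_lt hij hw hw' h]
    · have h4 := H.one_injOn i hw hw' h
      rw [← h4] at h3'
      rw [sign_eq_of_pos h3 h3']
    · linarith [H.one_eq_one_of_lt hij hw' hw h.symm]

/-- Within one handle the strips have disjoint heights or opposite signs. Points shared with a later
handle have height strictly between `ε` and `1 - ε` in the earlier one, where there is no band. -/
theorem initBand_disj {ε : ℝ} (hε : 0 < ε) (hε2 : ε < 1 / 2) (hm : H.IsMargin ε)
    (c c' : Fin (H.r + H.p) ⊕ Fin (H.r + H.p) × ℤˣ) (s : ℝ × ℝ)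
    (hs : s ∈ square) (t : ℝ × ℝ) (ht : t ∈ square)
    (h : H.initBand ε c s = H.initBand ε c' t) : c = c' := by
  rcases c with i | x <;> rcases c' with j | y
  · obtain ⟨w, hw, e, h1, -⟩ := initBand_inl hε hε2 i hs
    obtain ⟨w', hw', e', h1', -⟩ := initBand_inl hε hε2 j ht
    rw [e, e'] at h
    rcases lt_trichotomy i j with hij | rfl | hij
    · linarith [H.one_eq_one_of_lt hij hw hw' h]
    · rfl
    · linarith [H.one_eq_one_of_lt hij hw' hw h.symm]
  · obtain ⟨w, hw, e, h1, -⟩ := initBand_inl hε hε2 i hs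
    obtain ⟨w', hw', e', h1', -⟩ := initBand_inr hε hε2 y ht
    rw [e, e'] at h
    rcases lt_trichotomy i y.1 with hij | hij | hij
    · linarith [(level_of_lt hε hm hij hw hw' h).1]
    · subst hij
      have h4 := H.one_injOn _ hw hw' h
      rw [h4] at h1
      linarith
    · linarith [H.one_eq_one_of_lt hij hw' hw h.symm]
  · obtain ⟨w, hw, e, h1, -⟩ := initBand_inl hε hε2 j ht
    obtain ⟨w', hw', e', h1', -⟩ := initBand_inr hε hε2 x hs
    rw [e, e'] at h
    rcases lt_trichotomy j x.1 with hij | hij | hij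
    · linarith [(level_of_lt hε hm hij hw hw' h.symm).1]
    · subst hij
      have h4 := H.one_injOn _ hw' hw h
      rw [h4] at h1'
      linarith
    · linarith [H.one_eq_one_of_lt hij hw' hw h]
  · obtain ⟨w, hw, e, h1, h2, -⟩ := initBand_inr hε hε2 x hs
    obtain ⟨w', hw', e', h1', h2', -⟩ := initBand_inr hε hε2 y ht
    rw [e, e'] at h
    obtain ⟨i, η⟩ := x
    obtain ⟨j, ζ⟩ := y
    simp only at *
    rcases lt_trichotomy i j with hij | rfl | hij
    · linarith [(level_of_lt hε hm hij hw hw' h).2]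
    · have h4 := H.one_injOn i hw hw' h
      rw [← h4] at h2'
      rw [sign_eq_of_pos h2 h2']
    · linarith [(level_of_lt hε hm hij hw' hw h.symm).2]

theorem initBand_notMem {ω : ℝ × ℝ → ℂ} (hω : ω '' square = Metric.closedBall 0 1) {ε : ℝ}
    (hε : 0 < ε) (hε2 : ε < 1 / 2) (i : Fin (H.r + H.p) ⊕ Fin (H.r + H.p) × ℤˣ) (z : ℝ × ℝ)
    (hz : z ∈ square) (hz2 : |z.2| < 1) (c : Fin H.d ⊕ Fin (H.r + H.p) × ℤˣ) :
    H.initBand ε i z ∉ H.initDisc ω ε c '' square := by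
  rintro ⟨s, hs, h⟩
  have hωm : ∀ z ∈ square, ω z ∈ Metric.closedBall (0 : ℂ) 1 := fun z hz =>
    hω ▸ mem_image_of_mem ω hz
  obtain ⟨j, w, hw, e, h1, h2⟩ : ∃ j, ∃ w ∈ square, H.initBand ε i z = H.one j w ∧ |w.2| < 1 ∧
      (|w.2| < ε ∨ 1 - ε < |w.2|) := by
    rcases i with i | x
    · obtain ⟨w, hw, e, -, h1⟩ := initBand_inl hε hε2 i hz
      exact ⟨i, w, hw, e, by linarith [h1 hz2], Or.inl (h1 hz2)⟩
    · obtain ⟨w, hw, e, -, -, h1⟩ := initBand_inr hε hε2 x hz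
      exact ⟨_, w, hw, e, (h1 hz2).2, Or.inr (h1 hz2).1⟩
  rw [e] at h
  rcases c with k | y
  · linarith [H.one_eq_zero hw (hωm s hs) h.symm]
  · obtain ⟨w', hw', e', h1', h2', -⟩ := initDisc_inr (ω := ω) hε hε2 y hs
    rw [e'] at h
    rcases lt_trichotomy j y.1 with hij | hij | hij
    · linarith [H.one_eq_one_of_lt hij hw hw' h.symm]
    · subst hij
      have h4 := H.one_injOn _ hw' hw h
      rw [h4] at h1' h2'
      rcases h2 with h2 | h2 <;> linarith
    · linarith [H.one_eq_one_of_lt hij hw' hw h]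

theorem exists_init_cover {ω : ℝ × ℝ → ℂ} {ε : ℝ}
    (hε : 0 < ε) (hε2 : ε < 1 / 2) (i : Fin (H.r + H.p)) {z : ℝ × ℝ} (hz : z ∈ square) :
    (∃ η, H.one i z ∈ H.initDisc ω ε (Sum.inr (i, η)) '' square) ∨
    (H.one i z ∈ H.initBand ε (Sum.inl i) '' square) ∨
    ∃ η, H.one i z ∈ H.initBand ε (Sum.inr (i, η)) '' square := by
  obtain ⟨η, hη⟩ : ∃ η, sg η * z.2 = |z.2| := by
    rcases le_total 0 z.2 with h | h
    · exact ⟨1, by simp [abs_of_nonneg h]⟩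
    · exact ⟨-1, by simp [abs_of_nonpos h]⟩
  have h1 := (mem_square.1 hz).2
  rcases le_total |z.2| ε with h2 | h2
  · right; left
    obtain ⟨w, hw, he⟩ := exists_strip (a := -ε) (b := ε) (by linarith) 1 hz
      (by rw [sg_one, one_mul]; exact abs_le.1 h2)
    exact ⟨w, hw, by simp [initBand, he]⟩
  · rcases le_total |z.2| (1 - ε) with h3 | h3
    · left
      obtain ⟨w, hw, he⟩ := exists_strip (a := ε) (b := 1 - ε) (by linarith) η hz
        (by rw [hη]; exact ⟨h2, h3⟩)
      exact ⟨η, w, hw, by simp [initDisc, he]⟩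
    · right; right
      obtain ⟨w, hw, he⟩ := exists_strip (a := 1 - ε) (b := 1) (by linarith) η hz
        (by rw [hη]; exact ⟨h3, h1⟩)
      exact ⟨η, w, hw, by simp [initBand, he]⟩

variable (H)

theorem exists_ribbon [T2Space S] : Nonempty (MarkedRibbon H) := by
  obtain ⟨ω, hωc, hωi, hω, hωr⟩ := exists_disc_param
  obtain ⟨ε, hε, hε2, hm⟩ := H.exists_margin
  choose par hpar hpar2 using exists_parent (H := H) hωr hε2 hm
  have hωm : MapsTo ω square (Metric.closedBall (0 : ℂ) 1) := fun z hz =>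
    hω ▸ mem_image_of_mem ω hz
  let X : Ribbon S :=
    { C := Fin H.d ⊕ Fin (H.r + H.p) × ℤˣ
      I := Fin (H.r + H.p) ⊕ Fin (H.r + H.p) × ℤˣ
      finC := inferInstance
      finI := inferInstance
      disc := H.initDisc ω ε
      band := H.initBand ε
      -- A core joins the two rectangles of its handle. A collar has its foot `-1` in its own
      -- rectangle and its foot `1` in the parent disc.
      fd := Sum.elim (fun i η => Sum.inr (i, η))
        fun x η => if η = 1 then par x.1 x.2 else Sum.inr x
      disc_cont := by
        rintro (k | x)
        · exact (H.zero_continuousOn k).comp hωc.continuousOn hωm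
        · exact (H.one_continuousOn x.1).comp (continuous_strip _ _ _).continuousOn
            fun z hz => strip_mem_square (by linarith) (by linarith) (by linarith) _ hz
      disc_inj := by
        rintro (k | x)
        · exact (H.zero_injOn k).comp hωi.injOn hωm
        · exact (H.one_injOn x.1).comp (strip_injective (by linarith) _).injOn
            fun z hz => strip_mem_square (by linarith) (by linarith) (by linarith) _ hz
      disc_disj := initDisc_disj hω hε hε2
      band_cont := by
        rintro (k | x)
        · exact (H.one_continuousOn k).comp (continuous_strip _ _ _).continuousOn
            fun z hz => strip_mem_square (by linarith) (by linarith) (by linarith) _ hz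
        · exact (H.one_continuousOn x.1).comp (continuous_strip _ _ _).continuousOn
            fun z hz => strip_mem_square (by linarith) (by linarith) (by linarith) _ hz
      band_inj := by
        rintro (k | x)
        · exact (H.one_injOn k).comp (strip_injective (by linarith) _).injOn
            fun z hz => strip_mem_square (by linarith) (by linarith) (by linarith) _ hz
        · exact (H.one_injOn x.1).comp (strip_injective (by linarith) _).injOn
            fun z hz => strip_mem_square (by linarith) (by linarith) (by linarith) _ hz
      band_disj := initBand_disj hε hε2 hm
      foot_mem := by
        rintro (i | ⟨i, ζ⟩) η x hx
        · refine ⟨(sg η * x, -1), mem_rim_of_snd (abs_le.2 (sg_mul_mem_Icc _ hx)) (by simp), ?_⟩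
          simp only [Sum.elim_inl, initDisc, initBand, Sum.elim_inr, Function.comp_apply, strip,
            sg_mul_sg_mul]
          congr 2
          · simp
          · rw [sg_one]; ring
        · simp only [Sum.elim_inr]
          rcases Int.units_eq_one_or η with rfl | rfl
          · rw [if_pos rfl]
            have := hpar i ζ (sg ζ * x) (sg_mul_mem_Icc _ hx)
            simp only [initBand, Sum.elim_inr, Function.comp_apply, strip, sg_one]
            convert this using 3
            ring
          · rw [if_neg (by decide)]
            refine ⟨(x, 1), mem_rim_of_snd (abs_le.2 hx) (by simp), ?_⟩
            simp only [initDisc, initBand, Sum.elim_inr, Function.comp_apply, strip, sg_neg, sg_one]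
            congr 3
            ring
      band_notMem := initBand_notMem hω hε hε2
      cover := by
        intro x
        have hx : x ∈ (⋃ k, H.zero k '' Metric.closedBall 0 1) ∪ ⋃ i, H.one i '' square :=
          H.cover ▸ mem_univ x
        rcases hx with hx | hx
        · obtain ⟨k, hk⟩ := mem_iUnion.1 hx
          refine Or.inl ⟨Sum.inl k, ?_⟩
          rw [← hω, ← image_comp] at hk
          exact hk
        · obtain ⟨i, z, hz, rfl⟩ := mem_iUnion.1 hx
          rcases exists_init_cover (ω := ω) hε hε2 i hz with ⟨η, h⟩ | h | ⟨η, h⟩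
          · exact Or.inl ⟨_, h⟩
          · exact Or.inr ⟨_, h⟩
          · exact Or.inr ⟨_, h⟩ }
  have hcore0 : ∀ i : Fin (H.r + H.p), ∀ σ : ℝ, H.initBand ε (Sum.inl i) (σ, 0) = H.one i (σ, 0) := by
    intro i σ
    simp [initBand, strip]
  -- A side of a band is an increasing affine piece of a side of its handle. It lies in the
  -- boundary, so the orientation clause of the handle structure applies to it.
  have hpos : ∀ (b : X.I) (i : Fin (H.r + H.p)) (κ : ℤˣ) (A B : ℝ) (σ : ℤˣ), |A| < 1 → 0 < B →
      (∀ s, X.band b (sg σ, sg σ * s) = H.one i (sg κ, sg κ * (A + B * s))) →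
      IsPositiveBoundaryCurveAt (fun s => X.band b (sg σ, sg σ * s)) 0 := by
    intro b i κ A B σ hA hB hs
    have h1 : ∀ᶠ u in 𝓝 A, H.one i (sg κ, sg κ * u) ∈ (𝓡∂ 2).boundary S := by
      have hc : Continuous fun u : ℝ => (u - A) / B := by fun_prop
      have h2 : ∀ᶠ u in 𝓝 A, (u - A) / B ∈ Ioo (-1 : ℝ) 1 := by
        refine hc.continuousAt (isOpen_Ioo.mem_nhds ?_)
        simp
      filter_upwards [h2] with u hu
      have h3 := X.openSide_mem_boundary b σ (s := sg σ * ((u - A) / B))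
        (by rw [abs_sg_mul, abs_lt]; exact hu)
      rw [hs, mul_div_cancel₀ _ hB.ne', add_sub_cancel] at h3
      exact h3
    have h4 := (H.isPositive_side i κ (abs_lt.1 hA) h1).comp_affine hB
    have h5 : (fun s => X.band b (sg σ, sg σ * s)) =
        fun s => H.one i (sg κ, sg κ * (A + B * s)) := funext hs
    rw [h5]
    exact h4
  have hcast : ∀ i : Fin (H.r + H.p), ¬ H.r ≤ i.1 ↔ ∃ a, i = Fin.castAdd H.p a := by
    intro i
    constructor
    · intro h
      exact ⟨⟨i.1, by omega⟩, rfl⟩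
    · rintro ⟨a, rfl⟩
      simp
  have hnat : ∀ i : Fin (H.r + H.p), H.r ≤ i.1 ↔ ∃ a, i = Fin.natAdd H.r a := by
    intro i
    constructor
    · intro h
      exact ⟨⟨i.1 - H.r, by omega⟩, by ext; simp; omega⟩
    · rintro ⟨a, rfl⟩
      simp
  refine ⟨{ toRibbon := X
            core := Sum.elim (fun _ => True) fun _ => False
            inPC := Sum.elim (fun _ => False) fun x => H.r ≤ x.1.1
            inPI := Sum.elim (fun i => H.r ≤ i.1) fun x => H.r ≤ x.1.1
            -- The shift by one places the rectangles of the very first handle above the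
            -- `0`-handles.
            rank := Sum.elim (fun _ => 0) fun x => x.1.1 + 1
            mem_P := ?_
            inP_core := ?_
            inP_inner := ?_
            inP_outer := ?_
            rank_lt := ?_
            inner_inj := ?_
            inner_core := ?_
            antecedents := ?_
            primaries := ?_
            positive := ?_ }⟩
  · intro x
    constructor
    · intro hx
      rw [H.eq_P] at hx
      obtain ⟨j, z, hz, rfl⟩ := mem_iUnion.1 hx
      rcases exists_init_cover (ω := ω) hε hε2 (Fin.natAdd H.r j) hz with ⟨η, h⟩ | h | ⟨η, h⟩
      · exact Or.inl ⟨Sum.inr (_, η), (hnat _).2 ⟨j, rfl⟩, h⟩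
      · exact Or.inr ⟨Sum.inl _, (hnat _).2 ⟨j, rfl⟩, h⟩
      · exact Or.inr ⟨Sum.inr (_, η), (hnat _).2 ⟨j, rfl⟩, h⟩
    · intro hx
      obtain ⟨i, hi, w, hw, rfl⟩ : ∃ i : Fin (H.r + H.p), H.r ≤ i.1 ∧ x ∈ H.one i '' square := by
        rcases hx with ⟨k | y, hc, s, hs, rfl⟩ | ⟨i | y, hc, s, hs, rfl⟩
        · exact absurd hc (by simp)
        · obtain ⟨w, hw, e, -⟩ := initDisc_inr (ω := ω) hε hε2 y hs
          exact ⟨y.1, hc, w, hw, e.symm⟩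
        · obtain ⟨w, hw, e, -⟩ := initBand_inl hε hε2 i hs
          exact ⟨i, hc, w, hw, e.symm⟩
        · obtain ⟨w, hw, e, -⟩ := initBand_inr hε hε2 y hs
          exact ⟨y.1, hc, w, hw, e.symm⟩
      obtain ⟨a, rfl⟩ := (hnat i).1 hi
      exact (Set.ext_iff.1 H.eq_P _).2 (mem_iUnion.2 ⟨a, mem_image_of_mem _ hw⟩)
  · rintro (i | y) hi η
    · rfl
    · exact hi.elim
  · rintro (i | y) hi
    · exact absurd trivial hi
    · rfl
  · rintro (i | y) hi h
    · exact absurd trivial hi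
    · have h2 := hpar2 y.1 y.2
      change Sum.elim (fun _ => False) (fun x : Fin (H.r + H.p) × ℤˣ => H.r ≤ x.1.1)
        (par y.1 y.2) at h
      change H.r ≤ y.1.1
      rcases hp : par y.1 y.2 with k | x
      · rw [hp] at h
        exact h.elim
      · rw [hp] at h
        have h3 : x.1.1 < y.1.1 := h2 x hp
        exact le_trans h h3.le
  · rintro (i | y) hi
    · exact absurd trivial hi
    · have h2 := hpar2 y.1 y.2
      change Sum.elim (fun _ => 0) (fun x : Fin (H.r + H.p) × ℤˣ => x.1.1 + 1)
        (par y.1 y.2) < y.1.1 + 1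
      rcases hp : par y.1 y.2 with k | x
      · simp
      · have h3 : x.1.1 < y.1.1 := h2 x hp
        simpa using h3
  · rintro (i | y) (j | y') hi hj h
    · exact absurd trivial hi
    · exact absurd trivial hi
    · exact absurd trivial hj
    · rw [Sum.inr_injective (show (Sum.inr y : X.C) = Sum.inr y' from h)]
  · rintro (i | y) hi
    · exact absurd trivial hi
    · exact ⟨Sum.inl y.1, y.2, trivial, rfl⟩
  · ext s
    constructor
    · rintro ⟨i | y, h1, h2, rfl⟩
      · obtain ⟨a, rfl⟩ := (hcast i).1 h2
        refine ⟨a, ?_⟩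
        simp only [cocoreEnds]
        rw [← hcore0, ← hcore0]
      · exact h1.elim
    · rintro ⟨a, rfl⟩
      refine ⟨Sum.inl (Fin.castAdd H.p a), trivial, (hcast _).2 ⟨a, rfl⟩, ?_⟩
      simp only [cocoreEnds]
      rw [← hcore0, ← hcore0]
  · ext s
    constructor
    · rintro ⟨i | y, h1, h2, rfl⟩
      · obtain ⟨a, rfl⟩ := (hnat i).1 h2
        refine ⟨a, ?_⟩
        simp only [cocoreEnds]
        rw [← hcore0, ← hcore0]
      · exact h1.elim
    · rintro ⟨a, rfl⟩
      refine ⟨Sum.inl (Fin.natAdd H.r a), trivial, (hnat _).2 ⟨a, rfl⟩, ?_⟩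
      simp only [cocoreEnds]
      rw [← hcore0, ← hcore0]
  · rintro (i | y) σ
    · refine hpos (Sum.inl i) i σ 0 ε σ (by simp) hε fun s => ?_
      simp only [X, initBand, Sum.elim_inl, Function.comp_apply, strip, sg_one]
      congr 2
      · ring
      · ring
    · refine hpos (Sum.inr y) y.1 (y.2 * σ) (sg σ * (1 - ε / 2)) (ε / 2) σ ?_ (by linarith) fun s => ?_
      · rw [abs_sg_mul, abs_of_pos (by linarith)]
        linarith
      · simp only [X, initBand, Sum.elim_inr, Function.comp_apply, strip, sg_mul]
        congr 2
        have := sg_mul_self σ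
        linear_combination (-(sg y.2 * (1 - ε / 2))) * this

end HandleStructure

/-! ### Finite subsets of circles -/

theorem circle_exp_add_int (t : ℝ) (k : ℤ) : Circle.exp (t + k * (2 * Real.pi)) = Circle.exp t :=
  Circle.exp_eq_exp.2 ⟨k, rfl⟩

theorem circle_exp_injOn {t : ℝ} : InjOn Circle.exp (Ioc t (t + 2 * Real.pi)) := by
  intro a ha b hb h
  obtain ⟨k, hk⟩ := Circle.exp_eq_exp.1 h
  have hk0 : k = 0 := int_eq_zero_of_abs_lt Real.two_pi_pos
    (by rw [abs_lt]; constructor <;> linarith [ha.1, ha.2, hb.1, hb.2])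
  simpa [hk0] using hk

section

variable {n : ℕ} {Y : Set (Fin n × Circle)}

theorem finite_angles (hY : Y.Finite) (m : Fin n) (t : ℝ) :
    {u ∈ Ioc t (t + 2 * Real.pi) | (m, Circle.exp u) ∈ Y}.Finite :=
  Set.Finite.of_injOn (f := fun u => (m, Circle.exp u)) (t := Y) (fun _ hu => hu.2)
    (fun _ ha _ hb h => circle_exp_injOn ha.1 hb.1 (congrArg Prod.snd h)) hY

theorem nonempty_angles {m : Fin n} (t : ℝ) (h : ∃ u, (m, Circle.exp u) ∈ Y) :
    {u ∈ Ioc t (t + 2 * Real.pi) | (m, Circle.exp u) ∈ Y}.Nonempty := by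
  obtain ⟨u, hu⟩ := h
  refine ⟨toIocMod Real.two_pi_pos t u, toIocMod_mem_Ioc _ _ _, ?_⟩
  have : Circle.exp (toIocMod Real.two_pi_pos t u) = Circle.exp u :=
    Circle.exp_eq_exp.2 ⟨-toIocDiv Real.two_pi_pos t u, by
      rw [toIocMod, zsmul_eq_mul]; push_cast; ring⟩
  rwa [this]

/-- The window contains its right end, so a single point of `Y` on the circle is its own successor
after a full turn. -/
theorem exists_next_angle (hY : Y.Finite) {m : Fin n} (t : ℝ) (h : ∃ u, (m, Circle.exp u) ∈ Y) :
    ∃ b, t < b ∧ b ≤ t + 2 * Real.pi ∧ (m, Circle.exp b) ∈ Y ∧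
      ∀ u ∈ Ioo t b, (m, Circle.exp u) ∉ Y := by
  obtain ⟨b, hb, hmin⟩ := Set.exists_min_image _ id (finite_angles hY m t) (nonempty_angles t h)
  refine ⟨b, hb.1.1, hb.1.2, hb.2, fun u hu hY => ?_⟩
  have := hmin u ⟨⟨hu.1, hu.2.le.trans hb.1.2⟩, hY⟩
  exact absurd hu.2 (not_lt.2 this)

theorem exists_prev_angle (hY : Y.Finite) {m : Fin n} (t : ℝ) (h : ∃ u, (m, Circle.exp u) ∈ Y) :
    ∃ a, a ≤ t ∧ (m, Circle.exp a) ∈ Y ∧ ∀ u ∈ Ioc a t, (m, Circle.exp u) ∉ Y := by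
  obtain ⟨b, hb, hmax⟩ := Set.exists_max_image _ id (finite_angles hY m (t - 2 * Real.pi))
    (nonempty_angles _ h)
  have hb2 := hb.1.2
  rw [sub_add_cancel] at hb2
  refine ⟨b, hb2, hb.2, fun u hu hY => ?_⟩
  have := hmax u ⟨⟨hb.1.1.trans hu.1, by linarith [hu.2]⟩, hY⟩
  exact absurd hu.1 (not_lt.2 this)

/-- Running through its circle in positive direction, one can get from `z` to `w` without meeting
`Y` on the way. -/
def Arc (Y : Set (Fin n × Circle)) (z w : Fin n × Circle) : Prop :=
  ∃ m a b, a < b ∧ z = (m, Circle.exp a) ∧ w = (m, Circle.exp b) ∧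
    ∀ t ∈ Ioo a b, (m, Circle.exp t) ∉ Y

/-- Running through its circle in positive direction, one can get from `z` to `w` without meeting
`Y`, but meeting `M` on the way. -/
def ArcThrough (Y M : Set (Fin n × Circle)) (z w : Fin n × Circle) : Prop :=
  ∃ m a b, a < b ∧ z = (m, Circle.exp a) ∧ w = (m, Circle.exp b) ∧
    (∀ t ∈ Ioo a b, (m, Circle.exp t) ∉ Y) ∧ ∃ t ∈ Ioo a b, (m, Circle.exp t) ∈ M

/-- Angles matter only up to multiples of `2π`, so an arc can be made to start at any prescribed
angle of its first point. Arcs are compared on the line in this way. -/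
theorem Arc.exists_of_left {z w : Fin n × Circle} (h : Arc Y z w) {m : Fin n} {a : ℝ}
    (hz : z = (m, Circle.exp a)) :
    ∃ b, a < b ∧ w = (m, Circle.exp b) ∧ ∀ t ∈ Ioo a b, (m, Circle.exp t) ∉ Y := by
  obtain ⟨m', a', b, hab, h1, h2, h3⟩ := h
  rw [hz, Prod.mk.injEq] at h1
  obtain ⟨rfl, h1⟩ := h1
  obtain ⟨k, hk⟩ := Circle.exp_eq_exp.1 h1
  refine ⟨b + k * (2 * Real.pi), by linarith, by rw [circle_exp_add_int, h2], fun t ht => ?_⟩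
  have := h3 (t + (-k : ℤ) * (2 * Real.pi))
    ⟨by push_cast; linarith [ht.1], by push_cast; linarith [ht.2]⟩
  rwa [circle_exp_add_int] at this

theorem Arc.exists_of_right {z w : Fin n × Circle} (h : Arc Y z w) {m : Fin n} {b : ℝ}
    (hw : w = (m, Circle.exp b)) :
    ∃ a, a < b ∧ z = (m, Circle.exp a) ∧ ∀ t ∈ Ioo a b, (m, Circle.exp t) ∉ Y := by
  obtain ⟨m', a, b', hab, h1, h2, h3⟩ := h
  rw [hw, Prod.mk.injEq] at h2
  obtain ⟨rfl, h2⟩ := h2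
  obtain ⟨k, hk⟩ := Circle.exp_eq_exp.1 h2
  refine ⟨a + k * (2 * Real.pi), by linarith, by rw [circle_exp_add_int, h1], fun t ht => ?_⟩
  have := h3 (t + (-k : ℤ) * (2 * Real.pi))
    ⟨by push_cast; linarith [ht.1], by push_cast; linarith [ht.2]⟩
  rwa [circle_exp_add_int] at this

theorem Arc.right_unique {z w w' : Fin n × Circle} (h : Arc Y z w) (h' : Arc Y z w')
    (hw : w ∈ Y) (hw' : w' ∈ Y) : w = w' := by
  obtain ⟨m, a, b, hab, rfl, rfl, h3⟩ := h
  obtain ⟨b', hab', rfl, h3'⟩ := h'.exists_of_left rfl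
  rcases lt_trichotomy b b' with hb | rfl | hb
  · exact absurd hw (h3' b ⟨hab, hb⟩)
  · rfl
  · exact absurd hw' (h3 b' ⟨hab', hb⟩)

theorem Arc.left_unique {z z' w : Fin n × Circle} (h : Arc Y z w) (h' : Arc Y z' w)
    (hz : z ∈ Y) (hz' : z' ∈ Y) : z = z' := by
  obtain ⟨m, a, b, hab, rfl, rfl, h3⟩ := h
  obtain ⟨a', hab', rfl, h3'⟩ := h'.exists_of_right rfl
  rcases lt_trichotomy a a' with hb | rfl | hb
  · exact absurd hz' (h3 a' ⟨hb, hab'⟩)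
  · rfl
  · exact absurd hz (h3' a ⟨hb, hab⟩)

theorem Arc.trans {z w u : Fin n × Circle} (h : Arc Y z w) (h' : Arc Y w u) (hw : w ∉ Y) :
    Arc Y z u := by
  obtain ⟨m, a, b, hab, rfl, rfl, h3⟩ := h
  obtain ⟨c, hbc, rfl, h3'⟩ := h'.exists_of_left rfl
  refine ⟨m, a, c, hab.trans hbc, rfl, rfl, fun t ht => ?_⟩
  rcases lt_trichotomy t b with hb | rfl | hb
  · exact h3 t ⟨ht.1, hb⟩
  · exact hw
  · exact h3' t ⟨hb, ht.2⟩

theorem Arc.mono {Y' : Set (Fin n × Circle)} {z w : Fin n × Circle} (h : Arc Y z w)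
    (hY : Y' ⊆ Y) : Arc Y' z w := by
  obtain ⟨m, a, b, hab, h1, h2, h3⟩ := h
  exact ⟨m, a, b, hab, h1, h2, fun t ht h => h3 t ht (hY h)⟩

theorem ArcThrough.arc {M : Set (Fin n × Circle)} {z w : Fin n × Circle}
    (h : ArcThrough Y M z w) : Arc Y z w := by
  obtain ⟨m, a, b, hab, h1, h2, h3, -⟩ := h
  exact ⟨m, a, b, hab, h1, h2, h3⟩

/-- After `z` the point of `M` comes before `w`, and `w` is the first point of `Y`; an arc to `w`
avoiding `Y ∪ M` cannot get past either. -/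
theorem ArcThrough.not_arc {M : Set (Fin n × Circle)} {z w : Fin n × Circle}
    (h : ArcThrough Y M z w) (hw : w ∈ Y) : ¬ Arc (Y ∪ M) z w := by
  intro h'
  obtain ⟨m, a, b, hab, rfl, rfl, h3, t, ht, htM⟩ := h
  obtain ⟨b', hab', he, h3'⟩ := h'.exists_of_left rfl
  rcases lt_trichotomy b b' with hb | rfl | hb
  · exact h3' b ⟨hab, hb⟩ (Or.inl hw)
  · exact h3' t ht (Or.inr htM)
  · exact h3 b' ⟨hab', hb⟩ (he ▸ hw)

theorem ArcThrough.trans_left {M : Set (Fin n × Circle)} {z w u : Fin n × Circle}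
    (h : Arc Y z w) (h' : ArcThrough Y M w u) (hw : w ∉ Y) : ArcThrough Y M z u := by
  obtain ⟨m, b, c, hbc, rfl, rfl, h3', t, ht, htM⟩ := h'
  obtain ⟨a, hab, rfl, h3⟩ := h.exists_of_right rfl
  refine ⟨m, a, c, hab.trans hbc, rfl, rfl, fun t ht => ?_, t, ⟨hab.trans ht.1, ht.2⟩, htM⟩
  rcases lt_trichotomy t b with hb | rfl | hb
  · exact h3 t ⟨ht.1, hb⟩
  · exact hw
  · exact h3' t ⟨hb, ht.2⟩

theorem ArcThrough.trans_right {M : Set (Fin n × Circle)} {z w u : Fin n × Circle}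
    (h : ArcThrough Y M z w) (h' : Arc Y w u) (hw : w ∉ Y) : ArcThrough Y M z u := by
  obtain ⟨m, a, b, hab, rfl, rfl, h3, t, ht, htM⟩ := h
  obtain ⟨c, hbc, rfl, h3'⟩ := h'.exists_of_left rfl
  refine ⟨m, a, c, hab.trans hbc, rfl, rfl, fun t ht => ?_, t, ⟨ht.1, ht.2.trans hbc⟩, htM⟩
  rcases lt_trichotomy t b with hb | rfl | hb
  · exact h3 t ⟨ht.1, hb⟩
  · exact hw
  · exact h3' t ⟨hb, ht.2⟩

/-- An orientation-preserving bijection between collections of circles. -/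
def IsOriented {n' : ℕ} (f : Fin n × Circle → Fin n' × Circle) : Prop :=
  ∀ i, ∃ j, ∃ g : ℝ → ℝ, Continuous g ∧ StrictMono g ∧
    ∀ t, f (i, Circle.exp t) = (j, Circle.exp (g t))

theorem Arc.image {n' : ℕ} {f : Fin n × Circle → Fin n' × Circle} (hf : IsOriented f)
    (hi : Function.Injective f) {z w : Fin n × Circle} (h : Arc Y z w) :
    Arc (f '' Y) (f z) (f w) := by
  obtain ⟨m, a, b, hab, rfl, rfl, h3⟩ := h
  obtain ⟨j, g, hg, hgm, hfg⟩ := hf m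
  refine ⟨j, g a, g b, hgm hab, hfg a, hfg b, fun t ht => ?_⟩
  obtain ⟨s, hs, rfl⟩ := intermediate_value_Ioo hab.le hg.continuousOn ht
  rw [← hfg, hi.mem_set_image]
  exact h3 s hs

theorem ArcThrough.image {n' : ℕ} {f : Fin n × Circle → Fin n' × Circle} (hf : IsOriented f)
    (hi : Function.Injective f) {M : Set (Fin n × Circle)} {z w : Fin n × Circle}
    (h : ArcThrough Y M z w) : ArcThrough (f '' Y) (f '' M) (f z) (f w) := by
  obtain ⟨m, a, b, hab, rfl, rfl, h3, u, hu, huM⟩ := h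
  obtain ⟨j, g, hg, hgm, hfg⟩ := hf m
  refine ⟨j, g a, g b, hgm hab, hfg a, hfg b, fun t ht => ?_, g u, ⟨hgm hu.1, hgm hu.2⟩, ?_⟩
  · obtain ⟨s, hs, rfl⟩ := intermediate_value_Ioo hab.le hg.continuousOn ht
    rw [← hfg, hi.mem_set_image]
    exact h3 s hs
  · rw [← hfg]
    exact mem_image_of_mem _ huM

end

/-! ### The boundary curves run along the sides of the bands -/

namespace Ribbon

variable {S : Type*} [TopologicalSpace S] (X : Ribbon S)

/-- The sides of the bands, oriented so that the band lies on the left. -/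
def side (v : X.I × ℤˣ) (s : ℝ) : S := X.band v.1 (sg v.2, sg v.2 * s)

theorem side_mem_square (σ : ℤˣ) {s : ℝ} (hs : s ∈ Icc (-1 : ℝ) 1) :
    (sg σ, sg σ * s) ∈ square :=
  sg_mem_square (sg_mul_mem_Icc σ hs)

theorem side_eq_iff {v w : X.I × ℤˣ} {s t : ℝ} (hs : s ∈ Icc (-1 : ℝ) 1) (ht : t ∈ Icc (-1 : ℝ) 1) :
    X.side v s = X.side w t ↔ v = w ∧ s = t := by
  unfold side
  rw [X.band_eq_iff (side_mem_square _ hs) (side_mem_square _ ht), Prod.mk.injEq]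
  constructor
  · rintro ⟨h1, h2, h3⟩
    have h4 := sg_injective h2
    rw [h4] at h3
    exact ⟨Prod.ext h1 h4, mul_left_cancel₀ (sg_ne_zero _) h3⟩
  · rintro ⟨rfl, rfl⟩
    exact ⟨rfl, rfl, rfl⟩

theorem continuousOn_side (v : X.I × ℤˣ) : ContinuousOn (X.side v) (Icc (-1) 1) :=
  (X.band_cont v.1).comp (by fun_prop) fun _ hs => side_mem_square _ hs

variable [T2Space S] [ChartedSpace (EuclideanHalfSpace 2) S]

/-- The side is connected, hence runs on a single circle, and its angle is injective, hence
monotone. The direction is settled at the end point of the co-core, where both side and circle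
follow the boundary orientation. -/
theorem exists_side_angle {n : ℕ} (φ : (Fin n × Circle) ≃ₜ (𝓡∂ 2).boundary S)
    (hφ : ∀ i t, IsPositiveBoundaryCurveAt (fun s => (φ (i, Circle.exp s) : S)) t)
    (v : X.I × ℤˣ) (hv : IsPositiveBoundaryCurveAt (X.side v) 0) :
    ∃ (m : Fin n) (θ : ℝ → ℝ), ContinuousOn θ (Icc (-1) 1) ∧ StrictMonoOn θ (Icc (-1) 1) ∧
      ∀ s ∈ Icc (-1 : ℝ) 1, (φ (m, Circle.exp (θ s)) : S) = X.side v s := by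
  have h01 : (-1 : ℝ) ≤ 1 := by norm_num
  have hcl : IsClosed ((𝓡∂ 2).boundary S) := by
    have : CompactSpace ((𝓡∂ 2).boundary S) := φ.compactSpace
    exact (isCompact_iff_compactSpace.2 this).isClosed
  let c : Icc (-1 : ℝ) 1 → (𝓡∂ 2).boundary S := fun s =>
    ⟨X.side v s, X.side_mem_boundary hcl v.1 v.2 (sg_mul_mem_Icc v.2 s.2)⟩
  have hc : Continuous c := ((X.continuousOn_side v).domRestrict).subtype_mk _
  let w : ℝ → Fin n × Circle := fun s => φ.symm (c (projIcc (-1) 1 h01 s))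
  have hw : Continuous w := by fun_prop
  have hw1 : ∀ s, (w s).1 = (w 0).1 := fun s =>
    PreconnectedSpace.constant (f := fun s => (w s).1) inferInstance (by fun_prop)
  obtain ⟨θ, hθ, hθw⟩ := exists_circle_lift (z := fun s => (w s).2) h01 (by fun_prop)
  have hφθ : ∀ s ∈ Icc (-1 : ℝ) 1, (φ ((w 0).1, Circle.exp (θ s)) : S) = X.side v s := by
    intro s hs
    rw [hθw s hs, ← hw1 s, Prod.mk.eta]
    simp only [w, Homeomorph.apply_symm_apply, c]
    rw [projIcc_of_mem h01 hs]
  have hinj : InjOn θ (Icc (-1) 1) := by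
    intro s hs t ht h
    exact ((X.side_eq_iff hs ht).1 (by rw [← hφθ s hs, ← hφθ t ht, h])).2
  refine ⟨(w 0).1, θ, hθ, ?_, hφθ⟩
  rcases hθ.strictMonoOn_of_injOn_Icc' h01 hinj with hmono | hanti
  · exact hmono
  · exfalso
    have h0 : (0 : ℝ) ∈ Icc (-1 : ℝ) 1 := by constructor <;> norm_num
    -- In one chart both curves strictly decrease the second coordinate; if the angle decreased
    -- along the side, that coordinate would increase.
    have he := chart_mem_atlas (EuclideanHalfSpace 2) (X.side v 0)
    obtain ⟨δ₁, hδ₁, ha₁⟩ := hv.2 _ he (mem_chart_source _ _)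
    obtain ⟨δ₂, hδ₂, ha₂⟩ := (hφ (w 0).1 (θ 0)).2 _ he (by
      dsimp only
      rw [hφθ 0 h0]; exact mem_chart_source _ _)
    have hθ0 : ContinuousAt θ 0 := hθ.continuousAt (Icc_mem_nhds (by norm_num) (by norm_num))
    have h1 : ∀ᶠ s in 𝓝[>] (0 : ℝ), θ s ∈ Ioo (θ 0 - δ₂) (θ 0 + δ₂) :=
      (hθ0.eventually (Ioo_mem_nhds (by linarith) (by linarith))).filter_mono nhdsWithin_le_nhds
    have h2 : ∀ᶠ s in 𝓝[>] (0 : ℝ), s ∈ Ioo 0 (min δ₁ 1) := Ioo_mem_nhdsGT (lt_min hδ₁ one_pos)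
    obtain ⟨s, hs1, hs2⟩ := (h1.and h2).exists
    have hsI : s ∈ Icc (-1 : ℝ) 1 := ⟨by linarith [hs2.1], (hs2.2.trans_le (min_le_right _ _)).le⟩
    have h3 : θ s < θ 0 := hanti h0 hsI hs2.1
    have h4 := ha₂ hs1 (show θ 0 ∈ _ from ⟨by linarith, by linarith⟩) h3
    have h5 := ha₁ (show (0 : ℝ) ∈ _ from ⟨by linarith, by linarith⟩)
      (show s ∈ _ from ⟨by linarith [hs2.1], by linarith [hs2.2.trans_le (min_le_left _ _)]⟩) hs2.1
    simp only [hφθ s hsI, hφθ 0 h0] at h4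
    exact lt_asymm h4 h5

end Ribbon

/-! ### The free edges of a ribbon presentation -/

theorem rim_eq_range : rim = range rimPt :=
  Subset.antisymm (fun _ hz => exists_angle hz) (range_subset_iff.2 rimPt_mem)

theorem isPreconnected_rim : IsPreconnected rim :=
  rim_eq_range ▸ isPreconnected_range continuous_rimPt

namespace Ribbon

variable {S : Type*} [TopologicalSpace S] (X : Ribbon S)

/-- The other end point of the co-core. -/
def flip (v : X.I × ℤˣ) : X.I × ℤˣ := (v.1, -v.2)

@[simp] theorem flip_flip (v : X.I × ℤˣ) : X.flip (X.flip v) = v := by simp [flip]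

theorem flip_ne (v : X.I × ℤˣ) : X.flip v ≠ v := fun h => by
  have := congrArg Prod.snd h
  exact units_int_ne_iff.2 (show v.2 = -(-v.2) by simp) this.symm

/-- The disc in which the side `v` starts. -/
def src (v : X.I × ℤˣ) : X.C := X.fd v.1 (-v.2)

/-- The disc in which the side `v` ends. -/
def tgt (v : X.I × ℤˣ) : X.C := X.fd v.1 v.2

theorem src_flip (v : X.I × ℤˣ) : X.src (X.flip v) = X.tgt v := by simp [src, tgt, flip]

theorem tgt_flip (v : X.I × ℤˣ) : X.tgt (X.flip v) = X.src v := by simp [src, tgt, flip]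

theorem side_one_mem (v : X.I × ℤˣ) : X.side v 1 ∈ X.disc (X.tgt v) '' rim := by
  have := X.foot_mem v.1 v.2 (sg v.2) (abs_le.1 (abs_sg v.2).le)
  simpa [side, tgt] using this

theorem side_neg_one_mem (v : X.I × ℤˣ) : X.side v (-1) ∈ X.disc (X.src v) '' rim := by
  have := X.foot_mem v.1 (-v.2) (sg v.2) (abs_le.1 (abs_sg v.2).le)
  simpa [side, src] using this

/-- The discs are finitely many disjoint closed sets. -/
theorem subset_disc [T2Space S] {K : Set S} (hK : IsPreconnected K)
    (h : ∀ x ∈ K, ∃ c, x ∈ X.disc c '' square) {c : X.C} {x : S} (hx : x ∈ K)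
    (hc : x ∈ X.disc c '' square) : K ⊆ X.disc c '' square := by
  classical
  have h1 := isPreconnected_iff_subset_of_disjoint_closed.1 hK (X.disc c '' square)
    (⋃ c' : X.C, if c' = c then ∅ else X.disc c' '' square) (X.isClosed_disc c)
    (isClosed_iUnion_of_finite fun c' => by
      split_ifs
      · exact isClosed_empty
      · exact X.isClosed_disc c')
    (fun y hy => by
      obtain ⟨c', hc'⟩ := h y hy
      by_cases hcc : c' = c
      · exact Or.inl (hcc ▸ hc')
      · exact Or.inr (mem_iUnion.2 ⟨c', by rwa [if_neg hcc]⟩))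
    (by
      refine eq_empty_iff_forall_notMem.2 fun y hy => ?_
      obtain ⟨c', hc'⟩ := mem_iUnion.1 hy.2.2
      split_ifs at hc' with hcc
      · exact hc'
      · obtain ⟨s, hs, rfl⟩ := hc'
        obtain ⟨t, ht, he⟩ := hy.2.1
        exact hcc ((X.disc_eq_iff ht hs).1 he).1.symm)
  refine h1.resolve_right fun h2 => ?_
  obtain ⟨c', hc'⟩ := mem_iUnion.1 (h2 hx)
  split_ifs at hc' with hcc
  · exact hc'
  · obtain ⟨s, hs, rfl⟩ := hc'
    obtain ⟨t, ht, he⟩ := hc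
    exact hcc ((X.disc_eq_iff ht hs).1 he).1.symm

/-- A disc without feet would be open and closed, hence everything, and leave no room for the bands.
-/
theorem exists_foot [T2Space S] [PreconnectedSpace S] [Nonempty X.I] (c : X.C) :
    ∃ i η, X.fd i η = c := by
  by_contra! h
  have h1 : IsOpen (X.disc c '' square) := by
    rw [isOpen_iff_mem_nhds]
    rintro _ ⟨p, hp, rfl⟩
    refine X.disc_mem_nhds hp ?_
    rintro i ⟨t, ht, he⟩
    obtain ⟨η, -, h2, -⟩ := X.disc_eq_band hp ht he.symm
    exact h i η h2.symm
  have h0 : ((0 : ℝ), (0 : ℝ)) ∈ square := mem_square.2 ⟨by simp, by simp⟩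
  have h2 := IsClopen.eq_univ ⟨X.isClosed_disc c, h1⟩ ⟨_, mem_image_of_mem _ h0⟩
  obtain ⟨i⟩ := ‹Nonempty X.I›
  exact X.band_notMem i (0, 0) h0 (by simp) c (h2 ▸ mem_univ _)

variable [ChartedSpace (EuclideanHalfSpace 2) S]

/-- The cyclic order of the sides of the bands along the boundary circles. -/
structure Frame {n : ℕ} (φ : (Fin n × Circle) ≃ₜ (𝓡∂ 2).boundary S) where
  circ : X.I × ℤˣ → Fin n
  ang : X.I × ℤˣ → ℝ → ℝ
  ang_cont : ∀ v, ContinuousOn (ang v) (Icc (-1) 1)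
  ang_mono : ∀ v, StrictMonoOn (ang v) (Icc (-1) 1)
  ang_spec : ∀ v, ∀ s ∈ Icc (-1 : ℝ) 1, (φ (circ v, Circle.exp (ang v s)) : S) = X.side v s
  nx : X.I × ℤˣ → X.I × ℤˣ
  shift : X.I × ℤˣ → ℤ
  circ_nx : ∀ v, circ (nx v) = circ v
  lt_nx : ∀ v, ang v 0 < ang (nx v) 0 + shift v * (2 * Real.pi)
  avoid : ∀ v, ∀ u ∈ Ioo (ang v 0) (ang (nx v) 0 + shift v * (2 * Real.pi)),
    ∀ w, (circ v, Circle.exp u) ≠ (circ w, Circle.exp (ang w 0))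

/-- `nx v` is the side whose midpoint comes next on the circle, possibly `v` itself after one turn.
Since `ang` fixes one lift per side, `shift` counts the turns needed to bring that lift just after
`v`. -/
theorem exists_frame [T2Space S] {n : ℕ} (φ : (Fin n × Circle) ≃ₜ (𝓡∂ 2).boundary S)
    (hφ : ∀ i t, IsPositiveBoundaryCurveAt (fun s => (φ (i, Circle.exp s) : S)) t)
    (hX : ∀ v, IsPositiveBoundaryCurveAt (X.side v) 0) : Nonempty (X.Frame φ) := by
  choose m θ h1 h2 h3 using fun v => X.exists_side_angle φ hφ v (hX v)
  have h4 : ∀ v, ∃ w, ∃ k : ℤ, m w = m v ∧ θ v 0 < θ w 0 + k * (2 * Real.pi) ∧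
      ∀ u ∈ Ioo (θ v 0) (θ w 0 + k * (2 * Real.pi)),
        ∀ w', (m v, Circle.exp u) ≠ (m w', Circle.exp (θ w' 0)) := by
    intro v
    obtain ⟨b, hb1, -, ⟨w, hw⟩, hb4⟩ := exists_next_angle
      (Y := range fun w => (m w, Circle.exp (θ w 0))) (finite_range _) (m := m v) (θ v 0)
      ⟨θ v 0, v, rfl⟩
    rw [Prod.mk.injEq] at hw
    obtain ⟨k, hk⟩ := Circle.exp_eq_exp.1 hw.2.symm
    refine ⟨w, k, hw.1, hk ▸ hb1, fun u hu w' h => hb4 u (hk ▸ hu) ⟨w', h.symm⟩⟩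
  choose nx k h4 h5 h6 using h4
  exact ⟨⟨m, θ, h1, h2, h3, nx, k, h4, h5, h6⟩⟩

namespace Frame

variable {X} {n : ℕ} {φ : (Fin n × Circle) ≃ₜ (𝓡∂ 2).boundary S} (F : X.Frame φ)

/-- The end points of the co-cores on the circles. -/
noncomputable def pt (v : X.I × ℤˣ) : Fin n × Circle := (F.circ v, Circle.exp (F.ang v 0))

theorem zero_mem : (0 : ℝ) ∈ Icc (-1 : ℝ) 1 := ⟨by norm_num, by norm_num⟩

theorem one_mem : (1 : ℝ) ∈ Icc (-1 : ℝ) 1 := ⟨by norm_num, by norm_num⟩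

theorem neg_one_mem : (-1 : ℝ) ∈ Icc (-1 : ℝ) 1 := ⟨by norm_num, by norm_num⟩

theorem coe_pt (v : X.I × ℤˣ) : (φ (F.pt v) : S) = X.side v 0 := F.ang_spec v 0 zero_mem

theorem pt_injective : Function.Injective F.pt := fun v w h =>
  ((X.side_eq_iff zero_mem zero_mem).1 (by rw [← F.coe_pt, ← F.coe_pt, h])).1

theorem arc_nx (v : X.I × ℤˣ) : Arc (range F.pt) (F.pt v) (F.pt (F.nx v)) :=
  ⟨F.circ v, _, _, F.lt_nx v, rfl, by rw [circle_exp_add_int, ← F.circ_nx v]; rfl,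
    fun u hu ⟨w, hw⟩ => F.avoid v u hu w hw.symm⟩

/-- The angle at which the free edge after the side `v` starts. -/
def lo (v : X.I × ℤˣ) : ℝ := F.ang v 1

/-- The angle at which the free edge after the side `v` ends. -/
noncomputable def hi (v : X.I × ℤˣ) : ℝ := F.ang (F.nx v) (-1) + F.shift v * (2 * Real.pi)

theorem coe_lo (v : X.I × ℤˣ) : (φ (F.circ v, Circle.exp (F.lo v)) : S) = X.side v 1 :=
  F.ang_spec v 1 one_mem

theorem coe_hi (v : X.I × ℤˣ) : (φ (F.circ v, Circle.exp (F.hi v)) : S) = X.side (F.nx v) (-1) := by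
  rw [hi, circle_exp_add_int, ← F.circ_nx v]
  exact F.ang_spec _ _ neg_one_mem

theorem coe_ang_nx (v : X.I × ℤˣ) {s : ℝ} (hs : s ∈ Icc (-1 : ℝ) 1) :
    (φ (F.circ v, Circle.exp (F.ang (F.nx v) s + F.shift v * (2 * Real.pi))) : S) =
      X.side (F.nx v) s := by
  rw [circle_exp_add_int, ← F.circ_nx v]
  exact F.ang_spec _ _ hs

/-- Otherwise the second half of `v` and the first half of `nx v` would share an angle. As sides are
disjoint, this forces parameter `0` on both, against `lt_nx`. -/
theorem lo_lt_hi (v : X.I × ℤˣ) : F.lo v < F.hi v := by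
  by_contra! h
  have m1 := F.ang_mono v zero_mem one_mem one_pos
  have m2 := F.ang_mono (F.nx v) neg_one_mem zero_mem (by norm_num)
  have h0 := F.lt_nx v
  unfold lo hi at h
  obtain ⟨s, hs, hsu⟩ : max (F.ang v 0) (F.ang (F.nx v) (-1) + F.shift v * (2 * Real.pi)) ∈
      F.ang v '' Icc 0 1 :=
    intermediate_value_Icc zero_le_one ((F.ang_cont v).mono (Icc_subset_Icc (by norm_num) le_rfl))
      ⟨le_max_left _ _, max_le m1.le h⟩
  obtain ⟨t, ht, htu⟩ : max (F.ang v 0) (F.ang (F.nx v) (-1) + F.shift v * (2 * Real.pi)) ∈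
      (fun t => F.ang (F.nx v) t + F.shift v * (2 * Real.pi)) '' Icc (-1) 0 :=
    intermediate_value_Icc (by norm_num)
      (((F.ang_cont _).mono (Icc_subset_Icc le_rfl (by norm_num))).add continuousOn_const)
      ⟨le_max_right _ _, max_le h0.le (by simp only [Pi.add_apply]; linarith)⟩
  have hs' : s ∈ Icc (-1 : ℝ) 1 := ⟨by linarith [hs.1], hs.2⟩
  have ht' : t ∈ Icc (-1 : ℝ) 1 := ⟨ht.1, by linarith [ht.2]⟩
  have e := F.ang_spec v s hs'
  rw [hsu, ← htu, F.coe_ang_nx v ht', X.side_eq_iff ht' hs'] at e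
  have hs0 : s = 0 := by linarith [e.2, hs.1, ht.2]
  have ht0 : t = 0 := by linarith [e.2, hs.1, ht.2]
  subst hs0 ht0
  simp only at htu
  linarith

/-- The open free edges avoid the sides of the bands. -/
theorem ne_side {v : X.I × ℤˣ} {u : ℝ} (hu : u ∈ Ioo (F.lo v) (F.hi v)) (w : X.I × ℤˣ) {s : ℝ}
    (hs : s ∈ Icc (-1 : ℝ) 1) : (φ (F.circ v, Circle.exp u) : S) ≠ X.side w s := by
  intro h
  rw [← F.ang_spec w s hs] at h
  have h1 := φ.injective (Subtype.ext h)
  rw [Prod.mk.injEq] at h1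
  obtain ⟨k, hk⟩ := Circle.exp_eq_exp.1 h1.2
  have m1 := F.ang_mono v zero_mem one_mem one_pos
  have m2 := F.ang_mono (F.nx v) neg_one_mem zero_mem (by norm_num)
  have hu1 := hu.1
  have hu2 := hu.2
  unfold lo at hu1
  unfold hi at hu2
  have hcw : ∀ x, (F.circ v, Circle.exp (F.ang w x + k * (2 * Real.pi))) =
      (F.circ w, Circle.exp (F.ang w x)) := fun x => by rw [circle_exp_add_int, h1.1]
  have hcont : ContinuousOn (fun x => F.ang w x + k * (2 * Real.pi)) (Icc (-1) 1) :=
    (F.ang_cont w).add continuousOn_const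
  have hav := F.avoid v (F.ang w 0 + k * (2 * Real.pi))
  -- The midpoint of `w` is not strictly between those of `v` and `nx v`. To reach the angle `u`,
  -- the side `w` would sweep over one of these two midpoints, so it is `v` or `nx v`, and these
  -- stop short of the open edge.
  rcases le_or_gt (F.ang w 0 + k * (2 * Real.pi)) (F.ang v 0) with h2 | h2
  · have hs0 : 0 ≤ s := by
      by_contra! hs0
      have := F.ang_mono w hs zero_mem hs0
      linarith
    obtain ⟨x, hx, hxe⟩ := intermediate_value_Icc hs0
      (hcont.mono (Icc_subset_Icc (by norm_num) hs.2))
      (show F.ang v 0 ∈ _ from ⟨h2, by linarith⟩)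
    simp only at hxe
    have hx' : x ∈ Icc (-1 : ℝ) 1 := ⟨by linarith [hx.1], hx.2.trans hs.2⟩
    have e := F.ang_spec v 0 zero_mem
    rw [← hxe, hcw, F.ang_spec w x hx', X.side_eq_iff hx' zero_mem] at e
    obtain ⟨rfl, rfl⟩ := e
    have := (F.ang_mono w).monotoneOn hs one_mem hs.2
    linarith
  · have h3 : F.ang (F.nx v) 0 + F.shift v * (2 * Real.pi) ≤ F.ang w 0 + k * (2 * Real.pi) := by
      by_contra! h3
      exact hav ⟨h2, h3⟩ w (hcw 0)
    have hs0 : s ≤ 0 := by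
      by_contra! hs0
      have := F.ang_mono w zero_mem hs hs0
      linarith
    obtain ⟨x, hx, hxe⟩ := intermediate_value_Icc hs0
      (hcont.mono (Icc_subset_Icc hs.1 (by norm_num)))
      (show F.ang (F.nx v) 0 + F.shift v * (2 * Real.pi) ∈ _ from ⟨by linarith, h3⟩)
    simp only at hxe
    have hx' : x ∈ Icc (-1 : ℝ) 1 := ⟨hs.1.trans hx.1, by linarith [hx.2]⟩
    have e := F.coe_ang_nx v zero_mem
    rw [← hxe, hcw, F.ang_spec w x hx', X.side_eq_iff hx' zero_mem] at e
    obtain ⟨hw, rfl⟩ := e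
    have := (F.ang_mono w).monotoneOn neg_one_mem hs hs.1
    rw [← hw] at hu2 hxe
    linarith

/-- The free edge after the side `v`. -/
noncomputable def edge (v : X.I × ℤˣ) (τ : ℝ) : S :=
  φ (F.circ v, Circle.exp (F.lo v + (τ + 1) / 2 * (F.hi v - F.lo v)))

theorem continuous_edge (v : X.I × ℤˣ) : Continuous (F.edge v) := by
  unfold edge
  exact continuous_subtype_val.comp (by fun_prop)

theorem edge_neg_one (v : X.I × ℤˣ) : F.edge v (-1) = X.side v 1 := by
  rw [← F.coe_lo, edge]
  norm_num

theorem edge_one (v : X.I × ℤˣ) : F.edge v 1 = X.side (F.nx v) (-1) := by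
  rw [← F.coe_hi, edge]
  norm_num

theorem edge_mem_boundary (v : X.I × ℤˣ) (τ : ℝ) : F.edge v τ ∈ (𝓡∂ 2).boundary S :=
  Subtype.coe_prop _

theorem edge_angle_mem_Ioo (v : X.I × ℤˣ) {τ : ℝ} (hτ : |τ| < 1) :
    F.lo v + (τ + 1) / 2 * (F.hi v - F.lo v) ∈ Ioo (F.lo v) (F.hi v) := by
  have h := F.lo_lt_hi v
  rw [abs_lt] at hτ
  constructor <;> nlinarith [hτ.1, hτ.2]

theorem edge_angle_mem_Icc (v : X.I × ℤˣ) {τ : ℝ} (hτ : τ ∈ Icc (-1 : ℝ) 1) :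
    F.lo v + (τ + 1) / 2 * (F.hi v - F.lo v) ∈ Icc (F.lo v) (F.hi v) := by
  have h := F.lo_lt_hi v
  constructor <;> nlinarith [hτ.1, hτ.2]

theorem exists_edge_angle {v : X.I × ℤˣ} {u : ℝ} (hu : u ∈ Icc (F.lo v) (F.hi v)) :
    ∃ τ ∈ Icc (-1 : ℝ) 1, F.edge v τ = φ (F.circ v, Circle.exp u) := by
  have h := F.lo_lt_hi v
  have h' : 0 < F.hi v - F.lo v := sub_pos.2 h
  refine ⟨2 * ((u - F.lo v) / (F.hi v - F.lo v)) - 1, ?_, ?_⟩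
  · have h1 : 0 ≤ (u - F.lo v) / (F.hi v - F.lo v) := div_nonneg (sub_nonneg.2 hu.1) h'.le
    have h2 : (u - F.lo v) / (F.hi v - F.lo v) ≤ 1 := (div_le_one h').2 (by linarith [hu.2])
    constructor <;> linarith
  · rw [edge]
    congr 4
    field_simp
    ring

theorem edge_eq_iff {v w : X.I × ℤˣ} {s t : ℝ} (hs : s ∈ Icc (-1 : ℝ) 1) (ht : t ∈ Icc (-1 : ℝ) 1) :
    F.edge v s = F.edge w t ↔ v = w ∧ s = t := by
  constructor
  swap
  · rintro ⟨rfl, rfl⟩; rfl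
  -- If two edges meet, neither starts inside the other, because a start lies on a side. Applied
  -- both ways, the starts coincide.
  have key : ∀ {v w : X.I × ℤˣ} {u u' : ℝ} (k : ℤ), F.circ v = F.circ w →
      u ∈ Icc (F.lo v) (F.hi v) → u' ∈ Icc (F.lo w) (F.hi w) → u = u' + k * (2 * Real.pi) →
      F.lo w + k * (2 * Real.pi) ≤ F.lo v := by
    intro v w u u' k hc hu hu' hk
    by_contra! hlt
    have e : (φ (F.circ v, Circle.exp (F.lo w + k * (2 * Real.pi))) : S) = X.side w 1 := by
      rw [circle_exp_add_int, hc, F.coe_lo]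
    rcases (show F.lo w + k * (2 * Real.pi) ≤ F.hi v by linarith [hu.2, hu'.1]).lt_or_eq with h | h
    · exact F.ne_side ⟨hlt, h⟩ w one_mem e
    · rw [h, F.coe_hi, X.side_eq_iff neg_one_mem one_mem] at e
      norm_num at e
  intro h
  have h1 := φ.injective (Subtype.ext h)
  rw [Prod.mk.injEq] at h1
  obtain ⟨k, hk⟩ := Circle.exp_eq_exp.1 h1.2
  have a1 := F.edge_angle_mem_Icc v hs
  have a2 := F.edge_angle_mem_Icc w ht
  have b1 := key k h1.1 a1 a2 hk
  have b2 := key (-k) h1.1.symm a2 a1 (by push_cast; linarith)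
  push_cast at b2
  have b3 : F.lo v = F.lo w + k * (2 * Real.pi) := by linarith
  have e := F.coe_lo v
  rw [b3, circle_exp_add_int, h1.1, F.coe_lo, X.side_eq_iff one_mem one_mem] at e
  obtain rfl := e.1
  refine ⟨rfl, ?_⟩
  have hpos := sub_pos.2 (F.lo_lt_hi w)
  have hk0 : (k : ℝ) * (2 * Real.pi) = 0 := by linarith
  rw [hk0, add_zero] at hk
  have := mul_right_cancel₀ hpos.ne' (add_left_cancel hk)
  linarith

theorem exists_pt_of_side {m : Fin n} {t : ℝ} {w : X.I × ℤˣ} {s : ℝ} (hs : s ∈ Icc (-1 : ℝ) 1)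
    (h : (φ (m, Circle.exp t) : S) = X.side w s) : m = F.circ w := by
  rw [← F.ang_spec w s hs] at h
  exact congrArg Prod.fst (φ.injective (Subtype.ext h))

theorem nx_injective : Function.Injective F.nx := fun v w h =>
  ((F.edge_eq_iff one_mem one_mem).1 (by rw [F.edge_one, F.edge_one, h])).1

variable [T2Space S]

theorem exists_side_of_band {i : X.I} {z : ℝ × ℝ} (hz : z ∈ square)
    (h : X.band i z ∈ (𝓡∂ 2).boundary S) :
    ∃ w, w.1 = i ∧ ∃ s ∈ Icc (-1 : ℝ) 1, z = (sg w.2, sg w.2 * s) ∧ X.band i z = X.side w s := by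
  have h1 : |z.1| = 1 := by
    refine le_antisymm (mem_square.1 hz).1 ?_
    by_contra! h2
    exact X.band_notMem_boundary hz h2 h
  obtain ⟨σ, hσ⟩ := exists_sg_of_abs h1
  have h3 : z = (sg σ, sg σ * (sg σ * z.2)) := by rw [sg_mul_sg_mul, ← hσ]
  exact ⟨(i, σ), rfl, sg σ * z.2, sg_mul_mem_Icc _ (abs_le.1 (mem_square.1 hz).2), h3, by
    rw [side, ← h3]⟩

theorem edge_eq_band {v : X.I × ℤˣ} {τ : ℝ} (hτ : τ ∈ Icc (-1 : ℝ) 1) {i : X.I} {z : ℝ × ℝ}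
    (hz : z ∈ square) (h : F.edge v τ = X.band i z) :
    (τ = -1 ∧ i = v.1 ∧ z = (sg v.2, sg v.2)) ∨
      (τ = 1 ∧ i = (F.nx v).1 ∧ z = (sg (F.nx v).2, -sg (F.nx v).2)) := by
  have h1 : |τ| = 1 := by
    refine le_antisymm (abs_le.2 hτ) ?_
    by_contra! h2
    obtain ⟨w, -, s, hs, -, e⟩ := exists_side_of_band hz (h ▸ F.edge_mem_boundary v τ)
    exact F.ne_side (F.edge_angle_mem_Ioo v h2) w hs (h.trans e)
  rcases (abs_eq zero_le_one).1 h1 with rfl | rfl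
  · right
    rw [F.edge_one, side, X.band_eq_iff (side_mem_square _ neg_one_mem) hz] at h
    exact ⟨rfl, h.1.symm, by rw [← h.2]; simp⟩
  · left
    rw [F.edge_neg_one, side, X.band_eq_iff (side_mem_square _ one_mem) hz] at h
    exact ⟨rfl, h.1.symm, by rw [← h.2]; simp⟩

/-- Apart from its ends a free edge avoids the bands, so it is covered by discs and, being
connected, by the one in which `v` ends. Interior points of a disc are not on the boundary, so the
edge runs in the rim. -/
theorem edge_mem_disc (v : X.I × ℤˣ) {τ : ℝ} (hτ : τ ∈ Icc (-1 : ℝ) 1) :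
    F.edge v τ ∈ X.disc (X.tgt v) '' rim := by
  have h1 : F.edge v '' Icc (-1) 1 ⊆ X.disc (X.tgt v) '' square := by
    refine X.subset_disc (isPreconnected_Icc.image _ (F.continuous_edge v).continuousOn) ?_
      (mem_image_of_mem _ neg_one_mem)
      (F.edge_neg_one v ▸ image_mono rim_subset_square (X.side_one_mem v))
    rintro _ ⟨t, ht, rfl⟩
    rcases X.cover (F.edge v t) with h | ⟨i, z, hz, h⟩
    · exact h
    · rcases F.edge_eq_band ht hz h.symm with ⟨rfl, -, -⟩ | ⟨rfl, -, -⟩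
      · exact ⟨_, F.edge_neg_one v ▸ image_mono rim_subset_square (X.side_one_mem v)⟩
      · exact ⟨_, F.edge_one v ▸ image_mono rim_subset_square (X.side_neg_one_mem _)⟩
  obtain ⟨p, hp, hpe⟩ := h1 (mem_image_of_mem _ hτ)
  refine ⟨p, ?_, hpe⟩
  by_contra hr
  exact X.disc_notMem_boundary hp hr (hpe ▸ F.edge_mem_boundary v τ)

theorem src_nx (v : X.I × ℤˣ) : X.src (F.nx v) = X.tgt v := by
  obtain ⟨p, hp, hpe⟩ := F.edge_mem_disc v one_mem
  obtain ⟨q, hq, hqe⟩ := X.side_neg_one_mem (F.nx v)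
  rw [← F.edge_one, ← hpe] at hqe
  exact X.disc_disj _ _ q (rim_subset_square hq) p (rim_subset_square hp) hqe

/-- A boundary circle that meets the rim of a disc with a foot meets a band. -/
theorem exists_pt {c : X.C} (hc : ∃ i η, X.fd i η = c) {p : ℝ × ℝ} (hp : p ∈ rim) {m : Fin n}
    {t : ℝ} (h : (φ (m, Circle.exp t) : S) = X.disc c p) : ∃ v, F.circ v = m := by
  by_contra! hm
  have hb : ∀ z : Circle, ∀ i, (φ (m, z) : S) ∉ X.band i '' square := by
    rintro z i ⟨q, hq, he⟩
    obtain ⟨w, -, s, hs, -, e⟩ := exists_side_of_band hq (he ▸ Subtype.coe_prop _)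
    obtain ⟨t, rfl⟩ := Circle.exp_surjective z
    exact hm w (F.exists_pt_of_side hs (he.symm.trans e)).symm
  set K : Set S := (fun z => (φ (m, z) : S)) '' univ with hK
  have hKc : IsPreconnected K := by
    refine isPreconnected_univ.image _ (Continuous.continuousOn ?_)
    exact continuous_subtype_val.comp (by fun_prop)
  have hKd : K ⊆ X.disc c '' square := by
    refine X.subset_disc hKc ?_ ⟨Circle.exp t, mem_univ _, rfl⟩
      ⟨p, rim_subset_square hp, h.symm⟩
    rintro _ ⟨z, -, rfl⟩
    rcases X.cover (φ (m, z) : S) with h | ⟨i, h⟩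
    · exact h
    · exact absurd h (hb z i)
  have hrim := isPreconnected_rim
  have hdc : ContinuousOn (X.disc c) rim := (X.disc_cont c).mono rim_subset_square
  have hV : IsClosed (⋃ i, X.band i '' square ∪ (⋃ m' : {m' // m' ≠ m},
      (fun z => (φ (m', z) : S)) '' univ)) := by
    refine isClosed_iUnion_of_finite fun i => (X.isClosed_band i).union
      (isClosed_iUnion_of_finite fun m' => ?_)
    refine (isCompact_univ.image ?_).isClosed
    exact continuous_subtype_val.comp (by fun_prop)
  have hKcl : IsClosed K := (isCompact_univ.image
    (continuous_subtype_val.comp (by fun_prop))).isClosed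
  obtain ⟨i, η, hi⟩ := hc
  obtain ⟨q, hq, hqe⟩ := X.foot_mem i η 0 zero_mem
  rw [hi] at hqe
  have himg := hrim.image _ hdc
  -- Each point of the rim lies on a band or on a boundary circle, so a circle `K` missing all bands
  -- would be separated in the rim from the bands and the other circles. But the rim contains both a
  -- point of `K` and a foot.
  have := isPreconnected_iff_subset_of_disjoint_closed.1 himg K _ hKcl hV
    (by
      rintro _ ⟨r, hr, rfl⟩
      by_cases hrb : ∃ j, X.disc c r ∈ X.band j '' square
      · obtain ⟨j, hj⟩ := hrb
        exact Or.inr (mem_iUnion.2 ⟨j, Or.inl hj⟩)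
      · push Not at hrb
        have hbd := X.disc_mem_boundary hr hrb
        obtain ⟨⟨m', z⟩, hz⟩ := φ.surjective ⟨_, hbd⟩
        by_cases hmm : m' = m
        · subst hmm
          exact Or.inl ⟨z, mem_univ _, congrArg Subtype.val hz⟩
        · exact Or.inr (mem_iUnion.2 ⟨i, Or.inr (mem_iUnion.2 ⟨⟨m', hmm⟩, z, mem_univ _,
            congrArg Subtype.val hz⟩)⟩))
    (by
      refine eq_empty_iff_forall_notMem.2 ?_
      rintro _ ⟨-, ⟨z, -, rfl⟩, h2⟩
      obtain ⟨j, h2 | h2⟩ := mem_iUnion.1 h2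
      · exact hb z j h2
      · obtain ⟨⟨m', hm'⟩, z', -, h2⟩ := mem_iUnion.1 h2
        exact hm' (congrArg Prod.fst (φ.injective (Subtype.ext h2))))
  rcases this with h1 | h1
  · obtain ⟨z, -, hz⟩ := h1 ⟨q, hq, hqe⟩
    exact hb z i ⟨_, mem_square_sg zero_mem, hz.symm⟩
  · obtain ⟨j, h2 | h2⟩ := mem_iUnion.1 (h1 ⟨p, hp, rfl⟩)
    · exact hb _ j (h ▸ h2)
    · obtain ⟨⟨m', hm'⟩, z', -, h2⟩ := mem_iUnion.1 h2
      exact hm' (congrArg Prod.fst (φ.injective (Subtype.ext (h2.trans h.symm))))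

/-- The last co-core end point before the given point determines `v`. Since the point is on no band,
it comes after the side `v` and before the side `nx v`. -/
theorem exists_edge {c : X.C} (hc : ∃ i η, X.fd i η = c) {p : ℝ × ℝ} (hp : p ∈ rim)
    (hb : ∀ i, X.disc c p ∉ X.band i '' square) :
    ∃ v, X.tgt v = c ∧ ∃ τ ∈ Icc (-1 : ℝ) 1, F.edge v τ = X.disc c p := by
  obtain ⟨⟨m, z⟩, hz⟩ := φ.surjective ⟨_, X.disc_mem_boundary hp hb⟩
  obtain ⟨t, rfl⟩ := Circle.exp_surjective z
  replace hz : (φ (m, Circle.exp t) : S) = X.disc c p := congrArg Subtype.val hz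
  obtain ⟨v₀, rfl⟩ := F.exists_pt hc hp hz
  obtain ⟨a, hat, ⟨v, hv⟩, hav⟩ := exists_prev_angle (Y := range F.pt) (finite_range _)
    (m := F.circ v₀) t ⟨F.ang v₀ 0, v₀, rfl⟩
  rw [pt, Prod.mk.injEq] at hv
  obtain ⟨hm, hv⟩ := hv
  obtain ⟨k, hk⟩ := Circle.exp_eq_exp.1 hv.symm
  rw [← hm] at hz hav
  set t' := t + (-k : ℤ) * (2 * Real.pi) with ht'
  have htt : t = t' + k * (2 * Real.pi) := by rw [ht']; push_cast; ring
  have hz' : (φ (F.circ v, Circle.exp t') : S) = X.disc c p := by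
    rw [← hz, ht', circle_exp_add_int]
  have h1 : F.ang v 0 ≤ t' := by linarith
  have h2 : t' < F.ang (F.nx v) 0 + F.shift v * (2 * Real.pi) := by
    by_contra! h2
    refine hav (F.ang (F.nx v) 0 + F.shift v * (2 * Real.pi) + k * (2 * Real.pi))
      ⟨by linarith [F.lt_nx v], by linarith⟩ ⟨F.nx v, ?_⟩
    rw [circle_exp_add_int, circle_exp_add_int, ← F.circ_nx v]
    rfl
  have h3 : F.lo v < t' := by
    by_contra! h3
    obtain ⟨s, hs, hse⟩ := intermediate_value_Icc zero_le_one
      ((F.ang_cont v).mono (Icc_subset_Icc (by norm_num) le_rfl)) ⟨h1, h3⟩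
    have hs' : s ∈ Icc (-1 : ℝ) 1 := ⟨by linarith [hs.1], hs.2⟩
    have e := F.ang_spec v s hs'
    rw [hse, hz'] at e
    exact hb v.1 (e ▸ mem_image_of_mem _ (side_mem_square _ hs'))
  have h4 : t' < F.hi v := by
    by_contra! h4
    obtain ⟨s, hs, hse⟩ := intermediate_value_Icc (by norm_num : (-1 : ℝ) ≤ 0)
      ((F.ang_cont (F.nx v)).mono (Icc_subset_Icc le_rfl (by norm_num)) |>.add
        (continuousOn_const (c := F.shift v * (2 * Real.pi)))) ⟨h4, h2.le⟩
    have hs' : s ∈ Icc (-1 : ℝ) 1 := ⟨hs.1, by linarith [hs.2]⟩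
    have e := F.coe_ang_nx v hs'
    change F.ang (F.nx v) s + F.shift v * (2 * Real.pi) = t' at hse
    rw [hse, hz'] at e
    exact hb (F.nx v).1 ⟨_, side_mem_square _ hs', e.symm⟩
  obtain ⟨τ, hτ, he⟩ := F.exists_edge_angle (v := v) ⟨h3.le, h4.le⟩
  rw [hz'] at he
  refine ⟨v, ?_, τ, hτ, he⟩
  obtain ⟨q, hq, hqe⟩ := F.edge_mem_disc v hτ
  exact X.disc_disj _ _ q (rim_subset_square hq) p (rim_subset_square hp) (hqe.trans he)

end Frame

end Ribbon

/-! ### Equivariant bijections of the sides induce homeomorphisms -/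

namespace Ribbon

section

variable {S : Type*} [TopologicalSpace S] (X : Ribbon S)

/-- The foot in which the side `v` ends, starting on the opposite side of the band. -/
def footCurve (v : X.I × ℤˣ) (x : ℝ) : S := X.band v.1 (sg v.2 * x, sg v.2)

theorem foot_mem_square (v : X.I × ℤˣ) {x : ℝ} (hx : x ∈ Icc (-1 : ℝ) 1) :
    (sg v.2 * x, sg v.2) ∈ square :=
  mem_square_sg (sg_mul_mem_Icc _ hx)

theorem continuousOn_footCurve (v : X.I × ℤˣ) : ContinuousOn (X.footCurve v) (Icc (-1) 1) :=
  (X.band_cont v.1).comp (by fun_prop) fun _ hx => X.foot_mem_square v hx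

theorem footCurve_eq_iff {v w : X.I × ℤˣ} {s t : ℝ} (hs : s ∈ Icc (-1 : ℝ) 1)
    (ht : t ∈ Icc (-1 : ℝ) 1) : X.footCurve v s = X.footCurve w t ↔ v = w ∧ s = t := by
  unfold footCurve
  rw [X.band_eq_iff (X.foot_mem_square v hs) (X.foot_mem_square w ht), Prod.mk.injEq]
  constructor
  · rintro ⟨h1, h2, h3⟩
    have h4 := sg_injective h3
    rw [h4] at h2
    exact ⟨Prod.ext h1 h4, mul_left_cancel₀ (sg_ne_zero _) h2⟩
  · rintro ⟨rfl, rfl⟩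
    exact ⟨rfl, rfl, rfl⟩

theorem footCurve_one (v : X.I × ℤˣ) : X.footCurve v 1 = X.side v 1 := by simp [footCurve, side]

theorem footCurve_neg_one (v : X.I × ℤˣ) : X.footCurve v (-1) = X.side (X.flip v) (-1) := by
  simp [footCurve, side, flip]

theorem footCurve_mem_disc (v : X.I × ℤˣ) {x : ℝ} (hx : x ∈ Icc (-1 : ℝ) 1) :
    X.footCurve v x ∈ X.disc (X.tgt v) '' rim :=
  X.foot_mem v.1 v.2 _ (sg_mul_mem_Icc _ hx)

theorem exists_tgt [T2Space S] [PreconnectedSpace S] [Nonempty X.I] (c : X.C) :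
    ∃ v, X.tgt v = c := by
  obtain ⟨i, η, h⟩ := X.exists_foot c
  exact ⟨(i, η), h⟩

/-- A point in a disc and in a band lies on a foot. -/
theorem exists_footCurve {c : X.C} {i : X.I} {s t : ℝ × ℝ} (hs : s ∈ square) (ht : t ∈ square)
    (h : X.disc c s = X.band i t) : s ∈ rim ∧ ∃ v, v.1 = i ∧ X.tgt v = c ∧
      ∃ x ∈ Icc (-1 : ℝ) 1, t = (sg v.2 * x, sg v.2) ∧ X.band i t = X.footCurve v x := by
  obtain ⟨η, h1, h2, h3⟩ := X.disc_eq_band hs ht h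
  have h4 : t = (sg η * (sg η * t.1), sg η) := by rw [sg_mul_sg_mul, ← h1]
  exact ⟨h3, (i, η), rfl, h2.symm, sg η * t.1, sg_mul_mem_Icc _ (abs_le.1 (mem_square.1 ht).1), h4,
    by rw [footCurve, ← h4]⟩

end

namespace Frame

variable {S : Type*} [TopologicalSpace S] [ChartedSpace (EuclideanHalfSpace 2) S]
  {X : Ribbon S} {n : ℕ} {φ : (Fin n × Circle) ≃ₜ (𝓡∂ 2).boundary S} (F : X.Frame φ)

/-- The pieces of the boundaries of the discs: feet and free edges. -/
noncomputable def piece (a : (X.I × ℤˣ) ⊕ (X.I × ℤˣ)) : ℝ → S := Sum.elim X.footCurve F.edge a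

/-- The side preceding a foot or a free edge. -/
def base {V : Type*} : V ⊕ V → V := Sum.elim id id

theorem continuousOn_piece (a : (X.I × ℤˣ) ⊕ (X.I × ℤˣ)) : ContinuousOn (F.piece a) (Icc (-1) 1) := by
  rcases a with v | v
  · exact X.continuousOn_footCurve v
  · exact (F.continuous_edge v).continuousOn

variable [T2Space S]

theorem edge_eq_footCurve {v w : X.I × ℤˣ} {s t : ℝ} (hs : s ∈ Icc (-1 : ℝ) 1)
    (ht : t ∈ Icc (-1 : ℝ) 1) : F.edge w t = X.footCurve v s ↔
      (t = -1 ∧ v = w ∧ s = 1) ∨ (t = 1 ∧ v = X.flip (F.nx w) ∧ s = -1) := by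
  constructor
  · intro h
    rcases F.edge_eq_band ht (X.foot_mem_square v hs) h with ⟨rfl, -, -⟩ | ⟨rfl, -, -⟩
    · rw [F.edge_neg_one, ← footCurve_one, X.footCurve_eq_iff one_mem hs] at h
      exact Or.inl ⟨rfl, h.1.symm, h.2.symm⟩
    · rw [F.edge_one, ← X.flip_flip (F.nx w), ← footCurve_neg_one,
        X.footCurve_eq_iff neg_one_mem hs] at h
      exact Or.inr ⟨rfl, h.1.symm, h.2.symm⟩
  · rintro (⟨rfl, rfl, rfl⟩ | ⟨rfl, rfl, rfl⟩)
    · rw [F.edge_neg_one, footCurve_one]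
    · rw [F.edge_one, footCurve_neg_one, flip_flip]

theorem mem_disc_rim {c : X.C} (hc : ∃ i η, X.fd i η = c) {x : S} : x ∈ X.disc c '' rim ↔
    ∃ a, X.tgt (base a) = c ∧ x ∈ F.piece a '' Icc (-1) 1 := by
  constructor
  · rintro ⟨p, hp, rfl⟩
    by_cases h : ∃ i, X.disc c p ∈ X.band i '' square
    · obtain ⟨i, t, ht, he⟩ := h
      obtain ⟨-, v, -, h2, x, hx, -, h3⟩ := X.exists_footCurve (rim_subset_square hp) ht he.symm
      exact ⟨Sum.inl v, h2, x, hx, h3.symm.trans he⟩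
    · push Not at h
      obtain ⟨v, h1, τ, hτ, h2⟩ := F.exists_edge hc hp h
      exact ⟨Sum.inr v, h1, τ, hτ, h2⟩
  · rintro ⟨v | v, rfl, x, hx, rfl⟩
    · exact X.footCurve_mem_disc v hx
    · exact F.edge_mem_disc v hx

/-- The free edge after `v` meets the foot of `v` at its start and the foot of `flip (nx v)` at its
end, and pieces meet nowhere else. -/
theorem base_mem_iff {B : Set (X.I × ℤˣ)} (hB : ∀ v, v ∈ B ↔ X.flip (F.nx v) ∈ B)
    {a b : (X.I × ℤˣ) ⊕ (X.I × ℤˣ)} {s t : ℝ} (hs : s ∈ Icc (-1 : ℝ) 1) (ht : t ∈ Icc (-1 : ℝ) 1)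
    (h : F.piece a s = F.piece b t) : base a ∈ B ↔ base b ∈ B := by
  rcases a with v | v <;> rcases b with w | w
  · rw [((X.footCurve_eq_iff hs ht).1 h).1]
  · rcases (F.edge_eq_footCurve hs ht).1 h.symm with ⟨-, rfl, -⟩ | ⟨-, rfl, -⟩
    · rfl
    · exact (hB w).symm
  · rcases (F.edge_eq_footCurve ht hs).1 h with ⟨-, rfl, -⟩ | ⟨-, rfl, -⟩
    · rfl
    · exact hB v
  · rw [((F.edge_eq_iff hs ht).1 h).1]

/-- The sides that end in a given disc form a single orbit. -/
theorem mem_of_tgt_eq {B : Set (X.I × ℤˣ)} (hB : ∀ v, v ∈ B ↔ X.flip (F.nx v) ∈ B)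
    {v w : X.I × ℤˣ} (h : X.tgt v = X.tgt w) (hv : v ∈ B) : w ∈ B := by
  by_contra hw
  have hcl : ∀ B : Set (X.I × ℤˣ), IsClosed (⋃ a : {a // base a ∈ B}, F.piece a.1 '' Icc (-1) 1) :=
    fun B => isClosed_iUnion_of_finite fun a =>
      (isCompact_Icc.image_of_continuousOn (F.continuousOn_piece a.1)).isClosed
  have hpre : IsPreconnected (X.disc (X.tgt v) '' rim) :=
    isPreconnected_rim.image _ ((X.disc_cont _).mono rim_subset_square)
  -- If `B` and its complement both had sides ending here, the connected rim would contain a point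
  -- on a piece of each kind.
  obtain ⟨x, -, h1, h2⟩ := isPreconnected_closed_iff.1 hpre _ _ (hcl B) (hcl Bᶜ) (fun x hx => by
      obtain ⟨a, -, ha⟩ := (F.mem_disc_rim ⟨v.1, v.2, rfl⟩).1 hx
      by_cases hab : base a ∈ B
      · exact Or.inl (mem_iUnion.2 ⟨⟨a, hab⟩, ha⟩)
      · exact Or.inr (mem_iUnion.2 ⟨⟨a, hab⟩, ha⟩))
    ⟨_, X.footCurve_mem_disc v one_mem, mem_iUnion.2 ⟨⟨Sum.inl v, hv⟩, mem_image_of_mem _ one_mem⟩⟩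
    ⟨_, h ▸ X.footCurve_mem_disc w one_mem,
      mem_iUnion.2 ⟨⟨Sum.inl w, hw⟩, mem_image_of_mem _ one_mem⟩⟩
  obtain ⟨⟨a, ha⟩, s, hs, rfl⟩ := mem_iUnion.1 h1
  obtain ⟨⟨b, hb⟩, t, ht, e⟩ := mem_iUnion.1 h2
  exact hb ((F.base_mem_iff hB ht hs e).2 ha)

section

variable {S' : Type*} [TopologicalSpace S'] [ChartedSpace (EuclideanHalfSpace 2) S'] [T2Space S']
  {X' : Ribbon S'} {n' : ℕ} {φ' : (Fin n' × Circle) ≃ₜ (𝓡∂ 2).boundary S'} (F' : X'.Frame φ')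
  {β : X.I × ℤˣ → X'.I × ℤˣ}

/-- All incidences between feet and free edges are expressed by `flip` and `nx`, with which `β`
commutes. -/
theorem piece_eq_iff (hi : Function.Injective β) (hflip : ∀ v, β (X.flip v) = X'.flip (β v))
    (hnx : ∀ v, β (F.nx v) = F'.nx (β v)) {a b : (X.I × ℤˣ) ⊕ (X.I × ℤˣ)} {s t : ℝ}
    (hs : s ∈ Icc (-1 : ℝ) 1) (ht : t ∈ Icc (-1 : ℝ) 1) :
    F.piece a s = F.piece b t ↔ F'.piece (a.map β β) s = F'.piece (b.map β β) t := by
  rcases a with v | v <;> rcases b with w | w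
  · simp only [piece, Sum.elim_inl, Sum.map_inl, X.footCurve_eq_iff hs ht,
      X'.footCurve_eq_iff hs ht, hi.eq_iff]
  · simp only [piece, Sum.elim_inl, Sum.map_inl, Sum.elim_inr, Sum.map_inr]
    rw [eq_comm, F.edge_eq_footCurve hs ht, eq_comm (a := X'.footCurve _ _), F'.edge_eq_footCurve hs ht, ← hnx, ← hflip,
      hi.eq_iff, hi.eq_iff]
  · simp only [piece, Sum.elim_inl, Sum.map_inl, Sum.elim_inr, Sum.map_inr]
    rw [F.edge_eq_footCurve ht hs, F'.edge_eq_footCurve ht hs, ← hnx, ← hflip,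
      hi.eq_iff, hi.eq_iff]
  · simp only [piece, Sum.elim_inr, Sum.map_inr, F.edge_eq_iff hs ht, F'.edge_eq_iff hs ht,
      hi.eq_iff]

theorem exists_piece_map (hi : Function.Injective β) (hflip : ∀ v, β (X.flip v) = X'.flip (β v))
    (hnx : ∀ v, β (F.nx v) = F'.nx (β v)) [Nonempty S'] :
    ∃ G : S → S', ContinuousOn G (⋃ a, F.piece a '' Icc (-1) 1) ∧
      InjOn G (⋃ a, F.piece a '' Icc (-1) 1) ∧
      ∀ a, ∀ s ∈ Icc (-1 : ℝ) 1, G (F.piece a s) = F'.piece (a.map β β) s :=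
  exists_glue (K := fun _ => Icc (-1 : ℝ) 1) (fun _ => isCompact_Icc) F.continuousOn_piece
    (fun a => F'.continuousOn_piece (a.map β β))
    (fun _ _ _ hs _ ht => F.piece_eq_iff F' hi hflip hnx hs ht)

theorem tgt_eq_of_tgt_eq (hflip : ∀ v, β (X.flip v) = X'.flip (β v)) (hnx : ∀ v, β (F.nx v) = F'.nx (β v))
    {v w : X.I × ℤˣ} (h : X.tgt v = X.tgt w) : X'.tgt (β v) = X'.tgt (β w) :=
  (F.mem_of_tgt_eq (B := {w | X'.tgt (β v) = X'.tgt (β w)}) (fun w => by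
    simp only [Set.mem_ofPred_eq, hflip, hnx, tgt_flip, src_nx]) h rfl : _)

end

end Frame

end Ribbon

namespace Ribbon

namespace Frame

variable {S : Type*} [TopologicalSpace S] [ChartedSpace (EuclideanHalfSpace 2) S] [T2Space S]
  {X : Ribbon S} {n : ℕ} {φ : (Fin n × Circle) ≃ₜ (𝓡∂ 2).boundary S} (F : X.Frame φ)
  {S' : Type*} [TopologicalSpace S'] [ChartedSpace (EuclideanHalfSpace 2) S'] [T2Space S']
  {X' : Ribbon S'} {n' : ℕ} {φ' : (Fin n' × Circle) ≃ₜ (𝓡∂ 2).boundary S'} (F' : X'.Frame φ')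
  {β : X.I × ℤˣ → X'.I × ℤˣ}

theorem tgt_eq_iff (hβ : Function.Bijective β) (hflip : ∀ v, β (X.flip v) = X'.flip (β v))
    (hnx : ∀ v, β (F.nx v) = F'.nx (β v)) {v w : X.I × ℤˣ} :
    X'.tgt (β v) = X'.tgt (β w) ↔ X.tgt v = X.tgt w := by
  refine ⟨fun h => ?_, F.tgt_eq_of_tgt_eq F' hflip hnx⟩
  obtain ⟨β', hl, hr⟩ := Function.bijective_iff_has_inverse.1 hβ
  have := F'.tgt_eq_of_tgt_eq F (β := β') (fun v => hβ.1 (by rw [hr, hflip, hr]))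
    (fun v => hβ.1 (by rw [hr, hnx, hr])) h
  rwa [hl, hl] at this

/-- Matching feet and free edges gives a map of the rims of all discs. It is coned over each disc
and agrees on feet with a rotation of each band, so the maps on discs and bands glue. -/
theorem exists_homeo [ConnectedSpace S] [CompactSpace S] [ConnectedSpace S'] [Nonempty X.I]
    (hβ : Function.Bijective β) (hflip : ∀ v, β (X.flip v) = X'.flip (β v))
    (hnx : ∀ v, β (F.nx v) = F'.nx (β v)) :
    ∃ f : S ≃ₜ S', ∀ v, f '' (X.band v.1 '' square) = X'.band (β v).1 '' square ∧
      f '' (X.disc (X.tgt v) '' square) = X'.disc (X'.tgt (β v)) '' square := by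
  classical
  have hS' : Nonempty S' := inferInstance
  have hI' : Nonempty X'.I := ‹Nonempty X.I›.map fun i => (β (i, 1)).1
  obtain ⟨G, G1, G2, G3⟩ := F.exists_piece_map F' hβ.1 hflip hnx
  set Γ := ⋃ a, F.piece a '' Icc (-1) 1 with hΓ
  choose vc hvc using X.exists_tgt
  -- By `tgt_eq_iff` the disc assigned to `c` does not depend on the side chosen in it.
  set γ : X.C → X'.C := fun c => X'.tgt (β (vc c)) with hγ
  have hγt : ∀ v, γ (X.tgt v) = X'.tgt (β v) := fun v =>
    (F.tgt_eq_iff F' hβ hflip hnx).2 (hvc _)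
  have hγi : Function.Injective γ := by
    intro c c' h
    rw [← hvc c, ← hvc c']
    exact (F.tgt_eq_iff F' hβ hflip hnx).1 h
  have hfoot : ∀ c, ∃ i η, X.fd i η = c := X.exists_foot
  have hfoot' : ∀ c, ∃ i η, X'.fd i η = c := X'.exists_foot
  have hGf : ∀ v, ∀ x ∈ Icc (-1 : ℝ) 1, G (X.footCurve v x) = X'.footCurve (β v) x :=
    fun v => G3 (Sum.inl v)
  have hrimΓ : ∀ c, X.disc c '' rim ⊆ Γ := by
    intro c x hx
    obtain ⟨a, -, h⟩ := (F.mem_disc_rim (hfoot c)).1 hx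
    exact mem_iUnion.2 ⟨a, h⟩
  have hfootΓ : ∀ v, ∀ x ∈ Icc (-1 : ℝ) 1, X.footCurve v x ∈ Γ := fun v x hx =>
    mem_iUnion.2 ⟨Sum.inl v, mem_image_of_mem _ hx⟩
  have hbase : ∀ a : (X.I × ℤˣ) ⊕ (X.I × ℤˣ), base (a.map β β) = β (base a) := by
    rintro (v | v) <;> rfl
  have hGrim : ∀ c, G '' (X.disc c '' rim) = X'.disc (γ c) '' rim := by
    intro c
    ext y
    rw [F'.mem_disc_rim (hfoot' _)]
    constructor
    · rintro ⟨x, hx, rfl⟩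
      obtain ⟨a, h1, s, hs, rfl⟩ := (F.mem_disc_rim (hfoot c)).1 hx
      exact ⟨a.map β β, by rw [hbase, ← hγt, h1], s, hs, (G3 a s hs).symm⟩
    · rintro ⟨a', h1, s, hs, rfl⟩
      obtain ⟨a, rfl⟩ := (hβ.2.sumMap hβ.2) a'
      rw [hbase, ← hγt] at h1
      exact ⟨_, (F.mem_disc_rim (hfoot c)).2 ⟨a, hγi h1, mem_image_of_mem _ hs⟩, G3 a s hs⟩
  -- the map on the discs
  have hcone : ∀ c, ∃ g : ℝ × ℝ → ℝ × ℝ, ContinuousOn g square ∧ InjOn g square ∧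
      g '' square = square ∧ (∀ z ∈ rim, g z ∈ rim) ∧
      ∀ z ∈ rim, X'.disc (γ c) (g z) = G (X.disc c z) := by
    intro c
    obtain ⟨l, l1, l2⟩ := exists_leftInv isCompact_rim
      ((X'.disc_cont (γ c)).mono rim_subset_square) ((X'.disc_inj (γ c)).mono rim_subset_square)
    have hmap : ∀ z ∈ rim, ∃ w ∈ rim, X'.disc (γ c) w = G (X.disc c z) := fun z hz => by
      have : G (X.disc c z) ∈ X'.disc (γ c) '' rim :=
        hGrim c ▸ mem_image_of_mem _ (mem_image_of_mem _ hz)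
      exact this
    have hval : ∀ z ∈ rim, X'.disc (γ c) (l (G (X.disc c z))) = G (X.disc c z) := by
      intro z hz
      obtain ⟨w, hw, e⟩ := hmap z hz
      rw [← e, l2 w hw]
    have hrim : ∀ z ∈ rim, l (G (X.disc c z)) ∈ rim := by
      intro z hz
      obtain ⟨w, hw, e⟩ := hmap z hz
      rwa [← e, l2 w hw]
    obtain ⟨g, g1, g2, g3, g4⟩ := exists_cone (f := fun z => l (G (X.disc c z)))
      (by
        refine l1.comp (G1.comp ((X.disc_cont c).mono rim_subset_square)
          fun z hz => hrimΓ c (mem_image_of_mem _ hz)) fun z hz => ?_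
        exact hGrim c ▸ mem_image_of_mem _ (mem_image_of_mem _ hz))
      (by
        intro z hz w hw h
        have h1 : G (X.disc c z) = G (X.disc c w) := by
          rw [← hval z hz, ← hval w hw]
          exact congrArg _ h
        exact X.disc_inj c (rim_subset_square hz) (rim_subset_square hw)
          (G2 (hrimΓ c (mem_image_of_mem _ hz)) (hrimΓ c (mem_image_of_mem _ hw)) h1))
      (by
        ext w
        constructor
        · rintro ⟨z, hz, rfl⟩
          exact hrim z hz
        · intro hw
          have : X'.disc (γ c) w ∈ G '' (X.disc c '' rim) := hGrim c ▸ mem_image_of_mem _ hw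
          obtain ⟨_, ⟨z, hz, rfl⟩, e⟩ := this
          exact ⟨z, hz, by simp only [e, l2 w hw]⟩)
    exact ⟨g, g1, g2, g3, fun z hz => by rw [g4 hz]; exact hrim z hz,
      fun z hz => by rw [g4 hz]; exact hval z hz⟩
  choose g g1 g2 g3 g4 g5 using hcone
  have hgs : ∀ c, ∀ z ∈ square, g c z ∈ square := fun c z hz => g3 c ▸ mem_image_of_mem _ hz
  have hgrim : ∀ c, ∀ z ∈ square, g c z ∈ rim → z ∈ rim := by
    intro c z hz h
    have : X'.disc (γ c) (g c z) ∈ G '' (X.disc c '' rim) := hGrim c ▸ mem_image_of_mem _ h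
    obtain ⟨_, ⟨w, hw, rfl⟩, e⟩ := this
    rw [← g5 c w hw] at e
    have e1 := X'.disc_inj _ (rim_subset_square (g4 c w hw)) (hgs c z hz) e
    rwa [← g2 c (rim_subset_square hw) hz e1]
  -- the map on the bands
  set b : X.I → X'.I := fun i => (β (i, 1)).1 with hb
  set κ : X.I → ℤˣ := fun i => (β (i, 1)).2 with hκ
  -- Compatibility with `flip` means that `β` permutes bands and possibly exchanges the two sides of
  -- a band; the exchange is realized by rotation by π.
  have hβe : ∀ v, β v = (b v.1, κ v.1 * v.2) := by
    rintro ⟨i, σ⟩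
    rcases Int.units_eq_one_or σ with rfl | rfl
    · simp [hb, hκ]
    · have := hflip (i, 1)
      simp only [flip] at this
      rw [this]
      simp [hb, hκ]
  have hbi : Function.Injective b := by
    intro i j h
    have e1 := hβe (i, κ i)
    have e2 := hβe (j, κ j)
    simp only [Int.units_mul_self, h] at e1 e2
    exact congrArg Prod.fst (hβ.1 (e1.trans e2.symm))
  have hbs : Function.Surjective b := by
    intro j
    obtain ⟨v, hv⟩ := hβ.2 (j, 1)
    exact ⟨v.1, by rw [hβe] at hv; exact congrArg Prod.fst hv⟩
  have hγs : Function.Surjective γ := by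
    intro c
    obtain ⟨w, rfl⟩ := X'.exists_tgt c
    obtain ⟨v, rfl⟩ := hβ.2 w
    exact ⟨_, hγt v⟩
  have hband : ∀ v x, X'.footCurve (β v) x = X'.band (b v.1) (rot (κ v.1) (sg v.2 * x, sg v.2)) := by
    intro v x
    rw [hβe, footCurve, rot]
    simp only [sg_mul, mul_assoc]
  -- Discs and bands meet only in feet, where the coned maps and the rotations both reduce to `G`.
  have hmix : ∀ c i, ∀ s ∈ square, ∀ t ∈ square, X.disc c s = X.band i t ↔
      X'.disc (γ c) (g c s) = X'.band (b i) (rot (κ i) t) := by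
    intro c i s hs t ht
    constructor
    · intro h
      obtain ⟨hr, v, rfl, -, x, hx, rfl, e⟩ := X.exists_footCurve hs ht h
      rw [g5 c s hr, h, e, hGf v x hx, hband]
    · intro h
      obtain ⟨hr, w, hw1, hw2, x, hx, hw3, e⟩ :=
        X'.exists_footCurve (hgs c s hs) (rot_mem_square.2 ht) h
      obtain ⟨v, rfl⟩ := hβ.2 w
      have hr' := hgrim c s hs hr
      have hvi : v.1 = i := hbi (by rw [← hw1, hβe])
      subst hvi
      have h1 : G (X.disc c s) = G (X.footCurve v x) := by
        rw [← g5 c s hr', h, e, hGf v x hx]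
      have h2 := G2 (hrimΓ c (mem_image_of_mem _ hr')) (hfootΓ v x hx) h1
      rw [h2, footCurve]
      congr 1
      refine rot_injective (κ v.1) ?_
      rw [hw3, hβe]
      simp only [rot, sg_mul, mul_assoc]
  obtain ⟨f, f1, f2, f3⟩ := exists_glue (ι := X.C ⊕ X.I) (K := fun _ => square)
    (fun _ => isCompact_square) (p := Sum.elim X.disc X.band)
    (q := Sum.elim (fun c z => X'.disc (γ c) (g c z)) (fun i z => X'.band (b i) (rot (κ i) z)))
    (by
      rintro (c | i)
      · exact X.disc_cont c
      · exact X.band_cont i)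
    (by
      rintro (c | i)
      · exact (X'.disc_cont _).comp (g1 c) (hgs c)
      · exact (X'.band_cont _).comp (continuous_rot _).continuousOn fun z hz =>
          rot_mem_square.2 hz)
    (by
      rintro (c | i) (c' | i') s hs t ht
      · simp only [Sum.elim_inl, X.disc_eq_iff hs ht, X'.disc_eq_iff (hgs c s hs) (hgs c' t ht),
          hγi.eq_iff]
        constructor
        · rintro ⟨rfl, rfl⟩; exact ⟨rfl, rfl⟩
        · rintro ⟨rfl, h⟩; exact ⟨rfl, g2 c hs ht h⟩
      · exact hmix c i' s hs t ht
      · simp only [Sum.elim_inl, Sum.elim_inr]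
        rw [eq_comm, hmix c' i t ht s hs, eq_comm]
      · simp only [Sum.elim_inr, X.band_eq_iff hs ht,
          X'.band_eq_iff (rot_mem_square.2 hs) (rot_mem_square.2 ht), hbi.eq_iff]
        constructor
        · rintro ⟨rfl, rfl⟩; exact ⟨rfl, rfl⟩
        · rintro ⟨rfl, h⟩; exact ⟨rfl, rot_injective _ h⟩)
  have huniv : (⋃ a, Sum.elim X.disc X.band a '' square) = univ := by
    refine eq_univ_of_forall fun x => mem_iUnion.2 ?_
    rcases X.cover x with ⟨c, h⟩ | ⟨i, h⟩
    · exact ⟨Sum.inl c, h⟩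
    · exact ⟨Sum.inr i, h⟩
  rw [huniv] at f1 f2
  have hfd : ∀ c, f '' (X.disc c '' square) = X'.disc (γ c) '' square := by
    intro c
    rw [image_image]
    conv_rhs => rw [← g3 c, image_image]
    exact image_congr fun z hz => f3 (Sum.inl c) z hz
  have hfb : ∀ i, f '' (X.band i '' square) = X'.band (b i) '' square := by
    intro i
    rw [image_image]
    conv_rhs => rw [← image_rot_square (κ i), image_image]
    exact image_congr fun z hz => f3 (Sum.inr i) z hz
  have hsurj : Function.Surjective f := by
    intro y
    rcases X'.cover y with ⟨c, h⟩ | ⟨i, h⟩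
    · obtain ⟨c, rfl⟩ := hγs c
      rw [← hfd] at h
      exact ⟨_, h.choose_spec.2⟩
    · obtain ⟨i, rfl⟩ := hbs i
      rw [← hfb] at h
      exact ⟨_, h.choose_spec.2⟩
  let e : S ≃ S' := Equiv.ofBijective f ⟨injOn_univ.1 f2, hsurj⟩
  have he : Continuous e := continuousOn_univ.1 f1
  refine ⟨he.homeoOfEquivCompactToT2, fun v => ⟨?_, ?_⟩⟩
  · rw [hβe]
    exact hfb v.1
  · rw [← hγt]
    exact hfd _

end Frame

end Ribbon

/-! ### Diagrams on circles -/

/-- The sides of the bands come in four kinds: those of the cores of the handles of `P`, those of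
the cores of the other handles, and the two sides of a collar, along which the boundary
leaves and enters `P`. -/
inductive Kind
  | prim
  | ante
  | leave
  | enter

/-- The kind of the opposite side. -/
def Kind.swap : Kind → Kind
  | prim => prim
  | ante => ante
  | leave => enter
  | enter => leave

/-- Being a side of a core. -/
def Kind.IsCore (k : Kind) : Prop := k = prim ∨ k = ante

theorem Kind.swap_isCore {k : Kind} : k.swap.IsCore ↔ k.IsCore := by
  cases k <;> simp [swap, IsCore]

/-- The combinatorial structure formed by the sides of the bands of a ribbon presentation along the
boundary circles. -/
structure Diagram (n : ℕ) where
  V : Type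
  C : Type
  finV : Finite V
  flip : V → V
  nx : V → V
  src : V → C
  tgt : V → C
  pt : V → Fin n × Circle
  marks : Set (Fin n × Circle)
  kind : V → Kind
  flip_flip : ∀ v, flip (flip v) = v
  src_flip : ∀ v, src (flip v) = tgt v
  src_nx : ∀ v, src (nx v) = tgt v
  nx_injective : Function.Injective nx
  pt_injective : Function.Injective pt
  arc_nx : ∀ v, Arc (range pt) (pt v) (pt (nx v))
  kind_flip : ∀ v, kind (flip v) = (kind v).swap
  nx_prim : ∀ v, kind v = Kind.prim → kind (nx v) = Kind.prim ∨ kind (nx v) = Kind.leave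
  nx_ante : ∀ v, kind v = Kind.ante → kind (nx v) = Kind.ante ∨ kind (nx v) = Kind.enter
  nx_leave : ∀ v, kind v = Kind.leave → kind (nx v) = Kind.ante ∨ kind (nx v) = Kind.enter
  nx_enter : ∀ v, kind v = Kind.enter → kind (nx v) = Kind.prim
  enter_unique : ∀ v w, kind v = Kind.enter → kind w = Kind.enter → tgt v = tgt w → v = w
  orbit : ∀ B : Set V, (∀ v ∈ B, flip (nx v) ∈ B) → ∀ v ∈ B, ∀ w, tgt v = tgt w → w ∈ B
  unmarked : ∀ v, kind v = Kind.prim → kind (nx v) = Kind.prim →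
    Arc (range pt ∪ marks) (pt v) (pt (nx v))
  marked : ∀ v, kind v = Kind.leave → kind (nx v) = Kind.enter →
    ArcThrough (range pt) marks (pt v) (pt (nx v))

namespace Diagram

section

variable {n : ℕ} (D : Diagram n)

theorem tgt_flip (v : D.V) : D.tgt (D.flip v) = D.src v := by
  rw [← D.src_flip, D.flip_flip]

theorem exists_nx (v : D.V) : ∃ u, D.nx u = v :=
  haveI := D.finV
  Finite.surjective_of_injective D.nx_injective v

theorem prev_leave {v : D.V} (h : D.kind (D.nx v) = Kind.leave) : D.kind v = Kind.prim := by
  rcases hk : D.kind v with _ | _ | _ | _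
  · rfl
  · rcases D.nx_ante v hk with h1 | h1 <;> simp [h1] at h
  · rcases D.nx_leave v hk with h1 | h1 <;> simp [h1] at h
  · simp [D.nx_enter v hk] at h

theorem prev_prim {v : D.V} (h : D.kind (D.nx v) = Kind.prim) :
    D.kind v = Kind.prim ∨ D.kind v = Kind.enter := by
  rcases hk : D.kind v with _ | _ | _ | _
  · exact Or.inl rfl
  · rcases D.nx_ante v hk with h1 | h1 <;> simp [h1] at h
  · rcases D.nx_leave v hk with h1 | h1 <;> simp [h1] at h
  · exact Or.inr rfl

theorem prev_enter {v : D.V} (h : D.kind (D.nx v) = Kind.enter) :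
    D.kind v = Kind.ante ∨ D.kind v = Kind.leave := by
  rcases hk : D.kind v with _ | _ | _ | _
  · rcases D.nx_prim v hk with h1 | h1 <;> simp [h1] at h
  · exact Or.inl rfl
  · exact Or.inr rfl
  · simp [D.nx_enter v hk] at h

theorem kind_flip_leave {v : D.V} (h : D.kind v = Kind.leave) : D.kind (D.flip v) = Kind.enter := by
  rw [D.kind_flip, h]; rfl

theorem kind_flip_enter {v : D.V} (h : D.kind v = Kind.enter) : D.kind (D.flip v) = Kind.leave := by
  rw [D.kind_flip, h]; rfl

/-- The end points of the co-cores of the cores. -/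
def corePts : Set (Fin n × Circle) := D.pt '' {v | (D.kind v).IsCore}

theorem mem_corePts {v : D.V} : D.pt v ∈ D.corePts ↔ (D.kind v).IsCore :=
  D.pt_injective.mem_set_image

theorem corePts_subset : D.corePts ⊆ range D.pt := image_subset_range _ _

theorem notMem_of_leave {v : D.V} (h : D.kind v = Kind.leave) : D.pt v ∉ D.corePts := by
  rw [mem_corePts, h]; simp [Kind.IsCore]

theorem notMem_of_enter {v : D.V} (h : D.kind v = Kind.enter) : D.pt v ∉ D.corePts := by
  rw [mem_corePts, h]; simp [Kind.IsCore]

theorem mem_of_prim {v : D.V} (h : D.kind v = Kind.prim) : D.pt v ∈ D.corePts :=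
  D.mem_corePts.2 (Or.inl h)

theorem coreArc (v : D.V) : Arc D.corePts (D.pt v) (D.pt (D.nx v)) :=
  (D.arc_nx v).mono D.corePts_subset

/-- Collar points do not belong to the slice, so arcs relative to `corePts` run past them. Such arcs
are what an isomorphism of slices can transport. -/
theorem coreArc_of_leave {v : D.V} (h : D.kind (D.nx v) = Kind.leave) :
    Arc D.corePts (D.pt v) (D.pt (D.nx (D.nx v))) :=
  (D.coreArc v).trans (D.coreArc _) (D.notMem_of_leave h)

theorem coreArc_of_enter {v : D.V} (h : D.kind (D.nx v) = Kind.enter) :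
    Arc D.corePts (D.pt v) (D.pt (D.nx (D.nx v))) :=
  (D.coreArc v).trans (D.coreArc _) (D.notMem_of_enter h)

theorem coreArcThrough {v : D.V} (h : D.kind (D.nx v) = Kind.leave)
    (h' : D.kind (D.nx (D.nx v)) = Kind.enter) :
    ArcThrough D.corePts D.marks (D.pt v) (D.pt (D.nx (D.nx (D.nx v)))) := by
  obtain ⟨m, a, b, h1, h2, h3, h4, h5⟩ := D.marked _ h h'
  have h6 : ArcThrough D.corePts D.marks (D.pt (D.nx v)) (D.pt (D.nx (D.nx v))) :=
    ⟨m, a, b, h1, h2, h3, fun t ht hm => h4 t ht (D.corePts_subset hm), h5⟩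
  exact (h6.trans_left (D.coreArc v) (D.notMem_of_leave h)).trans_right (D.coreArc _)
    (D.notMem_of_enter h')

theorem coreArc_unmarked {v : D.V} (h : D.kind v = Kind.prim) (h' : D.kind (D.nx v) = Kind.prim) :
    Arc (D.corePts ∪ D.marks) (D.pt v) (D.pt (D.nx v)) :=
  (D.unmarked v h h').mono (union_subset_union_left _ D.corePts_subset)

end

/-! ### Recovering the collars from the decorated circles -/

/-- A correspondence between the cores of two diagrams that comes from an isomorphism of slices. -/
structure CoreIso {n n' : ℕ} (D : Diagram n) (D' : Diagram n') where
  f : Fin n × Circle → Fin n' × Circle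
  map : D.V → D'.V
  oriented : IsOriented f
  injective : Function.Injective f
  image_marks : f '' D.marks = D'.marks
  kind_map : ∀ v, (D.kind v).IsCore → D'.kind (map v) = D.kind v
  pt_map : ∀ v, (D.kind v).IsCore → D'.pt (map v) = f (D.pt v)
  map_flip : ∀ v, (D.kind v).IsCore → map (D.flip v) = D'.flip (map v)
  surj : ∀ v', (D'.kind v').IsCore → ∃ v, (D.kind v).IsCore ∧ map v = v'

namespace CoreIso

variable {n n' : ℕ} {D : Diagram n} {D' : Diagram n'} (F : CoreIso D D')

theorem image_corePts : F.f '' D.corePts = D'.corePts := by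
  ext z
  constructor
  · rintro ⟨_, ⟨v, hv, rfl⟩, rfl⟩
    rw [← F.pt_map v hv, mem_corePts, F.kind_map v hv]
    exact hv
  · rintro ⟨v', hv', rfl⟩
    obtain ⟨v, hv, rfl⟩ := F.surj v' hv'
    exact ⟨_, mem_image_of_mem _ hv, (F.pt_map v hv).symm⟩

theorem kind_prim {v : D.V} (h : D.kind v = Kind.prim) : D'.kind (F.map v) = Kind.prim := by
  rw [F.kind_map v (Or.inl h), h]

theorem kind_ante {v : D.V} (h : D.kind v = Kind.ante) : D'.kind (F.map v) = Kind.ante := by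
  rw [F.kind_map v (Or.inr h), h]

theorem arc {v w : D.V} (hv : (D.kind v).IsCore) (hw : (D.kind w).IsCore)
    (h : Arc D.corePts (D.pt v) (D.pt w)) :
    Arc D'.corePts (D'.pt (F.map v)) (D'.pt (F.map w)) := by
  rw [F.pt_map v hv, F.pt_map w hw, ← F.image_corePts]
  exact h.image F.oriented F.injective

theorem arcThrough {v w : D.V} (hv : (D.kind v).IsCore) (hw : (D.kind w).IsCore)
    (h : ArcThrough D.corePts D.marks (D.pt v) (D.pt w)) :
    ArcThrough D'.corePts D'.marks (D'.pt (F.map v)) (D'.pt (F.map w)) := by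
  rw [F.pt_map v hv, F.pt_map w hw, ← F.image_corePts, ← F.image_marks]
  exact h.image F.oriented F.injective

theorem arc_unmarked {v w : D.V} (hv : (D.kind v).IsCore) (hw : (D.kind w).IsCore)
    (h : Arc (D.corePts ∪ D.marks) (D.pt v) (D.pt w)) :
    Arc (D'.corePts ∪ D'.marks) (D'.pt (F.map v)) (D'.pt (F.map w)) := by
  rw [F.pt_map v hv, F.pt_map w hw, ← F.image_corePts, ← F.image_marks, ← image_union]
  exact h.image F.oriented F.injective

theorem eq_of_arc {u v w : D'.V} (h : Arc D'.corePts (D'.pt u) (D'.pt v))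
    (h' : Arc D'.corePts (D'.pt u) (D'.pt w)) (hv : (D'.kind v).IsCore)
    (hw : (D'.kind w).IsCore) : v = w :=
  D'.pt_injective (h.right_unique h' (D'.mem_corePts.2 hv) (D'.mem_corePts.2 hw))

theorem eq_of_arc_left {u v w : D'.V} (h : Arc D'.corePts (D'.pt v) (D'.pt u))
    (h' : Arc D'.corePts (D'.pt w) (D'.pt u)) (hv : (D'.kind v).IsCore)
    (hw : (D'.kind w).IsCore) : v = w :=
  D'.pt_injective (h.left_unique h' (D'.mem_corePts.2 hv) (D'.mem_corePts.2 hw))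

/-- Beyond a leaving side the next core point is antecedent, or it is primary with a marker on the
way. Neither is compatible with two directly consecutive primary sides in `D'`. -/
theorem nx_leave {v : D.V} (h : D.kind (D.nx v) = Kind.leave) :
    D'.kind (D'.nx (F.map v)) = Kind.leave := by
  have hv := D.prev_leave h
  refine (D'.nx_prim _ (F.kind_prim hv)).resolve_left fun h' => ?_
  have ha := D'.coreArc (F.map v)
  rcases D.nx_leave _ h with h1 | h1
  · have h2 := F.arc (Or.inl hv) (Or.inr h1) (D.coreArc_of_leave h)
    have h3 := eq_of_arc ha h2 (Or.inl h') (Or.inr (F.kind_ante h1))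
    rw [h3, F.kind_ante h1] at h'
    simp at h'
  · have hw := D.nx_enter _ h1
    have h2 := F.arcThrough (Or.inl hv) (Or.inl hw) (D.coreArcThrough h h1)
    have h3 := eq_of_arc ha h2.arc (Or.inl h') (Or.inl (F.kind_prim hw))
    have h4 := D'.coreArc_unmarked (F.kind_prim hv) h'
    rw [h3] at h4
    exact h2.not_arc (D'.mem_of_prim (F.kind_prim hw)) h4

/-- The mirror image of `nx_leave`: here the circles are run through backwards from the primary side
that follows `y`. -/
theorem prev_enter {y : D.V} (h : D.kind y = Kind.enter) :
    ∃ y', D'.kind y' = Kind.enter ∧ D'.nx y' = F.map (D.nx y) := by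
  have hw := D.nx_enter _ h
  obtain ⟨p, hp⟩ := D'.exists_nx (F.map (D.nx y))
  refine ⟨p, (D'.prev_prim (hp ▸ F.kind_prim hw)).resolve_left fun h' => ?_, hp⟩
  have ha := D'.coreArc p
  rw [hp] at ha
  obtain ⟨x, rfl⟩ := D.exists_nx y
  rcases D.prev_enter h with h1 | h1
  · have h2 := F.arc (Or.inr h1) (Or.inl hw) (D.coreArc_of_enter h)
    have h3 := eq_of_arc_left ha h2 (Or.inl h') (Or.inr (F.kind_ante h1))
    rw [h3, F.kind_ante h1] at h'
    simp at h'
  · obtain ⟨v, rfl⟩ := D.exists_nx x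
    have hv := D.prev_leave h1
    have h2 := F.arcThrough (Or.inl hv) (Or.inl hw) (D.coreArcThrough h1 h)
    have h3 := eq_of_arc_left ha h2.arc (Or.inl h') (Or.inl (F.kind_prim hv))
    have h4 := D'.coreArc_unmarked h' (hp ▸ F.kind_prim hw)
    rw [hp, h3] at h4
    exact h2.not_arc (D'.mem_of_prim (F.kind_prim hw)) h4

/-- An excursion out of `P'` between the two images would show an antecedent point or a marker, and
the transported arc contains neither. -/
theorem nx_prim {v : D.V} (h : D.kind v = Kind.prim) (h' : D.kind (D.nx v) = Kind.prim) :
    D'.nx (F.map v) = F.map (D.nx v) := by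
  have h0 := F.arc_unmarked (Or.inl h) (Or.inl h') (D.coreArc_unmarked h h')
  have h0' := h0.mono subset_union_left
  rcases D'.nx_prim _ (F.kind_prim h) with h1 | h1
  · exact eq_of_arc (D'.coreArc _) h0' (Or.inl h1) (Or.inl (F.kind_prim h'))
  · exfalso
    rcases D'.nx_leave _ h1 with h2 | h2
    · have h3 := eq_of_arc (D'.coreArc_of_leave h1) h0' (Or.inr h2) (Or.inl (F.kind_prim h'))
      rw [h3, F.kind_prim h'] at h2
      simp at h2
    · have h3 := D'.nx_enter _ h2
      have h4 := D'.coreArcThrough h1 h2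
      have h5 := eq_of_arc h4.arc h0' (Or.inl h3) (Or.inl (F.kind_prim h'))
      rw [← h5] at h0
      exact h4.not_arc (D'.mem_of_prim h3) h0

theorem nx_ante {v : D.V} (h : D.kind v = Kind.ante) (h' : D.kind (D.nx v) = Kind.ante) :
    D'.nx (F.map v) = F.map (D.nx v) := by
  have h0 := F.arc (Or.inr h) (Or.inr h') (D.coreArc v)
  rcases D'.nx_ante _ (F.kind_ante h) with h1 | h1
  · exact eq_of_arc (D'.coreArc _) h0 (Or.inr h1) (Or.inr (F.kind_ante h'))
  · have h2 := D'.nx_enter _ h1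
    have h3 := eq_of_arc (D'.coreArc_of_enter h1) h0 (Or.inl h2) (Or.inr (F.kind_ante h'))
    rw [h3, F.kind_ante h'] at h2
    simp at h2

theorem nx_ante_enter {v : D.V} (h : D.kind v = Kind.ante) (h' : D.kind (D.nx v) = Kind.enter) :
    D'.kind (D'.nx (F.map v)) = Kind.enter ∧
      D'.nx (D'.nx (F.map v)) = F.map (D.nx (D.nx v)) := by
  have hw := D.nx_enter _ h'
  have h0 := F.arc (Or.inr h) (Or.inl hw) (D.coreArc_of_enter h')
  rcases D'.nx_ante _ (F.kind_ante h) with h1 | h1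
  · have h3 := eq_of_arc (D'.coreArc _) h0 (Or.inr h1) (Or.inl (F.kind_prim hw))
    rw [h3, F.kind_prim hw] at h1
    simp at h1
  · exact ⟨h1, eq_of_arc (D'.coreArc_of_enter h1) h0 (Or.inl (D'.nx_enter _ h1))
      (Or.inl (F.kind_prim hw))⟩

theorem nx_leave_ante {v : D.V} (h : D.kind (D.nx v) = Kind.leave)
    (h' : D.kind (D.nx (D.nx v)) = Kind.ante) :
    D'.nx (D'.nx (F.map v)) = F.map (D.nx (D.nx v)) := by
  have hv := D.prev_leave h
  have h0 := F.arc (Or.inl hv) (Or.inr h') (D.coreArc_of_leave h)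
  have h1 := F.nx_leave h
  rcases D'.nx_leave _ h1 with h2 | h2
  · exact eq_of_arc (D'.coreArc_of_leave h1) h0 (Or.inr h2) (Or.inr (F.kind_ante h'))
  · have h3 := D'.nx_enter _ h2
    have h4 := eq_of_arc (D'.coreArcThrough h1 h2).arc h0 (Or.inl h3) (Or.inr (F.kind_ante h'))
    rw [h4, F.kind_ante h'] at h3
    simp at h3

theorem nx_leave_enter {v : D.V} (h : D.kind (D.nx v) = Kind.leave)
    (h' : D.kind (D.nx (D.nx v)) = Kind.enter) :
    D'.kind (D'.nx (D'.nx (F.map v))) = Kind.enter ∧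
      D'.nx (D'.nx (D'.nx (F.map v))) = F.map (D.nx (D.nx (D.nx v))) := by
  have hv := D.prev_leave h
  have hw := D.nx_enter _ h'
  have h0 := (F.arcThrough (Or.inl hv) (Or.inl hw) (D.coreArcThrough h h')).arc
  have h1 := F.nx_leave h
  rcases D'.nx_leave _ h1 with h2 | h2
  · have h4 := eq_of_arc (D'.coreArc_of_leave h1) h0 (Or.inr h2) (Or.inl (F.kind_prim hw))
    rw [h4, F.kind_prim hw] at h2
    simp at h2
  · exact ⟨h2, eq_of_arc (D'.coreArcThrough h1 h2).arc h0 (Or.inl (D'.nx_enter _ h2))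
      (Or.inl (F.kind_prim hw))⟩

/-- The disc of `P` at a collar corresponds to the disc of `P'` at the corresponding collar. -/
theorem tgt_map {y u : D.V} (h : D.kind y = Kind.enter) (hu : D.nx u = D.flip y) :
    D'.tgt (F.map u) = D'.src (F.map (D.nx y)) := by
  have hw := D.nx_enter _ h
  have hk : D.kind (D.nx u) = Kind.leave := hu ▸ D.kind_flip_enter h
  have hup := D.prev_leave hk
  have hut : D.tgt u = D.tgt y := by rw [← D.src_nx, hu, D.src_flip]
  -- Turning round the disc of `P` from `y`, only primary sides occur until the collar of `y` is
  -- reached again, since the disc has only one entering side. Along primary sides `map` commutes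
  -- with `flip` and `nx`, so the corresponding disc in `D'` does not change.
  have := D.orbit {v | D.tgt v = D.tgt y ∧ (D.kind v = Kind.prim ∧
      D'.tgt (F.map v) = D'.src (F.map (D.nx y)) ∨ v = y)} ?_ y ⟨rfl, Or.inr rfl⟩ u hut.symm
  · rcases this.2 with h1 | h1
    · exact h1.2
    · rw [h1, h] at hup
      simp at hup
  · rintro v ⟨hv, h1⟩
    refine ⟨by rw [D.tgt_flip, D.src_nx, hv], ?_⟩
    rcases h1 with ⟨h2, h3⟩ | rfl
    · rcases D.nx_prim v h2 with h4 | h4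
      · refine Or.inl ⟨by rw [D.kind_flip, h4]; rfl, ?_⟩
        rw [F.map_flip _ (Or.inl h4), D'.tgt_flip, ← F.nx_prim h2 h4, D'.src_nx, h3]
      · refine Or.inr (D.enter_unique _ _ (D.kind_flip_leave h4) h ?_)
        rw [D.tgt_flip, D.src_nx, hv]
    · refine Or.inl ⟨by rw [D.kind_flip, hw]; rfl, ?_⟩
      rw [F.map_flip _ (Or.inl hw), D'.tgt_flip]

/-- Both sides enter the same disc of `P'`, by `tgt_map`, and a disc has at most one entering side.
This recovers which leaving and entering sides bound the same collar. -/
theorem flip_eq {y u : D.V} (h : D.kind y = Kind.enter) (hu : D.nx u = D.flip y) {y' : D'.V}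
    (h' : D'.kind y' = Kind.enter) (hy' : D'.nx y' = F.map (D.nx y)) :
    D'.flip (D'.nx (F.map u)) = y' := by
  have hk : D.kind (D.nx u) = Kind.leave := hu ▸ D.kind_flip_enter h
  refine D'.enter_unique _ _ (D'.kind_flip_leave (F.nx_leave hk)) h' ?_
  rw [D'.tgt_flip, D'.src_nx, F.tgt_map h hu, ← hy', D'.src_nx]

/-- The correspondence between the cores extends to a correspondence between all bands. -/
theorem exists_extension (F : CoreIso D D') : ∃ β : D.V → D'.V, Function.Bijective β ∧
    (∀ v, β (D.flip v) = D'.flip (β v)) ∧ (∀ v, β (D.nx v) = D'.nx (β v)) ∧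
    ∀ v, D'.kind (β v) = D.kind v := by
  choose pv hpv using D.exists_nx
  have hpn : ∀ v, pv (D.nx v) = v := fun v => D.nx_injective (hpv _)
  -- A leaving side always follows a primary side, whose image is known; entering sides are defined
  -- through their leaving partners.
  obtain ⟨β, hcore, hleave, henter⟩ : ∃ β : D.V → D'.V,
      (∀ v, (D.kind v).IsCore → β v = F.map v) ∧
      (∀ v, D.kind v = Kind.leave → β v = D'.nx (F.map (pv v))) ∧
      ∀ v, D.kind v = Kind.enter → β v = D'.flip (D'.nx (F.map (pv (D.flip v)))) := by
    refine ⟨fun v => match D.kind v with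
      | .prim => F.map v
      | .ante => F.map v
      | .leave => D'.nx (F.map (pv v))
      | .enter => D'.flip (D'.nx (F.map (pv (D.flip v)))), ?_, ?_, ?_⟩
    · rintro v (h | h) <;> simp only [h]
    · intro v h
      simp only [h]
    · intro v h
      simp only [h]
  have hkind : ∀ v, D'.kind (β v) = D.kind v := by
    intro v
    rcases hk : D.kind v with _ | _ | _ | _
    · rw [hcore v (Or.inl hk), F.kind_prim hk]
    · rw [hcore v (Or.inr hk), F.kind_ante hk]
    · rw [hleave v hk, F.nx_leave (by rw [hpv, hk])]
    · rw [henter v hk, D'.kind_flip_leave (F.nx_leave (by rw [hpv, D.kind_flip_enter hk]))]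
  have hflip : ∀ v, β (D.flip v) = D'.flip (β v) := by
    intro v
    have hc : (D.kind v).IsCore → β (D.flip v) = D'.flip (β v) := fun h => by
      rw [hcore v h, hcore _ (by rw [D.kind_flip]; exact Kind.swap_isCore.2 h), F.map_flip v h]
    rcases hk : D.kind v with _ | _ | _ | _
    · exact hc (Or.inl hk)
    · exact hc (Or.inr hk)
    · rw [hleave v hk, henter _ (D.kind_flip_leave hk), D.flip_flip]
    · rw [henter v hk, hleave _ (D.kind_flip_enter hk), D'.flip_flip]
  -- The image of an entering side, defined through `flip`, is also characterized by the primary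
  -- side that comes after it. Compatibility with `nx` rests on this.
  have hy : ∀ y, D.kind y = Kind.enter → ∀ y', D'.kind y' = Kind.enter →
      D'.nx y' = F.map (D.nx y) → β y = y' := fun y hk y' hk' h => by
    rw [henter y hk]
    exact F.flip_eq hk (hpv _) hk' h
  have hnx : ∀ v, β (D.nx v) = D'.nx (β v) := by
    intro v
    rcases hk : D.kind v with _ | _ | _ | _
    · rw [hcore v (Or.inl hk)]
      rcases D.nx_prim v hk with h | h
      · rw [hcore _ (Or.inl h), F.nx_prim hk h]
      · rw [hleave _ h, hpn]
    · rw [hcore v (Or.inr hk)]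
      rcases D.nx_ante v hk with h | h
      · rw [hcore _ (Or.inr h), F.nx_ante hk h]
      · obtain ⟨h1, h2⟩ := F.nx_ante_enter hk h
        exact hy _ h _ h1 h2
    · obtain ⟨u, rfl⟩ := D.exists_nx v
      rw [hleave _ hk, hpn]
      rcases D.nx_leave _ hk with h | h
      · rw [hcore _ (Or.inr h), F.nx_leave_ante hk h]
      · obtain ⟨h1, h2⟩ := F.nx_leave_enter hk h
        exact hy _ h _ h1 h2
    · obtain ⟨y', h1, h2⟩ := F.prev_enter hk
      rw [hy v hk y' h1 h2, hcore _ (Or.inl (D.nx_enter v hk)), h2]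
  have hmap : ∀ v w, (D.kind v).IsCore → (D.kind w).IsCore → F.map v = F.map w → v = w := by
    intro v w hv hw h
    refine D.pt_injective (F.injective ?_)
    rw [← F.pt_map v hv, ← F.pt_map w hw, h]
  have hpc : ∀ v, D.kind v = Kind.leave → (D.kind (pv v)).IsCore := fun v hv =>
    Or.inl (D.prev_leave (by rw [hpv, hv]))
  have hie : ∀ v w, D.kind v = Kind.leave → D.kind w = Kind.leave → β v = β w → v = w := by
    intro v w hv hw h
    rw [hleave v hv, hleave w hw] at h
    have := hmap _ _ (hpc v hv) (hpc w hw) (D'.nx_injective h)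
    rw [← hpv v, this, hpv]
  refine ⟨β, ⟨fun v w h => ?_, fun v' => ?_⟩, hflip, hnx, hkind⟩
  · have hk : D.kind v = D.kind w := by rw [← hkind, h, hkind]
    rcases hv : D.kind v with _ | _ | _ | _
    · rw [hcore v (Or.inl hv), hcore w (Or.inl (hk ▸ hv))] at h
      exact hmap _ _ (Or.inl hv) (Or.inl (hk ▸ hv)) h
    · rw [hcore v (Or.inr hv), hcore w (Or.inr (hk ▸ hv))] at h
      exact hmap _ _ (Or.inr hv) (Or.inr (hk ▸ hv)) h
    · exact hie v w hv (hk ▸ hv) h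
    · have := hie _ _ (D.kind_flip_enter hv) (D.kind_flip_enter (hk ▸ hv))
        (by rw [hflip, hflip, h])
      rw [← D.flip_flip v, this, D.flip_flip]
  · have hsc : ∀ v', (D'.kind v').IsCore → ∃ v, β v = v' := fun v' h => by
      obtain ⟨v, hv, rfl⟩ := F.surj v' h
      exact ⟨v, hcore v hv⟩
    have hse : ∀ v', D'.kind v' = Kind.leave → ∃ v, β v = v' := fun v' h => by
      obtain ⟨u', rfl⟩ := D'.exists_nx v'
      obtain ⟨u, rfl⟩ := hsc u' (Or.inl (D'.prev_leave h))
      exact ⟨D.nx u, hnx u⟩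
    rcases hv : D'.kind v' with _ | _ | _ | _
    · exact hsc v' (Or.inl hv)
    · exact hsc v' (Or.inr hv)
    · exact hse v' hv
    · obtain ⟨u, hu⟩ := hse _ (D'.kind_flip_enter hv)
      exact ⟨D.flip u, by rw [hflip, hu, D'.flip_flip]⟩

end CoreIso

end Diagram

/-! ### The diagram of a reduced ribbon presentation -/

namespace Ribbon.Frame

variable {S : Type*} [TopologicalSpace S] [ChartedSpace (EuclideanHalfSpace 2) S]
  {X : Ribbon S} {n : ℕ} {φ : (Fin n × Circle) ≃ₜ (𝓡∂ 2).boundary S} (F : X.Frame φ)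

theorem angle_cases (v : X.I × ℤˣ) {u : ℝ}
    (hu : u ∈ Icc (F.ang v 0) (F.ang (F.nx v) 0 + F.shift v * (2 * Real.pi))) :
    (φ (F.circ v, Circle.exp u) : S) ∈ X.band v.1 '' square ∨
      (∃ τ ∈ Icc (-1 : ℝ) 1, (φ (F.circ v, Circle.exp u) : S) = F.edge v τ) ∨
      (φ (F.circ v, Circle.exp u) : S) ∈ X.band (F.nx v).1 '' square := by
  rcases le_total u (F.lo v) with h1 | h1
  · obtain ⟨s, hs, rfl⟩ := intermediate_value_Icc zero_le_one
      ((F.ang_cont v).mono (Icc_subset_Icc (by norm_num) le_rfl)) ⟨hu.1, h1⟩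
    have hs' : s ∈ Icc (-1 : ℝ) 1 := ⟨by linarith [hs.1], hs.2⟩
    rw [F.ang_spec v s hs']
    exact Or.inl (mem_image_of_mem _ (side_mem_square _ hs'))
  · rcases le_total u (F.hi v) with h2 | h2
    · obtain ⟨τ, hτ, h⟩ := F.exists_edge_angle ⟨h1, h2⟩
      exact Or.inr (Or.inl ⟨τ, hτ, h.symm⟩)
    · obtain ⟨s, hs, rfl⟩ := intermediate_value_Icc (by norm_num : (-1 : ℝ) ≤ 0)
        ((F.ang_cont (F.nx v)).mono (Icc_subset_Icc le_rfl (by norm_num)) |>.add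
          (continuousOn_const (c := F.shift v * (2 * Real.pi)))) ⟨h2, hu.2⟩
      have hs' : s ∈ Icc (-1 : ℝ) 1 := ⟨hs.1, by linarith [hs.2]⟩
      simp only [Pi.add_apply]
      rw [F.coe_ang_nx v hs']
      exact Or.inr (Or.inr (mem_image_of_mem _ (side_mem_square _ hs')))

theorem Ioo_lo_hi_subset (v : X.I × ℤˣ) : Ioo (F.lo v) (F.hi v) ⊆
    Ioo (F.ang v 0) (F.ang (F.nx v) 0 + F.shift v * (2 * Real.pi)) := by
  have m1 := F.ang_mono v zero_mem one_mem one_pos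
  have m2 := F.ang_mono (F.nx v) neg_one_mem zero_mem (by norm_num)
  refine Ioo_subset_Ioo m1.le ?_
  unfold hi
  linarith

/-- The rest of the boundary, after removal of an open free edge. -/
def coEdge (v : X.I × ℤˣ) : Set S :=
  (⋃ m : {m // m ≠ F.circ v}, (fun z => (φ (m.1, z) : S)) '' univ) ∪
    (fun u => (φ (F.circ v, Circle.exp u) : S)) '' Icc (F.hi v) (F.lo v + 2 * Real.pi)

theorem isClosed_coEdge [T2Space S] (v : X.I × ℤˣ) : IsClosed (F.coEdge v) := by
  refine IsClosed.union (isClosed_iUnion_of_finite fun m => ?_) ?_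
  · exact (isCompact_univ.image (continuous_subtype_val.comp (by fun_prop))).isClosed
  · exact (isCompact_Icc.image (continuous_subtype_val.comp (by fun_prop))).isClosed

theorem mem_edge_or_coEdge (v : X.I × ℤˣ) {x : S} (hx : x ∈ (𝓡∂ 2).boundary S) :
    x ∈ F.edge v '' Icc (-1) 1 ∨ x ∈ F.coEdge v := by
  obtain ⟨⟨m, z⟩, hz⟩ := φ.surjective ⟨x, hx⟩
  replace hz : (φ (m, z) : S) = x := congrArg Subtype.val hz
  by_cases hm : m = F.circ v
  · subst hm
    obtain ⟨t, rfl⟩ := Circle.exp_surjective z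
    have h1 := toIcoMod_mem_Ico Real.two_pi_pos (F.lo v) t
    have h2 : Circle.exp (toIcoMod Real.two_pi_pos (F.lo v) t) = Circle.exp t :=
      Circle.exp_eq_exp.2 ⟨-toIcoDiv Real.two_pi_pos (F.lo v) t, by
        rw [toIcoMod, zsmul_eq_mul]; push_cast; ring⟩
    rw [← h2] at hz
    rcases le_total (toIcoMod Real.two_pi_pos (F.lo v) t) (F.hi v) with h | h
    · obtain ⟨τ, hτ, he⟩ := F.exists_edge_angle ⟨h1.1, h⟩
      exact Or.inl ⟨τ, hτ, he.trans hz⟩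
    · exact Or.inr (Or.inr ⟨_, ⟨h, h1.2.le⟩, hz⟩)
  · exact Or.inr (Or.inl (mem_iUnion.2 ⟨⟨m, hm⟩, z, mem_univ _, hz⟩))

theorem notMem_coEdge (v : X.I × ℤˣ) {u : ℝ} (hu : u ∈ Ioo (F.lo v) (F.hi v)) :
    (φ (F.circ v, Circle.exp u) : S) ∉ F.coEdge v := by
  rintro (h | ⟨t, ht, h⟩)
  · obtain ⟨⟨m, hm⟩, z, -, h⟩ := mem_iUnion.1 h
    exact hm (congrArg Prod.fst (φ.injective (Subtype.ext h)))
  · have h1 := congrArg Prod.snd (φ.injective (Subtype.ext h))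
    obtain ⟨k, hk⟩ := Circle.exp_eq_exp.1 h1
    have hpos := Real.two_pi_pos
    have h2 : (0 : ℝ) < k := by
      by_contra! h2
      nlinarith [hu.2, ht.1]
    have h3 : (k : ℝ) < 1 := by
      by_contra! h3
      nlinarith [hu.1, ht.2]
    have h4 : 0 < k := by exact_mod_cast h2
    have h5 : k < 1 := by exact_mod_cast h3
    omega

end Ribbon.Frame

namespace MarkedRibbon

open Ribbon (Frame)

variable {S : Type*} [TopologicalSpace S] [ChartedSpace (EuclideanHalfSpace 2) S]
  {P : Set S} {H : HandleStructure P} (X : MarkedRibbon H)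

open Classical in
/-- The kind of a side. -/
noncomputable def kind (v : X.I × ℤˣ) : Kind :=
  if X.core v.1 then if X.inPI v.1 then Kind.prim else Kind.ante
  else if v.2 = 1 then Kind.leave else Kind.enter

theorem kind_prim_iff {v : X.I × ℤˣ} : X.kind v = Kind.prim ↔ X.core v.1 ∧ X.inPI v.1 := by
  unfold kind
  split_ifs <;> simp_all

theorem kind_ante_iff {v : X.I × ℤˣ} : X.kind v = Kind.ante ↔ X.core v.1 ∧ ¬ X.inPI v.1 := by
  unfold kind
  split_ifs <;> simp_all

theorem kind_leave_iff {v : X.I × ℤˣ} : X.kind v = Kind.leave ↔ ¬ X.core v.1 ∧ v.2 = 1 := by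
  unfold kind
  split_ifs <;> simp_all

theorem kind_enter_iff {v : X.I × ℤˣ} : X.kind v = Kind.enter ↔ ¬ X.core v.1 ∧ v.2 = -1 := by
  unfold kind
  rcases Int.units_eq_one_or v.2 with h | h <;> split_ifs <;> simp_all

theorem kind_flip (v : X.I × ℤˣ) : X.kind (X.flip v) = (X.kind v).swap := by
  rcases hk : X.kind v with _ | _ | _ | _
  · have h := X.kind_prim_iff.1 hk
    exact (X.kind_prim_iff (v := X.flip v)).2 h
  · have h := X.kind_ante_iff.1 hk
    exact (X.kind_ante_iff (v := X.flip v)).2 h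
  · obtain ⟨h1, h2⟩ := X.kind_leave_iff.1 hk
    exact X.kind_enter_iff.2 ⟨h1, by simp [Ribbon.flip, h2]⟩
  · obtain ⟨h1, h2⟩ := X.kind_enter_iff.1 hk
    exact X.kind_leave_iff.2 ⟨h1, by simp [Ribbon.flip, h2]⟩

variable {X}

theorem inPI_iff (hX : X.IsReduced) (v : X.I × ℤˣ) : X.inPI v.1 ↔ X.kind v ≠ Kind.ante := by
  rw [Ne, X.kind_ante_iff]
  by_cases h : X.core v.1
  · simp [h]
  · simp [h, (hX v.1 h).1]

theorem inPC_tgt_iff (hX : X.IsReduced) (v : X.I × ℤˣ) :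
    X.inPC (X.tgt v) ↔ X.kind v = Kind.prim ∨ X.kind v = Kind.enter := by
  rw [X.kind_prim_iff, X.kind_enter_iff]
  by_cases h : X.core v.1
  · simp [h, Ribbon.tgt, X.inP_core v.1 h]
  · obtain ⟨h1, h2⟩ := hX v.1 h
    rcases Int.units_eq_one_or v.2 with h3 | h3
    · simp [h, h3, Ribbon.tgt, h2]
    · simp [h, h3, Ribbon.tgt, X.inP_inner v.1 h, h1]

theorem inPC_src_iff (hX : X.IsReduced) (v : X.I × ℤˣ) :
    X.inPC (X.src v) ↔ X.kind v = Kind.prim ∨ X.kind v = Kind.leave := by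
  rw [← X.tgt_flip, inPC_tgt_iff hX, X.kind_flip]
  rcases X.kind v <;> simp [Kind.swap]

theorem enter_unique {v w : X.I × ℤˣ} (hv : X.kind v = Kind.enter) (hw : X.kind w = Kind.enter)
    (h : X.tgt v = X.tgt w) : v = w := by
  obtain ⟨h1, h2⟩ := X.kind_enter_iff.1 hv
  obtain ⟨h3, h4⟩ := X.kind_enter_iff.1 hw
  refine Prod.ext (X.inner_inj _ _ h1 h3 ?_) (h2.trans h4.symm)
  rwa [Ribbon.tgt, Ribbon.tgt, h2, h4] at h

variable [T2Space S] {n : ℕ} {φ : (Fin n × Circle) ≃ₜ (𝓡∂ 2).boundary S} (F : X.toRibbon.Frame φ)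

/-- For the injective map `flip ∘ nx` of a finite set, forward invariance already implies
invariance. -/
theorem orbit (B : Set (X.I × ℤˣ)) (hB : ∀ v ∈ B, X.flip (F.nx v) ∈ B) (v : X.I × ℤˣ)
    (hv : v ∈ B) (w : X.I × ℤˣ) (h : X.tgt v = X.tgt w) : w ∈ B := by
  have hi : Function.Injective fun v => X.flip (F.nx v) := fun v w h =>
    F.nx_injective (by rw [← X.flip_flip (F.nx v), ← X.flip_flip (F.nx w)]; exact congrArg X.flip h)
  have hs : (fun v => X.flip (F.nx v)) '' B = B :=
    Set.eq_of_subset_of_ncard_le (image_subset_iff.2 hB) (ncard_image_of_injective B hi).ge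
      (toFinite _)
  refine F.mem_of_tgt_eq (fun u => ⟨hB u, fun hu => ?_⟩) h hv
  rw [← hs] at hu
  obtain ⟨u', hu', e⟩ := hu
  exact hi e ▸ hu'

/-- If the boundary left `P` at once, it would do so along the same collar, so that collar would
have the only foot in the disc. But the disc also carries a foot of a core. -/
theorem nx_enter (hX : X.IsReduced) {v : X.I × ℤˣ} (h : X.kind v = Kind.enter) :
    X.kind (F.nx v) = Kind.prim := by
  have h1 := (inPC_src_iff hX (F.nx v)).1 (by
    rw [F.src_nx]; exact (inPC_tgt_iff hX v).2 (Or.inr h))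
  refine h1.resolve_right fun h2 => ?_
  have h3 : X.flip (F.nx v) = v :=
    enter_unique (by rw [X.kind_flip, h2]; rfl) h (by rw [X.tgt_flip, F.src_nx])
  obtain ⟨h4, h5⟩ := X.kind_enter_iff.1 h
  obtain ⟨j, η, hj, he⟩ := X.inner_core v.1 h4
  have h6 : ((j, η) : X.I × ℤˣ) ∈ ({v} : Set (X.I × ℤˣ)) := orbit F {v} (by
      rintro w rfl
      exact h3) v rfl (j, η) (by rw [Ribbon.tgt, Ribbon.tgt, h5, he])
  rw [mem_singleton_iff] at h6
  rw [← h6] at h4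
  exact h4 hj

theorem isClosed_P (X : MarkedRibbon H) : IsClosed P := by
  have : P = (⋃ c : {c // X.inPC c}, X.disc c.1 '' square) ∪
      ⋃ i : {i // X.inPI i}, X.band i.1 '' square := by
    ext x
    rw [X.mem_P]
    simp
  rw [this]
  exact (isClosed_iUnion_of_finite fun c : {c // X.inPC c} => X.isClosed_disc c.1).union
    (isClosed_iUnion_of_finite fun i : {i // X.inPI i} => X.isClosed_band i.1)

/-- As `P` is closed, its frontier lies in `P`, so removing its boundary from `∂S` amounts to
removing `P`. -/
theorem boundary_diff (X : MarkedRibbon H) :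
    (𝓡∂ 2).boundary S \ subsurfaceBoundary P = (𝓡∂ 2).boundary S \ P := by
  have hP := X.isClosed_P
  ext x
  simp only [subsurfaceBoundary, Set.mem_sdiff, mem_union, mem_inter_iff]
  constructor
  · rintro ⟨h1, h2⟩
    exact ⟨h1, fun h => h2 (Or.inr ⟨h, h1⟩)⟩
  · rintro ⟨h1, h2⟩
    refine ⟨h1, ?_⟩
    rintro (h | h)
    · exact h2 (hP.frontier_subset h)
    · exact h2 h.1

/-- Between two consecutive primary sides the boundary stays in pieces of `P`, whereas markers lie
outside `P`. -/
theorem unmarked (hX : X.IsReduced) {M : Set (Fin n × Circle)}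
    (hM : ∀ z ∈ M, ∃ C ∈ complementaryArcs P, (φ z : S) ∈ C) {v : X.I × ℤˣ}
    (hv : X.kind v = Kind.prim) (hv' : X.kind (F.nx v) = Kind.prim) :
    Arc (range F.pt ∪ M) (F.pt v) (F.pt (F.nx v)) := by
  refine ⟨F.circ v, _, _, F.lt_nx v, rfl, by rw [circle_exp_add_int, ← F.circ_nx v]; rfl, ?_⟩
  rintro u hu (⟨w, hw⟩ | hm)
  · exact F.avoid v u hu w hw.symm
  · obtain ⟨C, ⟨x, -, rfl, -⟩, hC⟩ := hM _ hm
    have h1 := connectedComponentIn_subset _ _ hC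
    rw [X.boundary_diff] at h1
    refine h1.2 ((X.mem_P _).2 ?_)
    rcases F.angle_cases v (Ioo_subset_Icc_self hu) with h | ⟨τ, hτ, h⟩ | h
    · exact Or.inr ⟨v.1, (X.kind_prim_iff.1 hv).2, h⟩
    · rw [h]
      exact Or.inl ⟨_, (inPC_tgt_iff hX v).2 (Or.inl hv),
        image_mono rim_subset_square (F.edge_mem_disc v hτ)⟩
    · exact Or.inr ⟨_, (X.kind_prim_iff.1 hv').2, h⟩

/-- The free edge between the two collars has its ends in `P` and its interior outside, so its
interior contains a whole arc of `∂S \ ∂P` and with it a marker. -/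
theorem marked (hX : X.IsReduced) {M : Set (Fin n × Circle)}
    (hM : ∀ C ∈ complementaryArcs P, ∃ z ∈ M, (φ z : S) ∈ C) {v : X.I × ℤˣ}
    (hv : X.kind v = Kind.leave) (hv' : X.kind (F.nx v) = Kind.enter) :
    ArcThrough (range F.pt) M (F.pt v) (F.pt (F.nx v)) := by
  have hband : ∀ w, X.kind w ≠ Kind.ante → X.band w.1 '' square ⊆ P := fun w hw x hx =>
    (X.mem_P x).2 (Or.inr ⟨w.1, (inPI_iff hX w).2 hw, hx⟩)
  have hlo : F.edge v (-1) ∈ P := by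
    rw [F.edge_neg_one]
    exact hband v (by simp [hv]) (mem_image_of_mem _ (Ribbon.side_mem_square _ Frame.one_mem))
  have hhi : F.edge v 1 ∈ P := by
    rw [F.edge_one]
    exact hband _ (by simp [hv'])
      (mem_image_of_mem _ (Ribbon.side_mem_square _ Frame.neg_one_mem))
  have hin : ∀ τ ∈ Ioo (-1 : ℝ) 1, F.edge v τ ∉ P := by
    intro τ hτ hP
    have hτ' := Ioo_subset_Icc_self hτ
    rcases (X.mem_P _).1 hP with ⟨c, hc, p, hp, he⟩ | ⟨i, -, z, hz, he⟩
    · obtain ⟨q, hq, hqe⟩ := F.edge_mem_disc v hτ'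
      have h1 := ((X.disc_eq_iff hp (rim_subset_square hq)).1 (he.trans hqe.symm)).1
      rw [h1, inPC_tgt_iff hX, hv] at hc
      simp at hc
    · rcases F.edge_eq_band hτ' hz he.symm with ⟨h, -⟩ | ⟨h, -⟩
      · exact hτ.1.ne' h
      · exact hτ.2.ne h
  set x := F.edge v 0 with hx
  have hxm : x ∈ (𝓡∂ 2).boundary S \ P :=
    ⟨F.edge_mem_boundary v 0, hin 0 ⟨by norm_num, by norm_num⟩⟩
  set C := connectedComponentIn ((𝓡∂ 2).boundary S \ P) x with hC
  have hCsub : C ⊆ (𝓡∂ 2).boundary S \ P := connectedComponentIn_subset _ _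
  have harc : C ∈ complementaryArcs P := by
    refine ⟨x, by rwa [X.boundary_diff], by rw [X.boundary_diff], fun h => ?_⟩
    have h1 : F.edge v '' Icc (-1) 1 ⊆ connectedComponentIn ((𝓡∂ 2).boundary S) x :=
      (isPreconnected_Icc.image _ (F.continuous_edge v).continuousOn).subset_connectedComponentIn
        (mem_image_of_mem _ Frame.zero_mem) (image_subset_iff.2 fun τ _ => F.edge_mem_boundary v τ)
    rw [← h] at h1
    exact (hCsub (h1 (mem_image_of_mem _ Frame.one_mem))).2 hhi
  have hopen : ∀ y ∈ C, y ∈ F.edge v '' Icc (-1) 1 →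
      ∃ u ∈ Ioo (F.lo v) (F.hi v), y = φ (F.circ v, Circle.exp u) := by
    rintro _ hy ⟨τ, hτ, rfl⟩
    refine ⟨_, F.edge_angle_mem_Ioo v (abs_lt.2 ⟨hτ.1.lt_of_ne ?_, hτ.2.lt_of_ne ?_⟩), rfl⟩
    · rintro rfl
      exact (hCsub hy).2 hlo
    · rintro rfl
      exact (hCsub hy).2 hhi
  -- The closed edge and `coEdge` cover the boundary and meet at most in the ends of the edge, which
  -- `C` avoids.
  have hCe : C ⊆ F.edge v '' Icc (-1) 1 := by
    refine (isPreconnected_iff_subset_of_disjoint_closed.1 isPreconnected_connectedComponentIn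
      (F.edge v '' Icc (-1) 1) (F.coEdge v)
      (isCompact_Icc.image (F.continuous_edge v)).isClosed (F.isClosed_coEdge v)
      (fun y hy => F.mem_edge_or_coEdge v (hCsub hy).1) ?_).resolve_right fun h => ?_
    · refine eq_empty_iff_forall_notMem.2 ?_
      rintro y ⟨hy, h1, h2⟩
      obtain ⟨u, hu, rfl⟩ := hopen y hy h1
      exact F.notMem_coEdge v hu h2
    · have hxC : x ∈ C := mem_connectedComponentIn hxm
      obtain ⟨u, hu, e⟩ := hopen x hxC (mem_image_of_mem _ Frame.zero_mem)
      exact F.notMem_coEdge v hu (e ▸ h hxC)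
  obtain ⟨z, hz, hzC⟩ := hM C harc
  obtain ⟨u, hu, e⟩ := hopen _ hzC (hCe hzC)
  have e' := φ.injective (Subtype.ext e)
  refine ⟨F.circ v, _, _, F.lt_nx v, rfl, by rw [circle_exp_add_int, ← F.circ_nx v]; rfl, ?_,
    u, F.Ioo_lo_hi_subset v hu, e' ▸ hz⟩
  rintro u hu ⟨w, hw⟩
  exact F.avoid v u hu w hw.symm

/-- The diagram of a reduced ribbon presentation. -/
noncomputable def diagram (hX : X.IsReduced) (M : Set (Fin n × Circle))
    (hM : ∀ z ∈ M, ∃ C ∈ complementaryArcs P, (φ z : S) ∈ C)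
    (hM' : ∀ C ∈ complementaryArcs P, ∃ z ∈ M, (φ z : S) ∈ C) : Diagram n where
  V := X.I × ℤˣ
  C := X.C
  finV := inferInstance
  flip := X.flip
  nx := F.nx
  src := X.src
  tgt := X.tgt
  pt := F.pt
  marks := M
  kind := X.kind
  flip_flip := X.flip_flip
  src_flip := X.src_flip
  src_nx := F.src_nx
  nx_injective := F.nx_injective
  pt_injective := F.pt_injective
  arc_nx := F.arc_nx
  kind_flip := X.kind_flip
  nx_prim v h := (inPC_src_iff hX _).1 (by
    rw [F.src_nx]; exact (inPC_tgt_iff hX v).2 (Or.inl h))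
  nx_ante v h := by
    have h1 := inPC_src_iff hX (F.nx v)
    rw [F.src_nx, inPC_tgt_iff hX, h] at h1
    rcases hk : X.kind (F.nx v) <;> simp [hk] at h1 ⊢
  nx_leave v h := by
    have h1 := inPC_src_iff hX (F.nx v)
    rw [F.src_nx, inPC_tgt_iff hX, h] at h1
    rcases hk : X.kind (F.nx v) <;> simp [hk] at h1 ⊢
  nx_enter _ h := nx_enter F hX h
  enter_unique _ _ := enter_unique
  orbit := orbit F
  unmarked _ := unmarked F hX hM
  marked _ := marked F hX hM'

end MarkedRibbon

/-! ### Isomorphisms of slices -/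

/-- Pairs of end points that correspond under an injective map. -/
theorem exists_pair {V V' Z Z' : Type*} {pt : V → Z} {pt' : V' → Z'} {flip : V → V}
    {flip' : V' → V'} (hflip' : ∀ v, flip' (flip' v) = v) {f : Z → Z'}
    (hne : ∀ v, pt (flip v) ≠ pt v) (hf : Function.Injective f)
    {K : V → Prop} {K' : V' → Prop} (hK' : ∀ v, K' v → K' (flip' v))
    (h : image f '' {s | ∃ v, K v ∧ s = {pt v, pt (flip v)}} ⊆
      {s | ∃ v, K' v ∧ s = {pt' v, pt' (flip' v)}}) {v : V} (hv : K v) :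
    ∃ v', K' v' ∧ pt' v' = f (pt v) ∧ pt' (flip' v') = f (pt (flip v)) := by
  obtain ⟨w, hw, e⟩ := h (mem_image_of_mem _ ⟨v, hv, rfl⟩)
  rw [image_pair] at e
  have h1 : f (pt (flip v)) ≠ f (pt v) := fun h => hne v (hf h)
  have h2 : f (pt v) ∈ ({pt' w, pt' (flip' w)} : Set Z') := e ▸ Or.inl rfl
  have h3 : f (pt (flip v)) ∈ ({pt' w, pt' (flip' w)} : Set Z') := e ▸ Or.inr rfl
  rcases h2 with h2 | h2
  · exact ⟨w, hw, h2.symm, (h3.resolve_left fun h => h1 (h.trans h2.symm)).symm⟩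
  · refine ⟨flip' w, hK' w hw, h2.symm, ?_⟩
    rw [hflip']
    exact (h3.resolve_right fun h => h1 (h.trans (mem_singleton_iff.1 h2).symm)).symm

namespace MarkedRibbon

section

variable {S : Type*} [TopologicalSpace S] [ChartedSpace (EuclideanHalfSpace 2) S]
  {P : Set S} {H : HandleStructure P} {X : MarkedRibbon H} {n : ℕ}
  {φ : (Fin n × Circle) ≃ₜ (𝓡∂ 2).boundary S} (F : X.toRibbon.Frame φ)

theorem image_pt_pair (v : X.I × ℤˣ) : (fun z => (φ z : S)) '' {F.pt v, F.pt (X.flip v)} =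
    {X.band v.1 (-1, 0), X.band v.1 (1, 0)} := by
  rw [image_pair, F.coe_pt, F.coe_pt]
  rcases Int.units_eq_one_or v.2 with h | h
  · rw [pair_comm]
    simp [Ribbon.side, Ribbon.flip, h]
  · simp [Ribbon.side, Ribbon.flip, h]

theorem eq_pairs {Q : Set (Set (Fin n × Circle))} {K : X.I → Prop}
    (h : image (fun z => (φ z : S)) '' Q =
      {s | ∃ i, K i ∧ s = {X.band i (-1, 0), X.band i (1, 0)}}) :
    Q = {s | ∃ v : X.I × ℤˣ, K v.1 ∧ s = {F.pt v, F.pt (X.flip v)}} := by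
  have hi : Function.Injective fun z => (φ z : S) := Subtype.val_injective.comp φ.injective
  refine (image_injective.2 (image_injective.2 hi)) (h.trans ?_)
  ext s
  constructor
  · rintro ⟨i, hi, rfl⟩
    exact ⟨_, ⟨(i, 1), hi, rfl⟩, image_pt_pair F (i, 1)⟩
  · rintro ⟨_, ⟨v, hv, rfl⟩, rfl⟩
    exact ⟨v.1, hv, image_pt_pair F v⟩

theorem exists_core [Nonempty X.I] : ∃ i, X.core i := by
  obtain ⟨i⟩ := ‹Nonempty X.I›
  by_cases h : X.core i
  · exact ⟨i, h⟩
  · obtain ⟨j, -, hj, -⟩ := X.inner_core i h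
    exact ⟨j, hj⟩

theorem antecedentPairs_eq {A : Slice} {φ : (Fin A.n × Circle) ≃ₜ (𝓡∂ 2).boundary S}
    (F : X.toRibbon.Frame φ)
    (h : image (fun z => (φ z : S)) '' A.antecedentPairs =
      range (fun i : Fin H.r => H.cocoreEnds (Fin.castAdd H.p i))) :
    A.antecedentPairs =
      {s | ∃ v : X.I × ℤˣ, X.kind v = Kind.ante ∧ s = {F.pt v, F.pt (X.flip v)}} := by
  simp only [X.kind_ante_iff]
  refine eq_pairs F (K := fun i => X.core i ∧ ¬ X.inPI i) (h.trans ?_)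
  rw [← X.antecedents]
  simp only [and_assoc]

theorem primaryPairs_eq {A : Slice} {φ : (Fin A.n × Circle) ≃ₜ (𝓡∂ 2).boundary S}
    (F : X.toRibbon.Frame φ)
    (h : image (fun z => (φ z : S)) '' A.primaryPairs =
      range (fun j : Fin H.p => H.cocoreEnds (Fin.natAdd H.r j))) :
    A.primaryPairs =
      {s | ∃ v : X.I × ℤˣ, X.kind v = Kind.prim ∧ s = {F.pt v, F.pt (X.flip v)}} := by
  simp only [X.kind_prim_iff]
  refine eq_pairs F (K := fun i => X.core i ∧ X.inPI i) (h.trans ?_)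
  rw [← X.primaries]
  simp only [and_assoc]

/-- Without bands every disc is open as well as closed. -/
theorem exists_disc_eq_univ [T2Space S] [ConnectedSpace S] [IsEmpty X.I] : ∃ c, X.disc c '' square = univ := by
  obtain ⟨x⟩ := (inferInstance : Nonempty S)
  obtain ⟨c, p, hp, rfl⟩ := (X.cover x).resolve_right fun ⟨i, _⟩ => isEmptyElim i
  refine ⟨c, IsClopen.eq_univ ⟨X.isClosed_disc c, ?_⟩ ⟨_, mem_image_of_mem _ hp⟩⟩
  rw [isOpen_iff_mem_nhds]
  rintro _ ⟨q, hq, rfl⟩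
  exact X.disc_mem_nhds hq fun i => isEmptyElim i

theorem eq_empty_of_isEmpty (X : MarkedRibbon H) [IsEmpty X.I] : P = ∅ := by
  have hp : IsEmpty (Fin H.p) := by
    rw [← not_nonempty_iff]
    rintro ⟨j⟩
    have h : H.cocoreEnds (Fin.natAdd H.r j) ∈
        range fun j : Fin H.p => H.cocoreEnds (Fin.natAdd H.r j) := mem_range_self j
    rw [← X.primaries] at h
    obtain ⟨i, -⟩ := h
    exact isEmptyElim i
  rw [H.eq_P, iUnion_of_empty]

theorem mem_P_iff [T2Space S] [ConnectedSpace S] [Nonempty X.I] (hX : X.IsReduced) (x : S) : x ∈ P ↔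
    (∃ v, (X.kind v = Kind.prim ∨ X.kind v = Kind.enter) ∧ x ∈ X.disc (X.tgt v) '' square) ∨
      ∃ v, X.kind v ≠ Kind.ante ∧ x ∈ X.band v.1 '' square := by
  rw [X.mem_P]
  refine or_congr ⟨?_, ?_⟩ ⟨?_, ?_⟩
  · rintro ⟨c, hc, hx⟩
    obtain ⟨v, rfl⟩ := X.exists_tgt c
    exact ⟨v, (inPC_tgt_iff hX v).1 hc, hx⟩
  · rintro ⟨v, hv, hx⟩
    exact ⟨_, (inPC_tgt_iff hX v).2 hv, hx⟩
  · rintro ⟨i, hi, hx⟩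
    exact ⟨(i, 1), (inPI_iff hX (i, 1)).1 hi, hx⟩
  · rintro ⟨v, hv, hx⟩
    exact ⟨v.1, (inPI_iff hX v).2 hv, hx⟩

theorem pt_flip_ne (v : X.I × ℤˣ) : F.pt (X.flip v) ≠ F.pt v := fun h =>
  X.flip_ne v (F.pt_injective h)

end

section

variable {S : Type*} [TopologicalSpace S] [T2Space S] [CompactSpace S] [ConnectedSpace S]
  [ChartedSpace (EuclideanHalfSpace 2) S]
  {S' : Type*} [TopologicalSpace S'] [T2Space S'] [ConnectedSpace S']
  [ChartedSpace (EuclideanHalfSpace 2) S']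
  {P : Set S} {P' : Set S'} {H : HandleStructure P} {H' : HandleStructure P'}
  {X : MarkedRibbon H} {X' : MarkedRibbon H'}

theorem exists_homeo_of_nonempty [Nonempty X.I] (hX : X.IsReduced) (hX' : X'.IsReduced)
    {A A' : Slice} (hA : H.IsSlice A) (hA' : H'.IsSlice A') (hAA' : A.Isomorphic A') :
    ∃ f : S ≃ₜ S', f '' P = P' := by
  obtain ⟨φ, h1, h2, h3, h4, h5⟩ := hA
  obtain ⟨φ', h1', h2', h3', h4', h5'⟩ := hA'
  obtain ⟨f, f1, f2, f3, f4⟩ := hAA'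
  obtain ⟨F⟩ := X.exists_frame φ h1 fun v => X.positive v.1 v.2
  obtain ⟨F'⟩ := X'.exists_frame φ' h1' fun v => X'.positive v.1 v.2
  let D := diagram F hX (range A.marker) (by rintro _ ⟨m, rfl⟩; exact h4 m)
    (fun C hC => by
      obtain ⟨m, hm, -⟩ := h5 C hC
      exact ⟨_, mem_range_self m, hm⟩)
  let D' := diagram F' hX' (range A'.marker) (by rintro _ ⟨m, rfl⟩; exact h4' m)
    (fun C hC => by
      obtain ⟨m, hm, -⟩ := h5' C hC
      exact ⟨_, mem_range_self m, hm⟩)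
  rw [antecedentPairs_eq F h2, antecedentPairs_eq F' h2'] at f2
  rw [primaryPairs_eq F h3, primaryPairs_eq F' h3'] at f3
  have finv : ∀ {Q : Set (Set (Fin A.n × Circle))} {Q' : Set (Set (Fin A'.n × Circle))},
      image f '' Q = Q' → image f.symm '' Q' ⊆ Q := by
    rintro Q _ rfl _ ⟨_, ⟨s, hs, rfl⟩, rfl⟩
    simpa [image_image] using hs
  have key : ∀ v : X.I × ℤˣ, (X.kind v).IsCore → ∃ v' : X'.I × ℤˣ, X'.kind v' = X.kind v ∧
      F'.pt v' = f (F.pt v) ∧ F'.pt (X'.flip v') = f (F.pt (X.flip v)) := by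
    rintro v (h | h)
    · rw [h]
      exact exists_pair X'.flip_flip (pt_flip_ne F) f.injective (K := fun v => X.kind v = Kind.prim)
        (K' := fun v => X'.kind v = Kind.prim)
        (fun v hv => by rw [X'.kind_flip, hv]; rfl) f3.subset h
    · rw [h]
      exact exists_pair X'.flip_flip (pt_flip_ne F) f.injective (K := fun v => X.kind v = Kind.ante)
        (K' := fun v => X'.kind v = Kind.ante)
        (fun v hv => by rw [X'.kind_flip, hv]; rfl) f2.subset h
  have key' : ∀ v' : X'.I × ℤˣ, (X'.kind v').IsCore → ∃ v : X.I × ℤˣ, X.kind v = X'.kind v' ∧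
      F.pt v = f.symm (F'.pt v') := by
    rintro v (h | h)
    · rw [h]
      obtain ⟨w, hw, e, -⟩ := exists_pair X.flip_flip (pt_flip_ne F') f.symm.injective
        (K := fun v => X'.kind v = Kind.prim) (K' := fun v => X.kind v = Kind.prim)
        (fun v hv => by rw [X.kind_flip, hv]; rfl) (finv f3) h
      exact ⟨w, hw, e⟩
    · rw [h]
      obtain ⟨w, hw, e, -⟩ := exists_pair X.flip_flip (pt_flip_ne F') f.symm.injective
        (K := fun v => X'.kind v = Kind.ante) (K' := fun v => X.kind v = Kind.ante)
        (fun v hv => by rw [X.kind_flip, hv]; rfl) (finv f2) h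
      exact ⟨w, hw, e⟩
  obtain ⟨i, hi⟩ := X.exists_core
  have hcore : (X.kind (i, 1)).IsCore := by
    by_cases h : X.inPI i
    · exact Or.inl (X.kind_prim_iff.2 ⟨hi, h⟩)
    · exact Or.inr (X.kind_ante_iff.2 ⟨hi, h⟩)
  have : Nonempty (X'.I × ℤˣ) := ⟨(key _ hcore).choose⟩
  -- Pairs of the slice are unordered, so it is `exists_pair` that sends the two sides of a core to
  -- the two sides of a core.
  choose! μ μ1 μ2 μ3 using key
  have μ4 : ∀ v, (X.kind v).IsCore → μ (X.flip v) = X'.flip (μ v) := fun v hv =>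
    F'.pt_injective (by
      rw [μ3 v hv]
      exact μ2 _ (by rw [X.kind_flip]; exact Kind.swap_isCore.2 hv))
  let E : Diagram.CoreIso D D' :=
    { f := f
      map := μ
      oriented := f1
      injective := f.injective
      image_marks := f4
      kind_map := μ1
      pt_map := μ2
      map_flip := μ4
      surj := fun v' hv' => by
        obtain ⟨v, h1, h2⟩ := key' v' hv'
        have h3 : (X.kind v).IsCore := h1 ▸ hv'
        exact ⟨v, h3, F'.pt_injective (by rw [μ2 v h3, h2, f.apply_symm_apply])⟩ }
  obtain ⟨β, β1, β2, β3, β4⟩ : ∃ β : X.I × ℤˣ → X'.I × ℤˣ, Function.Bijective β ∧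
      (∀ v, β (X.flip v) = X'.flip (β v)) ∧ (∀ v, β (F.nx v) = F'.nx (β v)) ∧
      ∀ v, X'.kind (β v) = X.kind v := E.exists_extension
  obtain ⟨g, hg⟩ := F.exists_homeo F' (β := β) β1 β2 β3
  have : Nonempty X'.I := ⟨(β (i, 1)).1⟩
  refine ⟨g, ?_⟩
  ext y
  obtain ⟨x, rfl⟩ := g.surjective y
  -- Membership of a disc or band in `P` can be read off from the kinds of its sides, and `β`
  -- preserves kinds.
  rw [g.injective.mem_set_image, mem_P_iff hX, mem_P_iff hX']
  refine or_congr ⟨?_, ?_⟩ ⟨?_, ?_⟩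
  · rintro ⟨v, hv, hx⟩
    exact ⟨β v, by rwa [β4], (hg v).2 ▸ mem_image_of_mem _ hx⟩
  · rintro ⟨w, hw, hx⟩
    obtain ⟨v, rfl⟩ := β1.2 w
    rw [β4] at hw
    rw [← (hg v).2, g.injective.mem_set_image] at hx
    exact ⟨v, hw, hx⟩
  · rintro ⟨v, hv, hx⟩
    exact ⟨β v, by rwa [β4], (hg v).1 ▸ mem_image_of_mem _ hx⟩
  · rintro ⟨w, hw, hx⟩
    obtain ⟨v, rfl⟩ := β1.2 w
    rw [β4] at hw
    rw [← (hg v).1, g.injective.mem_set_image] at hx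
    exact ⟨v, hw, hx⟩

theorem exists_homeo_of_isEmpty [IsEmpty X.I] [IsEmpty X'.I] : ∃ f : S ≃ₜ S', f '' P = P' := by
  obtain ⟨c, hc⟩ := exists_disc_eq_univ (X := X)
  obtain ⟨c', hc'⟩ := exists_disc_eq_univ (X := X')
  have hne : Nonempty S' := inferInstance
  obtain ⟨f, f1, f2, f3⟩ := exists_glue (ι := Unit) (K := fun _ => square)
    (fun _ => isCompact_square) (p := fun _ => X.disc c) (q := fun _ => X'.disc c')
    (fun _ => X.disc_cont c) (fun _ => X'.disc_cont c') (fun _ _ s hs t ht => by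
      rw [X.disc_eq_iff hs ht, X'.disc_eq_iff hs ht]; simp)
  rw [iUnion_const, hc] at f1 f2
  have hsurj : Function.Surjective f := by
    intro y
    obtain ⟨s, hs, rfl⟩ := hc' ▸ mem_univ y
    exact ⟨_, f3 () s hs⟩
  let e : S ≃ S' := Equiv.ofBijective f ⟨injOn_univ.1 f2, hsurj⟩
  have he : Continuous e := continuousOn_univ.1 f1
  exact ⟨he.homeoOfEquivCompactToT2, by
    rw [X.eq_empty_of_isEmpty, X'.eq_empty_of_isEmpty, image_empty]⟩

end

section

variable {S : Type*} [TopologicalSpace S] [ChartedSpace (EuclideanHalfSpace 2) S]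
  {S' : Type*} [TopologicalSpace S'] [ChartedSpace (EuclideanHalfSpace 2) S']
  {P : Set S} {P' : Set S'} {H : HandleStructure P} {H' : HandleStructure P'}
  {X : MarkedRibbon H} {X' : MarkedRibbon H'}

/-- Having no handles at all is visible in the slice. -/
theorem isEmpty_of_isomorphic [IsEmpty X.I] {A A' : Slice} (hA : H.IsSlice A)
    (hA' : H'.IsSlice A') (hAA' : A.Isomorphic A') : IsEmpty X'.I := by
  rw [← not_nonempty_iff]
  intro h
  obtain ⟨i, hi⟩ := X'.exists_core
  obtain ⟨φ, -, h2, h3, -⟩ := hA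
  obtain ⟨φ', -, h2', h3', -⟩ := hA'
  obtain ⟨f, -, f2, f3, -⟩ := hAA'
  by_cases hP : X'.inPI i
  · have h4 : A.primaryPairs = ∅ := by
      rw [← image_eq_empty, h3, ← X.primaries]
      exact eq_empty_of_forall_notMem fun s ⟨i, _⟩ => isEmptyElim i
    rw [h4, image_empty] at f3
    rw [← f3, image_empty, ← X'.primaries] at h3'
    exact eq_empty_iff_forall_notMem.1 h3'.symm _ ⟨i, hi, hP, rfl⟩
  · have h4 : A.antecedentPairs = ∅ := by
      rw [← image_eq_empty, h2, ← X.antecedents]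
      exact eq_empty_of_forall_notMem fun s ⟨i, _⟩ => isEmptyElim i
    rw [h4, image_empty] at f2
    rw [← f2, image_empty, ← X'.antecedents] at h2'
    exact eq_empty_iff_forall_notMem.1 h2'.symm _ ⟨i, hi, hP, rfl⟩

end

end MarkedRibbon

end SurfaceSlices

theorem mainTheorem7
    {S : Type*} [TopologicalSpace S] [T2Space S] [CompactSpace S] [ConnectedSpace S]
    [ChartedSpace (EuclideanHalfSpace 2) S] [SurfaceSlices.OrientedSurface S]
    {S' : Type*} [TopologicalSpace S'] [T2Space S'] [CompactSpace S'] [ConnectedSpace S']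
    [ChartedSpace (EuclideanHalfSpace 2) S'] [SurfaceSlices.OrientedSurface S']
    (P : Set S) (P' : Set S')
    (H : SurfaceSlices.HandleStructure P) (H' : SurfaceSlices.HandleStructure P')
    (A A' : SurfaceSlices.Slice) (hA : H.IsSlice A) (hA' : H'.IsSlice A')
    (hAA' : A.Isomorphic A') :
    ∃ f : S ≃ₜ S', f '' P = P' := by
  obtain ⟨X₀⟩ := H.exists_ribbon
  obtain ⟨X₀'⟩ := H'.exists_ribbon
  obtain ⟨X, hX⟩ := X₀.exists_reduced
  obtain ⟨X', hX'⟩ := X₀'.exists_reduced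
  -- The case without bands is separate because discs are otherwise addressed through the sides that
  -- end in them.
  rcases isEmpty_or_nonempty X.I with h | h
  · have := SurfaceSlices.MarkedRibbon.isEmpty_of_isomorphic (X := X) (X' := X') hA hA' hAA'
    exact SurfaceSlices.MarkedRibbon.exists_homeo_of_isEmpty (X := X) (X' := X')
  · exact SurfaceSlices.MarkedRibbon.exists_homeo_of_nonempty hX hX' hA hA' hAA'
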